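/- Model. A network is a finite connected simple graph $G=(V,E)$ with $n=|V|$ vertices, a device at each vertex. Time is divided into slots that all devices count from $0$. In each slot each device either sends a message (of any kind), or listens, or is idle; sending and listening cost one unit of energy each, idling and local computation are free, and only listeners get feedback. In the model $\mathsf{No\text{-}CD}$ a listener receives $m'$ if exactly one of its neighbors sends and that neighbor sends $m'$, and hears silence if no neighbor or at least two neighbors send. In the model $\mathsf{LOCAL}$ a listener receives the messages of all neighbors that send. All devices run the same algorithm, which may depend on $n$; each device has its own string of independent fair random bits (finitely many, a number fixed by the algorithm), and knows nothing else about $G$ and its position in it. In the problem $\mathsf{Broadcast}$ a source vertex $s\in V$ initially holds a message $m\in M$, where $M$ is any set of possible messages, every other vertex gets no input, and the algorithm succeeds if every vertex outputs $m$ at the end. The time of the algorithm is its number of slots, and its energy cost is the largest energy spent by any one vertex. Theorem. (1) For all $\Delta, c\in\mathbb{N}$ there is a constant $C>0$ such that for every $n$ and every message set $M$ there is a randomized $\mathsf{No\text{-}CD}$ algorithm that runs for at most $C\,n\log n$ slots and for which the following holds on every connected graph with $n$ vertices and maximum degree at most $\Delta$, for every source $s$ and every message $m\in M$: every vertex always spends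 at most $C\log n$ energy, and with probability at least $1-n^{-c}$ the algorithm solves $\mathsf{Broadcast}$. (2) The energy bound is matched by a lower bound on path graphs, even in $\mathsf{LOCAL}$: let $n\ge 1$, let $A$ be any randomized $\mathsf{LOCAL}$ algorithm (of any running time), and let $S$ be a finite set of $k\ge 1$ possible messages. If an endpoint of the $n$-vertex path is the source and its message is drawn uniformly at random from $S$, then the probability that $A$ solves $\mathsf{Broadcast}$ while every vertex spends less than $\frac15\log_2 n$ energy is at most $\frac12+\frac1{2k}$. -/

import Mathlib

/-!
Synchronous radio networks in which a device pays one unit of energy for every slot in which it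
sends or listens, and the Broadcast problem on them.
-/

namespace Radio

/-- The two reception rules that are used: no collision detection, and `LOCAL` (no collisions). -/
inductive Model where
  | noCD
  | LOCAL

/-- What a listener perceives. In `noCD` it is a message, or `none` (silence); in `LOCAL` it is the
multiset of all messages sent by neighbours. -/
def Model.Obs : Model → Type → Type
  | .noCD, Msg => Option Msg
  | .LOCAL, Msg => Multiset Msg

open Classical in
/-- Reception without collision detection: the message `a` if exactly one message is sent, namely
`a`, and `none` (silence) if no message or at least two messages are sent. -/
noncomputable def receive {Msg : Type} (ms : Multiset Msg) : Option Msg :=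
  if h : ∃ a, ms = {a} then some h.choose else none

theorem receive_singleton {Msg : Type} (a : Msg) : receive ({a} : Multiset Msg) = some a := by
  have h : ∃ b, ({a} : Multiset Msg) = {b} := ⟨a, rfl⟩
  have h2 : a = h.choose := Multiset.singleton_inj.mp h.choose_spec
  rw [receive, dif_pos h, ← h2]

theorem receive_of_card_ne_one {Msg : Type} (ms : Multiset Msg)
    (hms : Multiset.card ms ≠ 1) : receive ms = none := by
  have h : ¬ ∃ b, ms = {b} := by
    rintro ⟨b, rfl⟩
    simp at hms
  rw [receive, dif_neg h]

/-- The perception of a listener, given the multiset of the messages sent by its neighbours in this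
slot. -/
noncomputable def Model.hear {Msg : Type} : (c : Model) → Multiset Msg → c.Obs Msg
  | .noCD, ms => receive ms
  | .LOCAL, ms => ms

/-- What a device does in one slot. A device cannot send and listen in the same slot. -/
inductive Action (Msg : Type) where
  | send (a : Msg)
  | listen
  | idle

/-- The message that is sent, if any. -/
def Action.sent {Msg : Type} : Action Msg → Option Msg
  | .send a => some a
  | _ => none

/-- A randomized protocol for broadcasting an element of `M`. All devices run the same protocol.
A device starts with its input (the message at the source, nothing elsewhere) and a private string
of fair random bits, and knows nothing about the graph. Local computation is free and unrestricted,
all devices agree on the number of the current slot, and messages may be of any kind. -/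
structure Protocol (c : Model) (M : Type) where
  /-- the messages that may be sent -/
  Msg : Type
  /-- the local states of a device -/
  State : Type
  /-- the number of private random bits of each device -/
  bits : ℕ
  /-- the running time, that is, the number of slots -/
  time : ℕ
  /-- the initial state, from the input and the random bits -/
  init : Option M → (Fin bits → Bool) → State
  /-- the action taken in a slot, from the number of the slot and the current state -/
  act : ℕ → State → Action Msg
  /-- the state after a slot, from the number of the slot, the state before it, and what was
  perceived (`none` if the device did not listen) -/
  step : ℕ → State → Option (c.Obs Msg) → State
  /-- the message that a device in this state holds for the broadcast message, if any -/
  out : State → Option M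

namespace Protocol

variable {c : Model} {M V : Type} [Fintype V]

/-- The random bits of all devices. -/
abbrev Bits (P : Protocol c M) (V : Type) : Type := V → Fin P.bits → Bool

open Classical in
/-- The messages sent by the neighbours of `v` in slot `t`, if `σ` gives the current states. -/
noncomputable def incoming (P : Protocol c M) (G : SimpleGraph V) (t : ℕ) (σ : V → P.State)
    (v : V) : Multiset P.Msg :=
  (Finset.univ.filter (fun u => G.Adj v u)).val.filterMap (fun u => (P.act t (σ u)).sent)

/-- The feedback that `v` gets in slot `t`: only listeners get any. -/
noncomputable def feedback (P : Protocol c M) (G : SimpleGraph V) (t : ℕ) (σ : V → P.State)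
    (v : V) : Option (c.Obs P.Msg) :=
  match P.act t (σ v) with
  | .listen => some (c.hear (P.incoming G t σ v))
  | _ => none

open Classical in
/-- The states of all devices before slot `t`, when `s` is the source, `m` is its message, and `ω`
gives the random bits. -/
noncomputable def run (P : Protocol c M) (G : SimpleGraph V) (s : V) (m : M) (ω : P.Bits V) :
    ℕ → V → P.State
  | 0 => fun v => P.init (if v = s then some m else none) (ω v)
  | t + 1 => fun v =>
      P.step t (P.run G s m ω t v) (P.feedback G t (P.run G s m ω t) v)

open Classical in
/-- The energy spent by `v`: the number of slots in which `v` sends or listens. -/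
noncomputable def energy (P : Protocol c M) (G : SimpleGraph V) (s : V) (m : M) (ω : P.Bits V)
    (v : V) : ℕ :=
  ((Finset.range P.time).filter (fun t => P.act t (P.run G s m ω t v) ≠ .idle)).card

/-- Broadcast succeeds: at the end every device knows the message of the source. -/
def Succeeds (P : Protocol c M) (G : SimpleGraph V) (s : V) (m : M) (ω : P.Bits V) : Prop :=
  ∀ v, P.out (P.run G s m ω P.time v) = some m

open Classical in
/-- The probability of an event, all random bits of all devices being fair and independent. -/
noncomputable def prob (P : Protocol c M) (A : P.Bits V → Prop) : ℝ :=
  ((Finset.univ.filter A).card : ℝ) / (Fintype.card (P.Bits V) : ℝ)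

end Protocol

end Radio

/-! Lower bound. Fix the random bits of a block of consecutive devices. The block is a wall until
`θ` if no information crosses it in the first `θ` slots, whatever surrounds it. A device between two
walls until `θ` evolves independently of the outside up to `θ`, and from then on until it next
listens. If it stays deaf almost until `θ'`, then wall, device and wall together form a wall until
`θ'` (`Wall.combine`).

Walls are searched for by adaptive readers of independent random letters. Suppose that `t` finds
walls until `θ` at expected cost `c`. Let `θ' ≤ T` be the largest time for which two outcomes of `t`
with a letter between them are quiet until `θ'` with probability at least 1/2. Repeating this trial
until it succeeds and then appending one more outcome of `t` costs at most `2(2c + 1) + c = 5c + 2`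
letters on average. If `θ' < T`, then by maximality the middle device listens in `[θ, θ')` with
probability above 1/2. The new words begin and end with outcomes of `t`, so a device between two new
words has a neighbourhood with the same law as before, and its expected number of listening slots by
`θ'` exceeds the old value by more than 1/2 (`evBetween_extend`, `SearchState.step`). With at most
`b` listening slots per device the search reaches `T` within `2b` stages, at expected cost at most
`25^b / 2` (`exists_findsWall`). By Markov's inequality, if `25^b ≤ k + 1`, then the `k` inner
vertices of a path contain a wall with probability at least 1/2. In that case the last device ends
in the same state for all messages, so it is right for at most one of them.

Upper bound. Every device uses a long random string both as its identifier and as its supply of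
random choices. If the strings are distinct, they may be renamed to vertex names (`exec_simulates`,
`simulates_program`). Time is divided into rounds of `K` slots, one for each colour. With `K` of
order `Δ²`, logarithmically many rounds teach each device its neighbours (`avg_unknown_le`) and
yield a colouring that separates vertices at distance at most two (`Colouring.attempt`,
`avg_uncoloured_le`). From then on there are no harmful collisions (`next_cast`).

The devices then maintain clusters, which are rooted trees with distance labels, initially
singletons. In a merging step every root has a coin, which all members can read off from the
identifier of the root. Clusters with coin true keep their labels; a cluster with coin false that
touches one of them is relabelled from the point of contact, by a sweep up to its root and a sweep
down to its members (`exec_merge`). A cluster that is not alone disappears with probability at least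
1/4 (`avg_excess_le`), so logarithmically many steps leave a single cluster, through which the
message is spread in the same way (`exec_startMsg_spread`). A sweep takes `n` rounds, but a device
is awake only in the at most two rounds that involve its label (`awakeCount_spread_le`); hence the
energy is logarithmic although the time is of order `n log n`. -/

/-! ### Synchronous dynamics on a line -/

/-- A synchronous dynamics on the two-sided line whose cells only react to their two neighbours
when they listen, and may listen at most `fuel` times. -/
structure LineDyn (Q : Type) where
  nxt : ℕ → Q → Q → Q → Q
  lis : ℕ → Q → Prop
  dead : Q
  fuel : Q → ℕ
  nxt_eq_of_not_lis : ∀ {t q}, ¬ lis t q → ∀ a b a' b', nxt t a q b = nxt t a' q b'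
  not_lis_dead : ∀ t, ¬ lis t dead
  nxt_dead : ∀ t a b, nxt t a dead b = dead
  fuel_nxt_le : ∀ t a q b, fuel (nxt t a q b) ≤ fuel q
  fuel_nxt_lt : ∀ t a q b, lis t q → fuel (nxt t a q b) < fuel q

namespace LineDyn

variable {Q : Type} (D : LineDyn Q)

/-- The configuration at time `t`. -/
def run (D : LineDyn Q) (σ : ℤ → Q) : ℕ → ℤ → Q
  | 0 => σ
  | t + 1 => fun i => D.nxt t (run D σ t (i - 1)) (run D σ t i) (run D σ t (i + 1))

theorem run_shift (σ : ℤ → Q) (a : ℤ) (t : ℕ) (i : ℤ) :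
    D.run (fun j => σ (j + a)) t i = D.run σ t (i + a) := by
  induction t generalizing i with
  | zero => rfl
  | succ t ih =>
    simp only [run, ih]
    congr 2 <;> ring

theorem run_dead (σ : ℤ → Q) (i : ℤ) (h : σ i = D.dead) (t : ℕ) : D.run σ t i = D.dead := by
  induction t with
  | zero => exact h
  | succ t ih => simp only [run, ih, D.nxt_dead]

/-- The configuration `σ` shows the word `L` from cell `a` on. -/
def Holds (σ : ℤ → Q) (a : ℤ) (L : List Q) : Prop :=
  ∀ (j : ℕ) (q : Q), L[j]? = some q → σ (a + j) = q

theorem Holds.left {σ : ℤ → Q} {a : ℤ} {L₁ L₂ : List Q} (h : Holds σ a (L₁ ++ L₂)) :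
    Holds σ a L₁ := by
  intro j q hj
  refine h j q ?_
  have hlt : j < L₁.length := by
    by_contra hc
    rw [List.getElem?_eq_none (by omega)] at hj
    cases hj
  rw [List.getElem?_append_left hlt, hj]

theorem Holds.right {σ : ℤ → Q} {a : ℤ} {L₁ L₂ : List Q} (h : Holds σ a (L₁ ++ L₂)) :
    Holds σ (a + L₁.length) L₂ := by
  intro j q hj
  have := h (L₁.length + j) q (by rw [List.getElem?_append_right (by omega)]; simpa using hj)
  rw [← this]; congr 1; push_cast; ring

theorem Holds.head {σ : ℤ → Q} {a : ℤ} {q : Q} {L : List Q} (h : Holds σ a (q :: L)) :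
    σ a = q := by
  simpa using h 0 q (by simp)

theorem Holds.tail {σ : ℤ → Q} {a : ℤ} {q : Q} {L : List Q} (h : Holds σ a (q :: L)) :
    Holds σ (a + 1) L := by
  simpa using Holds.right (L₁ := [q]) h

theorem Holds.congr {σ σ' : ℤ → Q} {a : ℤ} {L : List Q} (h : Holds σ a L)
    (hs : ∀ i, a ≤ i → i < a + L.length → σ' i = σ i) : Holds σ' a L := by
  intro j q hj
  have hlt : j < L.length := by
    by_contra hc
    rw [List.getElem?_eq_none (by omega)] at hj
    cases hj
  rw [hs _ (by omega) (by omega), h j q hj]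

/-- Within the first `θ` slots no information crosses a block of cells that start with the
states `L`, whatever surrounds the block. -/
def Wall (θ : ℕ) (L : List Q) : Prop :=
  ∀ (a : ℤ) (σ σ' : ℤ → Q), Holds σ a L → Holds σ' a L →
    ((∀ i, a + L.length ≤ i → σ i = σ' i) →
      ∀ t ≤ θ, ∀ i, a + L.length ≤ i → D.run σ t i = D.run σ' t i) ∧
    ((∀ i, i < a → σ i = σ' i) → ∀ t ≤ θ, ∀ i, i < a → D.run σ t i = D.run σ' t i)

/-! ### Blocks that stop information. -/

variable {D}

theorem Wall.mono {θ θ' : ℕ} {L : List Q} (h : D.Wall θ L) (hθ : θ' ≤ θ) : D.Wall θ' L :=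
  fun a σ σ' h1 h2 => ⟨fun h3 t ht => (h a σ σ' h1 h2).1 h3 t (ht.trans hθ),
    fun h3 t ht => (h a σ σ' h1 h2).2 h3 t (ht.trans hθ)⟩

theorem wall_zero (L : List Q) : D.Wall 0 L := by
  intro a σ σ' _ _
  refine ⟨fun h t ht i hi => ?_, fun h t ht i hi => ?_⟩ <;>
  · obtain rfl : t = 0 := by omega
    exact h i hi

theorem Holds.eq_of_mem {σ σ' : ℤ → Q} {a : ℤ} {L : List Q} (h : Holds σ a L) (h' : Holds σ' a L)
    (i : ℤ) (h1 : a ≤ i) (h2 : i < a + L.length) : σ i = σ' i := by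
  obtain ⟨j, rfl⟩ : ∃ j : ℕ, i = a + j := ⟨(i - a).toNat, by omega⟩
  have hj : L[j]? = some L[j] := List.getElem?_eq_getElem (by omega)
  rw [h j _ hj, h' j _ hj]

/-- The padding shows the same letters in both configurations, so configurations that agree on one
side of the long block also agree on that side of the inner wall. -/
theorem Wall.append {θ : ℕ} {L : List Q} (h : D.Wall θ L) (L₁ L₂ : List Q) :
    D.Wall θ (L₁ ++ (L ++ L₂)) := by
  intro a σ σ' h1 h2
  have hw := h (a + L₁.length) σ σ' h1.right.left h2.right.left
  constructor
  · intro h3 t ht i hi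
    simp only [List.length_append, Nat.cast_add] at hi h3
    refine hw.1 (fun i hi => ?_) t ht i (by omega)
    by_cases hc : a + L₁.length + L.length + L₂.length ≤ i
    · exact h3 i (by omega)
    · exact h1.right.right.eq_of_mem h2.right.right i hi (by omega)
  · intro h3 t ht i hi
    refine hw.2 (fun i hi => ?_) t ht i (by omega)
    by_cases hc : i < a
    · exact h3 i hc
    · exact h1.left.eq_of_mem h2.left i (by omega) hi

theorem Wall.append_right {θ : ℕ} {L : List Q} (h : D.Wall θ L) (L₂ : List Q) :
    D.Wall θ (L ++ L₂) := by simpa using h.append [] L₂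

theorem Wall.append_left {θ : ℕ} {L : List Q} (h : D.Wall θ L) (L₁ : List Q) :
    D.Wall θ (L₁ ++ L) := by simpa using h.append L₁ []

/-- Between two walls a cell evolves independently of the surroundings. -/
theorem run_center_eq {θ : ℕ} {A B : List Q} {w : Q} (hA : D.Wall θ A) (hB : D.Wall θ B)
    {a : ℤ} {σ σ' : ℤ → Q} (h : Holds σ a (A ++ w :: B)) (h' : Holds σ' a (A ++ w :: B))
    (t : ℕ) (ht : t ≤ θ) : D.run σ t (a + A.length) = D.run σ' t (a + A.length) := by
  set c : ℤ := a + A.length with hc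
  -- A hybrid configuration: it differs from `σ` only on the left and from `σ'` only on the right,
  -- so each wall is needed for one comparison.
  let ρ : ℤ → Q := fun i => if i < c then σ' i else σ i
  have h1 : D.run σ t c = D.run ρ t c := by
    refine (hA a σ ρ h.left (h'.left.congr ?_)).1 (fun i hi => ?_) t ht c le_rfl
    · intro i _ hi; simp only [ρ]; rw [if_pos (by omega)]
    · simp only [ρ]; rw [if_neg (by omega)]
  have h2 : D.run ρ t c = D.run σ' t c := by
    refine (hB (c + 1) ρ σ' (h.right.tail.congr ?_) h'.right.tail).2 (fun i hi => ?_) t ht c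
      (by omega)
    · intro i hi _; simp only [ρ]; rw [if_neg (by omega)]
    · simp only [ρ]
      split_ifs with hi'
      · rfl
      · obtain rfl : i = c := by omega
        rw [h.right.head, h'.right.head]
  rw [h1, h2]

/-- After `θ` the walls may leak, but a cell that does not listen ignores its neighbours. Deafness
in one of the two configurations is enough, since the states agree as long as it lasts. -/
theorem run_center_eq_of_not_lis {θ : ℕ} {A B : List Q} {w : Q} (hA : D.Wall θ A)
    (hB : D.Wall θ B) {a : ℤ} {σ σ' : ℤ → Q} (h : Holds σ a (A ++ w :: B))
    (h' : Holds σ' a (A ++ w :: B)) (t : ℕ)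
    (hl : ∀ r, θ ≤ r → r < t → ¬ D.lis r (D.run σ r (a + A.length))) :
    D.run σ t (a + A.length) = D.run σ' t (a + A.length) := by
  induction t with
  | zero => exact run_center_eq hA hB h h' 0 (Nat.zero_le _)
  | succ t ih =>
    by_cases ht : t + 1 ≤ θ
    · exact run_center_eq hA hB h h' _ ht
    · have e := ih (fun r h1 h2 => hl r h1 (by omega))
      have hn := hl t (by omega) (by omega)
      simp only [run]
      rw [← e]
      exact D.nxt_eq_of_not_lis hn _ _ _ _

/-- Later listening may depend on the surroundings, but the first listening slot from `θ` on does
not: up to it the two evolutions agree. -/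
theorem lis_center_congr {θ θ' : ℕ} {A B : List Q} {w : Q} (hA : D.Wall θ A)
    (hB : D.Wall θ B) {a : ℤ} {σ σ' : ℤ → Q} (h : Holds σ a (A ++ w :: B))
    (h' : Holds σ' a (A ++ w :: B))
    (hex : ∃ r, θ ≤ r ∧ r < θ' ∧ D.lis r (D.run σ r (a + A.length))) :
    ∃ r, θ ≤ r ∧ r < θ' ∧ D.lis r (D.run σ' r (a + A.length)) := by
  by_contra hc
  push Not at hc
  obtain ⟨r, h1, h2, h3⟩ := hex
  rw [← run_center_eq_of_not_lis hA hB h' h r (fun s h4 h5 => hc s h4 (by omega))] at h3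
  exact hc r h1 h2 h3

/-- A cell between two walls that stays deaf until the slot before the last turns them into a wall
for a longer time. -/
theorem Wall.combine {θ θ' : ℕ} {A B : List Q} {w : Q} (hA : D.Wall θ A)
    (hB : D.Wall θ B) {a₀ : ℤ} {α : ℤ → Q} (hα : Holds α a₀ (A ++ w :: B))
    (hl : ∀ r, θ ≤ r → r + 1 < θ' → ¬ D.lis r (D.run α r (a₀ + A.length))) :
    D.Wall θ' (A ++ w :: B) := by
  intro a σ σ' h h'
  -- The cells next to the middle cell see at time `t + 1` its state at time `t`. Hence its state
  -- has to be forced only up to time `θ' - 1`, and listening in slot `θ' - 1` does no harm.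
  have key : ∀ σ : ℤ → Q, Holds σ a (A ++ w :: B) → ∀ t, t + 1 ≤ θ' →
      D.run σ t (a + A.length) = D.run α t (a₀ + A.length) := by
    intro σ h t ht
    have hα' : Holds (fun j => α (j + (a₀ - a))) a (A ++ w :: B) := by
      intro j q hj
      have := hα j q hj
      rw [← this]; simp only; congr 1; ring
    have hs := D.run_shift α (a₀ - a)
    have e : a + A.length + (a₀ - a) = a₀ + A.length := by ring
    have := run_center_eq_of_not_lis hA hB hα' h t (fun r h1 h2 => by
      rw [hs, e]; exact hl r h1 (by omega))
    rw [← this, hs, e]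
  have kk : ∀ t, t + 1 ≤ θ' → D.run σ t (a + A.length) = D.run σ' t (a + A.length) :=
    fun t ht => by rw [key σ h t ht, key σ' h' t ht]
  have hlen : ((A ++ w :: B).length : ℤ) = A.length + 1 + B.length := by
    simp only [List.length_append, List.length_cons]; push_cast; ring
  constructor
  · intro h3 t ht
    have : ∀ i, a + A.length + 1 ≤ i → D.run σ t i = D.run σ' t i := by
      induction t with
      | zero =>
        intro i hi
        by_cases hc : a + (A ++ w :: B).length ≤ i
        · exact h3 i hc
        · exact h.eq_of_mem h' i (by omega) (by omega)
      | succ t ih =>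
        intro i hi
        have ih' := ih (by omega)
        have h0 : ∀ i, a + A.length ≤ i → D.run σ t i = D.run σ' t i := by
          intro i hi
          rcases hi.eq_or_lt with rfl | hi
          · exact kk t ht
          · exact ih' i (by omega)
        simp only [run]
        rw [h0 (i - 1) (by omega), h0 i (by omega), h0 (i + 1) (by omega)]
    intro i hi
    exact this i (by omega)
  · intro h3 t ht
    have : ∀ i, i < a + A.length → D.run σ t i = D.run σ' t i := by
      induction t with
      | zero =>
        intro i hi
        by_cases hc : i < a
        · exact h3 i hc
        · exact h.eq_of_mem h' i (by omega) (by omega)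
      | succ t ih =>
        intro i hi
        have ih' := ih (by omega)
        have h0 : ∀ i, i ≤ a + A.length → D.run σ t i = D.run σ' t i := by
          intro i hi
          rcases hi.eq_or_lt with rfl | hi
          · exact kk t ht
          · exact ih' i (by omega)
        simp only [run]
        rw [h0 (i - 1) (by omega), h0 i (by omega), h0 (i + 1) (by omega)]
    intro i hi
    exact this i (by omega)

/-- A dead cell never listens, so it is a quiet cell between two empty walls. Such a wall for every
duration is what a search that gives up can still return. -/
theorem wall_dead (θ : ℕ) : D.Wall θ [D.dead] := by
  have h : Holds (fun _ => D.dead) 0 ([] ++ D.dead :: []) := by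
    intro j q hj
    rcases j with _ | j <;> simp_all
  refine Wall.combine (A := []) (B := []) (wall_zero []) (wall_zero []) h ?_
  intro r _ _
  rw [D.run_dead (fun _ => D.dead) _ rfl]
  exact D.not_lis_dead r

/-! ### Counting the listening slots of one cell. -/

variable (D)

/-- The word `A ++ w :: B` with `w` in cell `0`, surrounded by dead cells. -/
def alone (A : List Q) (w : Q) (B : List Q) : ℤ → Q := fun i =>
  if -(A.length : ℤ) ≤ i then ((A ++ w :: B)[(i + A.length).toNat]?).getD D.dead else D.dead

theorem holds_alone (A : List Q) (w : Q) (B : List Q) :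
    Holds (D.alone A w B) (-(A.length : ℤ)) (A ++ w :: B) := by
  intro j q hj
  have e : (-(A.length : ℤ) + j + A.length).toNat = j := by omega
  simp only [alone]
  rw [if_pos (by omega), e, hj, Option.getD_some]

open Classical in
/-- The number of slots before `θ` in which cell `0` listens. -/
noncomputable def lisCount (σ : ℤ → Q) (θ : ℕ) : ℕ :=
  ((Finset.range θ).filter (fun t => D.lis t (D.run σ t 0))).card

theorem lisCount_succ_le (σ : ℤ → Q) (θ : ℕ) :
    D.lisCount σ θ + D.fuel (D.run σ θ 0) ≤ D.fuel (σ 0) := by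
  induction θ with
  | zero => simp [lisCount, run]
  | succ θ ih =>
    unfold lisCount at *
    rw [Finset.range_add_one, Finset.filter_insert]
    split_ifs with hl
    · rw [Finset.card_insert_of_notMem (by simp)]
      have := D.fuel_nxt_lt θ (D.run σ θ (0 - 1)) (D.run σ θ 0) (D.run σ θ (0 + 1)) hl
      simp only [run]
      omega
    · have := D.fuel_nxt_le θ (D.run σ θ (0 - 1)) (D.run σ θ 0) (D.run σ θ (0 + 1))
      simp only [run]
      omega

theorem lisCount_le (σ : ℤ → Q) (θ : ℕ) : D.lisCount σ θ ≤ D.fuel (σ 0) :=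
  (Nat.le_add_right _ _).trans (D.lisCount_succ_le σ θ)

theorem lisCount_lt {σ : ℤ → Q} {θ θ' : ℕ}
    (h : ∃ r, θ ≤ r ∧ r < θ' ∧ D.lis r (D.run σ r 0)) :
    D.lisCount σ θ + 1 ≤ D.lisCount σ θ' := by
  obtain ⟨r, h1, h2, h3⟩ := h
  refine Finset.card_lt_card ((Finset.ssubset_iff_of_subset ?_).2 ⟨r, by simp [h2, h3], by simp; omega⟩)
  intro s hs
  simp only [Finset.mem_filter, Finset.mem_range] at *
  exact ⟨by omega, hs.2⟩

theorem lisCount_mono {σ : ℤ → Q} {θ θ' : ℕ} (h : θ ≤ θ') :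
    D.lisCount σ θ ≤ D.lisCount σ θ' := by
  refine Finset.card_le_card fun s hs => ?_
  simp only [Finset.mem_filter, Finset.mem_range] at *
  exact ⟨by omega, hs.2⟩

end LineDyn

/-! ### Adaptive exploration of a random word -/

/-- A computation that reads letters one after the other. -/
inductive Explorer (β α : Type) : Type where
  | done (a : α)
  | read (f : β → Explorer β α)

namespace Explorer

variable {β α γ : Type}

/-- Sequential composition. -/
def bind : Explorer β α → (α → Explorer β γ) → Explorer β γ
  | done a, g => g a
  | read f, g => read fun b => bind (f b) g

/-- Every possible outcome satisfies `P`, which also sees the word that has been read. -/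
def Outcomes : Explorer β α → (List β → α → Prop) → Prop
  | done a, P => P [] a
  | read f, P => ∀ b, Outcomes (f b) fun l a => P (b :: l) a

/-- Run on a word; `none` if the word is too short. -/
def run : Explorer β α → List β → Option (α × List β)
  | done a, l => some (a, l)
  | read _, [] => none
  | read f, b :: l => run (f b) l

theorem Outcomes.mono {t : Explorer β α} {P R : List β → α → Prop} (h : t.Outcomes P)
    (hPR : ∀ l a, P l a → R l a) : t.Outcomes R := by
  induction t generalizing P R with
  | done a => exact hPR _ _ h
  | read f ih => exact fun b => ih b (h b) fun l a => hPR _ _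

theorem outcomes_bind {t : Explorer β α} {g : α → Explorer β γ} {P : List β → α → Prop}
    {R : List β → γ → Prop} (h : t.Outcomes P)
    (hg : ∀ l a, P l a → (g a).Outcomes fun l' c => R (l ++ l') c) : (t.bind g).Outcomes R := by
  induction t generalizing P R with
  | done a => exact hg _ _ h
  | read f ih => exact fun b => ih b (h b) fun l a hla => hg _ _ hla

theorem outcomes_true (t : Explorer β α) : t.Outcomes fun _ _ => True := by
  induction t with
  | done a => trivial
  | read f ih => exact fun b => ih b

theorem Outcomes.of_run {t : Explorer β α} {P : List β → α → Prop} (h : t.Outcomes P)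
    {ω rest : List β} {a : α} (hr : t.run ω = some (a, rest)) :
    ∃ l, ω = l ++ rest ∧ P l a := by
  induction t generalizing P ω with
  | done a' =>
    simp only [run, Option.some.injEq, Prod.mk.injEq] at hr
    obtain ⟨rfl, rfl⟩ := hr
    exact ⟨[], rfl, h⟩
  | read f ih =>
    cases ω with
    | nil => simp [run] at hr
    | cons b ω =>
      obtain ⟨l, rfl, hl⟩ := ih b (h b) hr
      exact ⟨b :: l, rfl, hl⟩

variable [Fintype β]

/-- The average of `F` over the letters. -/
noncomputable def avg {β : Type} [Fintype β] (F : β → ℝ) : ℝ := (∑ b, F b) / Fintype.card β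

theorem avg_mono {F G : β → ℝ} (h : ∀ b, F b ≤ G b) : avg F ≤ avg G :=
  div_le_div_of_nonneg_right (Finset.sum_le_sum fun b _ => h b) (Nat.cast_nonneg _)

theorem avg_add (F G : β → ℝ) : avg (fun b => F b + G b) = avg F + avg G := by
  simp only [avg, Finset.sum_add_distrib, add_div]

theorem avg_mul_left (c : ℝ) (F : β → ℝ) : avg (fun b => c * F b) = c * avg F := by
  simp only [avg, ← Finset.mul_sum, mul_div_assoc]

theorem avg_const [Nonempty β] (c : ℝ) : avg (fun _ : β => c) = c := by
  simp [avg]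

/-- The expectation of `F` of the outcome on a random word. -/
noncomputable def ev : Explorer β α → (α → ℝ) → ℝ
  | done a, F => F a
  | read f, F => avg fun b => ev (f b) F

/-- The expected number of letters that are read. -/
noncomputable def cost : Explorer β α → ℝ
  | done _ => 0
  | read f => 1 + avg fun b => cost (f b)

theorem ev_bind (t : Explorer β α) (g : α → Explorer β γ) (F : γ → ℝ) :
    (t.bind g).ev F = t.ev fun a => (g a).ev F := by
  induction t with
  | done a => rfl
  | read f ih => simp only [bind, ev, ih]

theorem ev_le_of_outcomes {t : Explorer β α} {P : List β → α → Prop} (h : t.Outcomes P)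
    {F G : α → ℝ} (hFG : ∀ l a, P l a → F a ≤ G a) : t.ev F ≤ t.ev G := by
  induction t generalizing P with
  | done a => exact hFG _ _ h
  | read f ih => exact avg_mono fun b => ih b (h b) fun l a => hFG _ _

theorem ev_mono (t : Explorer β α) {F G : α → ℝ} (hFG : ∀ a, F a ≤ G a) : t.ev F ≤ t.ev G :=
  ev_le_of_outcomes t.outcomes_true fun _ a _ => hFG a

theorem ev_congr_of_outcomes {t : Explorer β α} {P : List β → α → Prop} (h : t.Outcomes P)
    {F G : α → ℝ} (hFG : ∀ l a, P l a → F a = G a) : t.ev F = t.ev G :=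
  le_antisymm (ev_le_of_outcomes h fun l a hl => (hFG l a hl).le)
    (ev_le_of_outcomes h fun l a hl => (hFG l a hl).ge)

theorem ev_add (t : Explorer β α) (F G : α → ℝ) :
    t.ev (fun a => F a + G a) = t.ev F + t.ev G := by
  induction t with
  | done a => rfl
  | read f ih => simp only [ev, ih, avg_add]

theorem ev_mul_left (t : Explorer β α) (c : ℝ) (F : α → ℝ) :
    t.ev (fun a => c * F a) = c * t.ev F := by
  induction t with
  | done a => rfl
  | read f ih => simp only [ev, ih, avg_mul_left]

theorem ev_const [Nonempty β] (t : Explorer β α) (c : ℝ) : t.ev (fun _ => c) = c := by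
  induction t with
  | done a => rfl
  | read f ih => simp only [ev, ih, avg_const]

theorem cost_bind [Nonempty β] (t : Explorer β α) (g : α → Explorer β γ) :
    (t.bind g).cost = t.cost + t.ev fun a => (g a).cost := by
  induction t with
  | done a => simp [bind, cost, ev]
  | read f ih => simp only [bind, cost, ev, ih, avg_add]; ring

theorem cost_nonneg (t : Explorer β α) : 0 ≤ t.cost := by
  induction t with
  | done a => exact le_rfl
  | read f ih =>
    have : 0 ≤ avg fun b => (f b).cost := by
      unfold avg
      exact div_nonneg (Finset.sum_nonneg fun b _ => ih b) (Nat.cast_nonneg _)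
    simp only [cost]; linarith

/-- The average of `F` over all words of length `N`. -/
noncomputable def wordAvg (β : Type) [Fintype β] : ℕ → (List β → ℝ) → ℝ
  | 0, F => F []
  | N + 1, F => avg fun b => wordAvg β N fun l => F (b :: l)

theorem wordAvg_mono {N : ℕ} {F G : List β → ℝ} (h : ∀ l, l.length = N → F l ≤ G l) :
    wordAvg β N F ≤ wordAvg β N G := by
  induction N generalizing F G with
  | zero => exact h [] rfl
  | succ N ih => exact avg_mono fun b => ih fun l hl => h _ (by simp [hl])

theorem wordAvg_const [Nonempty β] (N : ℕ) (c : ℝ) : wordAvg β N (fun _ => c) = c := by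
  induction N with
  | zero => rfl
  | succ N ih => simp only [wordAvg, ih, avg_const]

/-- Markov's inequality for the number of letters that are read. -/
theorem wordAvg_run_none_le [Nonempty β] (t : Explorer β α) (N : ℕ) :
    wordAvg β N (fun l => if (t.run l).isNone then 1 else 0) * (N + 1) ≤ t.cost := by
  induction t generalizing N with
  | done a =>
    simp only [run, Option.isNone_some, Bool.false_eq_true, if_false, wordAvg_const, zero_mul, cost,
      le_refl]
  | read f ih =>
    cases N with
    | zero =>
      have : 0 ≤ avg fun b => (f b).cost := by
        have := (read f).cost_nonneg
        unfold avg
        exact div_nonneg (Finset.sum_nonneg fun b _ => (f b).cost_nonneg) (Nat.cast_nonneg _)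
      simp only [wordAvg, run, Option.isNone_none, if_true, cost]
      push_cast; linarith
    | succ N =>
      change (avg fun b => wordAvg β N fun l => if ((f b).run l).isNone then (1 : ℝ) else 0) *
        ((N + 1 : ℕ) + 1 : ℝ) ≤ 1 + avg fun b => (f b).cost
      -- The left side is `x * (N + 1) + x`: the first summand is bounded by the averaged inductive
      -- hypothesis, and `x ≤ 1` is paid for by the letter just read.
      generalize hx : (avg fun b => wordAvg β N fun l =>
        if ((f b).run l).isNone then (1 : ℝ) else 0) = x
      have h1 : x ≤ 1 := by
        rw [← hx]
        refine (avg_mono (G := fun _ => 1) fun b => ?_).trans (avg_const 1).le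
        refine (wordAvg_mono (G := fun _ => 1) fun l _ => ?_).trans (wordAvg_const N 1).le
        split_ifs <;> norm_num
      have h2 : x * (N + 1) ≤ avg fun b => (f b).cost := by
        rw [← hx, mul_comm, ← avg_mul_left]
        refine avg_mono fun b => ?_
        rw [mul_comm]
        exact ih b N
      push_cast
      linarith

/-- Restart `trial` until it reports success, at most `k` times; `giveUp` ends the word
otherwise. -/
def retry {β δ : Type} (trial : Explorer β (List δ × Bool)) (giveUp : List δ) :
    ℕ → List δ → Explorer β (List δ)
  | 0, acc => done (acc ++ giveUp)
  | k + 1, acc => trial.bind fun r =>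
      if r.2 then done (acc ++ r.1) else retry trial giveUp k (acc ++ r.1)

variable {δ : Type}

/-- One trial costs `c`, and with probability at most `1 - p` the remaining trials cost at most `c /
p` by induction; `c + (1 - p) c / p = c / p`. -/
theorem cost_retry_le [Nonempty β] (trial : Explorer β (List δ × Bool)) (giveUp : List δ) {p : ℝ}
    (hp : 0 < p) (hs : p ≤ trial.ev fun r => if r.2 then 1 else 0) (k : ℕ) (acc : List δ) :
    (retry trial giveUp k acc).cost ≤ trial.cost / p := by
  induction k generalizing acc with
  | zero => exact div_nonneg trial.cost_nonneg hp.le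
  | succ k ih =>
    simp only [retry, cost_bind]
    have h1 : (trial.ev fun r => (if r.2 then done (acc ++ r.1)
        else retry trial giveUp k (acc ++ r.1) : Explorer β (List δ)).cost) ≤
        trial.ev fun r => trial.cost / p + (-(trial.cost / p)) * (if r.2 then 1 else 0) := by
      refine ev_mono _ fun r => ?_
      by_cases hr : r.2
      · simp [hr, cost]
      · simpa [hr] using ih _
    rw [ev_add, ev_const, ev_mul_left] at h1
    have h2 : trial.cost / p * p ≤ trial.cost / p * trial.ev fun r => if r.2 then 1 else 0 :=
      mul_le_mul_of_nonneg_left hs (div_nonneg trial.cost_nonneg hp.le)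
    rw [div_mul_cancel₀ _ hp.ne'] at h2
    linarith

end Explorer

/-! ### Walls exist in long random words -/

namespace LineDyn

open Explorer

variable {Q β : Type} {D : LineDyn Q}

theorem lisCount_congr {θ : ℕ} {A B : List Q} {w : Q} (hA : D.Wall θ A) (hB : D.Wall θ B)
    {a : ℤ} {σ σ' : ℤ → Q} (h : Holds σ a (A ++ w :: B)) (h' : Holds σ' a (A ++ w :: B))
    (ha : a + A.length = 0) : D.lisCount σ θ = D.lisCount σ' θ := by
  unfold lisCount
  congr 1
  ext t
  simp only [Finset.mem_filter, Finset.mem_range]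
  refine and_congr_right fun ht => ?_
  have := run_center_eq hA hB h h' t ht.le
  rw [ha] at this
  rw [this]

theorem holds_alone_append (X A : List Q) (w : Q) (B Y : List Q) :
    Holds (D.alone (X ++ A) w (B ++ Y)) (-(A.length : ℤ)) (A ++ w :: B) := by
  have h : Holds (D.alone (X ++ A) w (B ++ Y)) (-((X ++ A).length : ℤ))
      (X ++ ((A ++ w :: B) ++ Y)) := by
    simpa using D.holds_alone (X ++ A) w (B ++ Y)
  have := h.right.left
  simp only [List.length_append, Nat.cast_add] at this
  rwa [show -((X.length : ℤ) + A.length) + X.length = -(A.length : ℤ) by ring] at this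

open Classical in
/-- The number of slots before `θ` in which the cell `w` between `A` and `B` listens, plus one if
it listens in some slot from `θ` on, but before `θ'`. -/
noncomputable def activity (D : LineDyn Q) (θ θ' : ℕ) (A : List Q) (w : Q) (B : List Q) : ℝ :=
  D.lisCount (D.alone A w B) θ +
    if ∃ r, θ ≤ r ∧ r < θ' ∧ D.lis r (D.run (D.alone A w B) r 0) then 1 else 0

/-- The walls next to `w` determine its behaviour before `θ` and whether it listens at all
afterwards. This invariance is the reason for counting only one listening slot from `θ` on. -/
theorem activity_append {θ θ' : ℕ} {A B : List Q} (hA : D.Wall θ A) (hB : D.Wall θ B) (w : Q)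
    (X Y : List Q) : D.activity θ θ' (X ++ A) w (B ++ Y) = D.activity θ θ' A w B := by
  have h1 := D.holds_alone_append X A w B Y
  have h2 := D.holds_alone A w B
  have h0 : -(A.length : ℤ) + A.length = 0 := by ring
  unfold activity
  rw [lisCount_congr hA hB h1 h2 h0]
  congr 1
  have e : (∃ r, θ ≤ r ∧ r < θ' ∧ D.lis r (D.run (D.alone (X ++ A) w (B ++ Y)) r 0)) ↔
      ∃ r, θ ≤ r ∧ r < θ' ∧ D.lis r (D.run (D.alone A w B) r 0) := by
    have i1 := lis_center_congr (θ' := θ') hA hB h1 h2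
    have i2 := lis_center_congr (θ' := θ') hA hB h2 h1
    rw [h0] at i1 i2
    exact ⟨i1, i2⟩
  by_cases he : ∃ r, θ ≤ r ∧ r < θ' ∧ D.lis r (D.run (D.alone A w B) r 0)
  · rw [if_pos (e.2 he), if_pos he]
  · rw [if_neg (mt e.1 he), if_neg he]

theorem activity_le {θ θ' : ℕ} (h : θ ≤ θ') (A : List Q) (w : Q) (B : List Q) :
    D.activity θ θ' A w B ≤ D.lisCount (D.alone A w B) θ' := by
  unfold activity
  split_ifs with hex
  · exact_mod_cast D.lisCount_lt hex
  · rw [add_zero]; exact_mod_cast D.lisCount_mono h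

variable (D) (live : β → Q) (N : ℕ)

/-- The cell `w` between `A` and `B` does not listen in the slots from `θ` on, until the slot
`θ' - 1` (exclusively). -/
def Quiet (θ θ' : ℕ) (A : List Q) (w : Q) (B : List Q) : Prop :=
  ∀ r, θ ≤ r → r + 1 < θ' → ¬ D.lis r (D.run (D.alone A w B) r 0)

open Classical in
/-- Two consecutive outcomes of `t` with one letter between them. -/
noncomputable def trial (t : Explorer β (List Q)) (θ θ' : ℕ) : Explorer β (List Q × Bool) :=
  t.bind fun A => read fun w => t.bind fun B =>
    done (A ++ live w :: B, decide (D.Quiet θ θ' A (live w) B))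

/-- Search for a block that is quiet from `θ` until `θ'`, and append another outcome of `t`. -/
noncomputable def extend (t : Explorer β (List Q)) (θ θ' : ℕ) : Explorer β (List Q) :=
  (retry (D.trial live t θ θ') [D.dead] (N + 1) []).bind fun M => t.bind fun C => done (M ++ C)

/-- The explorer finds a wall, and it is the word that was read (unless that is long). -/
def FindsWall (t : Explorer β (List Q)) (θ : ℕ) : Prop :=
  t.Outcomes fun l L => D.Wall θ L ∧ (L = l.map live ∨ N < l.length)

variable {D live N}

/-- The last clause matters for giving up: every trial reads a letter, so `N + 1` failed trials have
read more than `N` letters. -/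
theorem outcomes_trial {t : Explorer β (List Q)} {θ θ' : ℕ} (ht : D.FindsWall live N t θ) :
    (D.trial live t θ θ').Outcomes fun l r =>
      (r.2 = true → D.Wall θ' r.1) ∧ (r.1 = l.map live ∨ N < l.length) ∧ 1 ≤ l.length := by
  refine outcomes_bind ht fun l A hA => ?_
  intro w
  refine outcomes_bind ht fun l' B hB => ?_
  refine ⟨fun hq => ?_, ?_, by simp; omega⟩
  · simp only [decide_eq_true_eq] at hq
    refine hA.1.combine hB.1 (D.holds_alone A (live w) B) ?_
    rwa [show -(A.length : ℤ) + A.length = 0 by ring]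
  · rcases hA.2 with hA | hA
    · rcases hB.2 with hB | hB
      · left; simp [hA, hB]
      · right; simp; omega
    · right; simp; omega

theorem outcomes_retry {t : Explorer β (List Q)} {θ θ' : ℕ} (ht : D.FindsWall live N t θ) (k : ℕ)
    (acc : List Q) :
    (retry (D.trial live t θ θ') [D.dead] k acc).Outcomes fun l L =>
      D.Wall θ' L ∧ (L = acc ++ l.map live ∨ k ≤ l.length ∨ N < l.length) := by
  induction k generalizing acc with
  -- The dead cell makes the output a wall although it is not the word that was read.
  | zero => exact ⟨(wall_dead θ').append_left acc, Or.inr (Or.inl le_rfl)⟩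
  | succ k ih =>
    refine outcomes_bind (outcomes_trial ht) fun l r hr => ?_
    obtain ⟨h1, h2, h3⟩ := hr
    split_ifs with hr2
    · refine ⟨(h1 hr2).append_left acc, ?_⟩
      rcases h2 with h2 | h2
      · left; simp [h2]
      · right; right; simpa using h2
    · refine (ih (acc ++ r.1)).mono fun l' L hL => ⟨hL.1, ?_⟩
      simp only [List.length_append, List.map_append]
      rcases h2 with h2 | h2
      · rcases hL.2 with hL | hL | hL
        · left; rw [hL, h2, List.append_assoc]
        · right; left; omega
        · right; right; omega
      · right; right; omega

theorem findsWall_extend {t : Explorer β (List Q)} {θ θ' : ℕ} (ht : D.FindsWall live N t θ) :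
    D.FindsWall live N (D.extend live N t θ θ') θ' := by
  refine outcomes_bind (outcomes_retry ht _ _) fun l M hM => outcomes_bind ht fun l' C hC => ?_
  refine ⟨hM.1.append_right C, ?_⟩
  simp only [List.length_append, List.map_append, List.append_nil]
  rcases hM.2 with h | h | h
  · rcases hC.2 with h' | h'
    · left; rw [h, h', List.nil_append]
    · right; omega
  · right; omega
  · right; omega

theorem outcomes_retry_prefix (trial : Explorer β (List Q × Bool)) (g : List Q) (k : ℕ)
    (acc : List Q) : (retry trial g k acc).Outcomes fun _ L => ∃ Y, L = acc ++ Y := by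
  induction k generalizing acc with
  | zero => exact ⟨g, rfl⟩
  | succ k ih =>
    refine outcomes_bind trial.outcomes_true fun l r _ => ?_
    split_ifs
    · exact ⟨r.1, rfl⟩
    · refine (ih (acc ++ r.1)).mono fun l' L ⟨Y, hY⟩ => ⟨r.1 ++ Y, ?_⟩
      rw [hY, List.append_assoc]

/-! ### Expected cost and expected listening of the extended search. -/

variable [Fintype β]

/-- The final outcome `C` is drawn from `t` independently of the search before it. Without it, the
end of the word would be biased by the success of the last trial. -/
theorem ev_extend_of_suffix [Nonempty β] {t : Explorer β (List Q)} {θ θ' : ℕ}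
    (ht : D.FindsWall live N t θ) {F : List Q → ℝ}
    (hF : ∀ M C, D.Wall θ C → F (M ++ C) = F C) :
    (D.extend live N t θ θ').ev F = t.ev F := by
  unfold extend
  simp only [ev_bind, ev]
  have : ∀ M, (t.ev fun C => F (M ++ C)) = t.ev F := fun M =>
    ev_congr_of_outcomes ht fun l C hC => hF M C hC.1
  simp only [this, ev_const]

open Classical in
-- At least one trial is made, and failed trials are kept. So the output begins with the first
-- outcome `A` of `t`, whose law is not conditioned on anything.
theorem ev_extend_of_prefix [Nonempty β] {t : Explorer β (List Q)} {θ θ' : ℕ}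
    (ht : D.FindsWall live N t θ) {F : List Q → ℝ}
    (hF : ∀ A Y, D.Wall θ A → F (A ++ Y) = F A) :
    (D.extend live N t θ θ').ev F = t.ev F := by
  unfold extend
  simp only [ev_bind, ev, retry, trial]
  refine ev_congr_of_outcomes ht fun l A hA => ?_
  have h1 : ∀ Y, (t.ev fun C => F (A ++ Y ++ C)) = F A := fun Y => by
    have : ∀ C, F (A ++ Y ++ C) = F A := fun C => by rw [List.append_assoc, hF A _ hA.1]
    simp only [this, ev_const]
  have h2 : ∀ (w : β) (B : List Q),
      ((if decide (D.Quiet θ θ' A (live w) B) = true then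
          done ([] ++ (A ++ live w :: B))
        else retry (D.trial live t θ θ') [D.dead] N ([] ++ (A ++ live w :: B)) :
        Explorer β (List Q)).ev fun M => t.ev fun C => F (M ++ C)) = F A := by
    intro w B
    have h3 := outcomes_retry_prefix (D.trial live t θ θ') [D.dead] N ([] ++ (A ++ live w :: B))
    split_ifs
    · simpa [ev] using h1 (live w :: B)
    · rw [← ev_const (retry (D.trial live t θ θ') [D.dead] N ([] ++ (A ++ live w :: B))) (F A)]
      refine ev_congr_of_outcomes h3 ?_
      rintro l M ⟨Y, rfl⟩
      have := h1 (live w :: B ++ Y)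
      simpa using this
  simp only [trial] at h2
  simp only [h2, ev_const, avg_const]

variable (D live) in
/-- The expected value of `H` on two independent outcomes of `t` and a letter between them. -/
noncomputable def evBetween (t : Explorer β (List Q)) (H : List Q → Q → List Q → ℝ) : ℝ :=
  t.ev fun A => avg fun w : β => t.ev fun B => H A (live w) B

theorem evBetween_mono {t : Explorer β (List Q)} {H H' : List Q → Q → List Q → ℝ}
    (h : ∀ A w B, H A (live w) B ≤ H' A (live w) B) :
    evBetween live t H ≤ evBetween live t H' :=
  ev_mono _ fun _ => avg_mono fun _ => ev_mono _ fun _ => h _ _ _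

/-- The letter between two extended words has on its left the end of the first and on its right the
beginning of the second. Both are fresh outcomes of `t` and walls until `θ`, and the activity
depends on nothing else. -/
theorem evBetween_extend [Nonempty β] {t : Explorer β (List Q)} {θ θ' : ℕ} (hθ : θ ≤ θ')
    (ht : D.FindsWall live N t θ) :
    evBetween live (D.extend live N t θ θ') (D.activity θ θ') =
      evBetween live t (D.activity θ θ') := by
  have ht' : D.FindsWall live N (D.extend live N t θ θ') θ :=
    (findsWall_extend ht).mono fun l L hL => ⟨hL.1.mono hθ, hL.2⟩
  have key : ∀ A, D.Wall θ A → ∀ w,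
      ((D.extend live N t θ θ').ev fun B => D.activity θ θ' A w B) =
        t.ev fun B => D.activity θ θ' A w B := fun A hA w =>
    ev_extend_of_prefix ht fun B Y hB => by
      simpa using activity_append hA hB w [] Y
  have e1 : evBetween live (D.extend live N t θ θ') (D.activity θ θ') =
      (D.extend live N t θ θ').ev fun A => avg fun w : β => t.ev fun B =>
        D.activity θ θ' A (live w) B :=
    ev_congr_of_outcomes ht' fun l A hA => by simp only [key A hA.1]
  rw [e1]
  refine ev_extend_of_suffix ht fun M C hC => ?_
  congr 1
  funext w
  refine ev_congr_of_outcomes ht fun l B hB => ?_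
  simpa using activity_append hC hB.1 (live w) M []

/-- A trial costs `2c + 1`, at most two trials are expected, and the appended outcome adds `c`. -/
theorem cost_extend_le [Nonempty β] {t : Explorer β (List Q)} {θ θ' : ℕ}
    (hs : 1 / 2 ≤ (D.trial live t θ θ').ev fun r => if r.2 then 1 else 0) :
    (D.extend live N t θ θ').cost ≤ 5 * t.cost + 2 := by
  have h1 := cost_retry_le (D.trial live t θ θ') [D.dead] (by norm_num : (0 : ℝ) < 1 / 2) hs
    (N + 1) []
  have h2 : (D.trial live t θ θ').cost = 2 * t.cost + 1 := by
    simp only [trial, cost_bind, cost, ev_const, add_zero, avg_const]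
    ring
  have h3 : (D.extend live N t θ θ').cost =
      (retry (D.trial live t θ θ') [D.dead] (N + 1) []).cost + t.cost := by
    simp only [extend, cost_bind, cost, ev_const, add_zero]
  rw [h3]
  rw [h2] at h1
  linarith

/-- The state of the search: a wall until `θ`, at a cost that is exponential in the expected
number of listening slots. -/
def SearchState (D : LineDyn Q) (live : β → Q) (N i θ : ℕ) (t : Explorer β (List Q)) : Prop :=
  D.FindsWall live N t θ ∧ t.cost ≤ (5 ^ i - 1) / 2 ∧
    (i : ℝ) / 2 ≤ evBetween live t (fun A w B => D.lisCount (D.alone A w B) θ) ∧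
    (0 < i → (i : ℝ) / 2 < evBetween live t (fun A w B => D.lisCount (D.alone A w B) θ))

/-- The time horizon is pushed as far as trials still succeed with probability 1/2. Either it
reaches `T`, or one more slot would be too much, which means that the middle cell listens too often
and so uses up energy. -/
theorem SearchState.step [Nonempty β] {i θ T : ℕ} {t : Explorer β (List Q)}
    (h : SearchState D live N i θ t) (hθ : θ ≤ T) :
    (∃ t', D.FindsWall live N t' T ∧ t'.cost ≤ ((5 : ℝ) ^ (i + 1) - 1) / 2) ∨
      ∃ θ' t', θ' ≤ T ∧ SearchState D live N (i + 1) θ' t' := by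
  classical
  obtain ⟨h1, h2, h3, -⟩ := h
  let p : ℕ → Prop := fun θ' => 1 / 2 ≤ (D.trial live t θ θ').ev fun r => if r.2 then (1 : ℝ) else 0
  -- For `θ' = θ` no slot is tested, so every trial succeeds.
  have hpθ : p θ := by
    have : ∀ A w B, D.Quiet θ θ A w B := fun A w B r h4 h5 => by omega
    simp only [p, trial, ev_bind, ev, this, decide_true, if_true, ev_const, avg_const]
    norm_num
  set θ' := Nat.findGreatest p T with hθ'
  have hp : p θ' := Nat.findGreatest_spec hθ hpθ
  have hle : θ ≤ θ' := Nat.le_findGreatest hθ hpθ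
  have hcost : (D.extend live N t θ θ').cost ≤ ((5 : ℝ) ^ (i + 1) - 1) / 2 := by
    have := cost_extend_le (N := N) hp
    rw [pow_succ]
    linarith
  have hT : θ' ≤ T := Nat.findGreatest_le T
  rcases hT.eq_or_lt with hT' | hT'
  · left
    exact ⟨_, hT' ▸ findsWall_extend h1, hcost⟩
  · right
    have hnp : ¬ p (θ' + 1) := fun hc => by
      have := Nat.le_findGreatest (P := p) hT' hc
      omega
    have hkey : (i : ℝ) / 2 + 1 / 2 < evBetween live (D.extend live N t θ θ')
        (fun A w B => D.lisCount (D.alone A w B) θ') := by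
      refine lt_of_lt_of_le ?_ (evBetween_mono fun A w B => activity_le hle A (live w) B)
      rw [evBetween_extend hle h1]
      -- Quietness until `θ' + 1` excludes exactly the slots in `[θ, θ')`, so its failure is the
      -- indicator in `activity`.
      have e1 : evBetween live t (D.activity θ θ') =
          evBetween live t (fun A w B => D.lisCount (D.alone A w B) θ) +
          (1 - (D.trial live t θ (θ' + 1)).ev fun r => if r.2 then (1 : ℝ) else 0) := by
        have e2 : ∀ A w B, D.activity θ θ' A w B = D.lisCount (D.alone A w B) θ +
            (1 + (-1) * if D.Quiet θ (θ' + 1) A w B then 1 else 0) := by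
          intro A w B
          unfold activity
          congr 1
          by_cases hq : D.Quiet θ (θ' + 1) A w B
          · rw [if_pos hq, if_neg]
            · norm_num
            · rintro ⟨r, h4, h5, h6⟩
              exact hq r h4 (by omega) h6
          · rw [if_neg hq, if_pos]
            · norm_num
            · unfold Quiet at hq
              push Not at hq
              obtain ⟨r, h4, h5, h6⟩ := hq
              exact ⟨r, h4, by omega, h6⟩
        unfold evBetween
        simp only [e2, ev_add, avg_add, ev_mul_left, avg_mul_left, ev_const, avg_const, trial,
          ev_bind, ev, decide_eq_true_eq]
        ring
      rw [e1]
      simp only [p, not_le] at hnp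
      linarith
    refine ⟨θ', _, hT, findsWall_extend h1, hcost, ?_, fun _ => ?_⟩
    · push_cast; linarith
    · push_cast; linarith

theorem exists_findsWall [Nonempty β] {b : ℕ} (hb : 0 < b) (hfuel : ∀ w, D.fuel (live w) ≤ b)
    (N T : ℕ) :
    ∃ t : Explorer β (List Q), D.FindsWall live N t T ∧ t.cost ≤ 25 ^ b / 2 := by
  have key : ∀ i : ℕ, (∃ t, D.FindsWall live N t T ∧ t.cost ≤ ((5 : ℝ) ^ i - 1) / 2) ∨
      ∃ θ t, θ ≤ T ∧ SearchState D live N i θ t := by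
    intro i
    induction i with
    | zero =>
      right
      refine ⟨0, done [], Nat.zero_le _, ⟨wall_zero _, Or.inl rfl⟩, ?_, ?_, fun h => by omega⟩
      · simp [cost]
      · simp [evBetween, ev, lisCount, avg]
    | succ i ih =>
      rcases ih with ⟨t, h1, h2⟩ | ⟨θ, t, h1, h2⟩
      · left
        refine ⟨t, h1, h2.trans ?_⟩
        have : (5 : ℝ) ^ i ≤ 5 ^ (i + 1) := pow_le_pow_right₀ (by norm_num) (by omega)
        linarith
      · exact h2.step h1
  -- If the search were still going on after `2b` stages, the expected number of listening slots
  -- would exceed the fuel `b`.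
  rcases key (2 * b) with ⟨t, h1, h2⟩ | ⟨θ, t, -, -, -, -, h⟩
  · refine ⟨t, h1, h2.trans ?_⟩
    rw [pow_mul]
    norm_num
    linarith
  · exfalso
    have h3 := h (by omega)
    have h4 : evBetween live t (fun A w B => D.lisCount (D.alone A w B) θ) ≤
        evBetween live t (fun _ _ _ => (b : ℝ)) := by
      refine evBetween_mono fun A w B => ?_
      have := D.lisCount_le (D.alone A (live w) B) θ
      rw [show D.alone A (live w) B 0 = live w from ?_] at this
      · exact_mod_cast this.trans (hfuel w)
      · exact (by simpa using (D.holds_alone A (live w) B).right :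
          Holds (D.alone A (live w) B) 0 (live w :: B)).head
    have h5 : evBetween live t (fun _ _ _ => (b : ℝ)) = b := by
      simp only [evBetween, ev_const, avg_const]
    rw [h5] at h4
    push_cast at h3
    linarith

open Classical in
/-- Most words of length `N` have a prefix that is a wall. -/
theorem wordAvg_no_wall_le [Nonempty β] {b : ℕ} (hb : 0 < b) (hfuel : ∀ w, D.fuel (live w) ≤ b)
    (N T : ℕ) :
    wordAvg β N (fun l => if ∃ l₁ l₂, l = l₁ ++ l₂ ∧ D.Wall T (l₁.map live) then 0 else 1) *
      (N + 1) ≤ 25 ^ b / 2 := by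
  obtain ⟨t, h1, h2⟩ := exists_findsWall hb hfuel N T
  refine le_trans (mul_le_mul_of_nonneg_right (wordAvg_mono fun l hl => ?_) (by positivity))
    ((wordAvg_run_none_le t N).trans h2)
  cases hr : t.run l with
  | none => simp only [Option.isNone_none, if_true]; split_ifs <;> norm_num
  | some x =>
    obtain ⟨L, rest⟩ := x
    obtain ⟨l₁, rfl, h3, h4⟩ := Outcomes.of_run h1 hr
    rw [if_pos]
    · simp
    · refine ⟨l₁, rest, rfl, ?_⟩
      -- The letters read form a prefix of a word of length `N`, so the search has not given up.
      rcases h4 with rfl | h4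
      · exact h3
      · simp at hl; omega

end LineDyn

/-! ### Averages over functions on `Fin` -/

namespace Explorer

variable {β : Type} [Fintype β]

theorem avg_equiv {α : Type} [Fintype α] (e : α ≃ β) (F : β → ℝ) : (avg fun a => F (e a)) = avg F := by
  unfold avg
  rw [Fintype.card_congr e]
  congr 1
  exact Fintype.sum_equiv e _ _ fun _ => rfl

theorem avg_prod {α : Type} [Fintype α] (F : α × β → ℝ) :
    avg F = avg fun a => avg fun b => F (a, b) := by
  simp only [avg, Fintype.sum_prod_type, Fintype.card_prod, Nat.cast_mul, ← Finset.sum_div]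
  rw [div_div, mul_comm]

theorem avg_cons {N : ℕ} (F : (Fin (N + 1) → β) → ℝ) :
    avg F = avg fun b => avg fun ω : Fin N → β => F (Fin.cons b ω) := by
  rw [← avg_equiv (Fin.consEquiv fun _ => β) F, avg_prod]
  rfl

theorem avg_snoc {N : ℕ} (F : (Fin (N + 1) → β) → ℝ) :
    avg F = avg fun b => avg fun ω : Fin N → β => F (Fin.snoc ω b) := by
  rw [← avg_equiv (Fin.snocEquiv fun _ => β) F, avg_prod]
  rfl

theorem avg_ofFn {N : ℕ} (F : List β → ℝ) :
    (avg fun ω : Fin N → β => F (List.ofFn ω)) = wordAvg β N F := by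
  induction N generalizing F with
  | zero => simp [avg, wordAvg]
  | succ N ih =>
    rw [avg_cons]
    simp only [List.ofFn_cons, wordAvg]
    congr 1
    funext b
    exact ih fun l => F (b :: l)

end Explorer

namespace Radio

namespace Protocol

open Explorer

/-- The probability of an event as an average. -/
theorem prob_eq_avg {c : Model} {M V : Type} [Fintype V] [DecidableEq V] (P : Protocol c M)
    (A : P.Bits V → Prop) [DecidablePred A] :
    P.prob A = avg fun ω => if A ω then 1 else 0 := by
  classical
  unfold prob avg
  rw [Finset.sum_boole]
  congr!

/-! ### `LOCAL` protocols on a path as dynamics on a line. -/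

variable {M : Type} (P : Protocol .LOCAL M)

/-- A protocol on a line, whose devices stop listening after a given number of times. The state
`none` belongs to the cells without a device. -/
abbrev LineState : Type := Option (P.State × ℕ)

/-- The message sent by a cell. -/
def lineSent (t : ℕ) : P.LineState → Multiset P.Msg
  | none => 0
  | some x => ((P.act t x.1).sent).elim 0 fun a => {a}

open Classical in
/-- The next state of a cell. -/
noncomputable def lineNxt (t : ℕ) (a : P.LineState) (q : P.LineState) (b : P.LineState) :
    P.LineState :=
  match q with
  | none => none
  | some (s, f) =>
    if P.act t s = .listen ∧ 0 < f then
      some (P.step t s (some (P.lineSent t a + P.lineSent t b)), f - 1)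
    else some (P.step t s none, f)

/-- The dynamics of a protocol on a line. -/
noncomputable def line : LineDyn P.LineState where
  nxt := P.lineNxt
  lis t q := ∃ s f, q = some (s, f) ∧ P.act t s = .listen ∧ 0 < f
  dead := none
  fuel q := q.elim 0 Prod.snd
  nxt_eq_of_not_lis := by
    rintro t (_ | ⟨s, f⟩) h a b a' b'
    · rfl
    · have h' : ¬ (P.act t s = .listen ∧ 0 < f) := fun h' => h ⟨s, f, rfl, h'⟩
      simp only [lineNxt, if_neg h']
  not_lis_dead := by rintro t ⟨s, f, h, -⟩; cases h
  nxt_dead _ _ _ := rfl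
  fuel_nxt_le := by
    rintro t a (_ | ⟨s, f⟩) b
    · exact le_rfl
    · simp only [lineNxt]
      split_ifs <;> simp
  fuel_nxt_lt := by
    rintro t a q b ⟨s, f, rfl, h⟩
    simp only [lineNxt, if_pos h, Option.elim]
    omega

/-- The initial configuration of the path with vertices `0, …, n` and source `0`. -/
noncomputable def pathConfig (n b : ℕ) (m : M) (ω : P.Bits (Fin (n + 1))) (i : ℤ) : P.LineState :=
  if h : 0 ≤ i ∧ i < n + 1 then
    some (P.init (if i = 0 then some m else none) (ω ⟨i.toNat, by omega⟩), b)
  else none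

theorem incoming_path (n t : ℕ) (σ : Fin (n + 1) → P.State) (τ : ℤ → P.LineState)
    (h1 : ∀ v : Fin (n + 1), P.lineSent t (τ v) = ((P.act t (σ v)).sent).elim 0 fun a => {a})
    (h2 : ∀ i : ℤ, ¬ (0 ≤ i ∧ i < n + 1) → τ i = none) (v : Fin (n + 1)) :
    P.incoming (SimpleGraph.pathGraph (n + 1)) t σ v =
      P.lineSent t (τ (v - 1)) + P.lineSent t (τ (v + 1)) := by
  classical
  have hsum : ∀ s : Finset (Fin (n + 1)),
      s.val.filterMap (fun u => (P.act t (σ u)).sent) = ∑ u ∈ s, P.lineSent t (τ u) := by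
    intro s
    induction s using Finset.induction_on with
    | empty => rfl
    | insert a s ha ih =>
      rw [Finset.sum_insert ha, Finset.insert_val_of_notMem ha, ← ih, h1]
      cases hs : (P.act t (σ a)).sent with
      | none => 
        rw [Multiset.filterMap_cons_none (f := fun u => (P.act t (σ u)).sent) _ _ hs]
        simp
      | some x => 
        rw [Multiset.filterMap_cons_some (fun u => (P.act t (σ u)).sent) _ _ hs]
        simp
  unfold incoming
  rw [hsum, Finset.sum_filter]
  have e : ∀ i : ℤ, P.lineSent t (τ i) =
      ∑ u : Fin (n + 1), if (u : ℤ) = i then P.lineSent t (τ u) else 0 := by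
    intro i
    by_cases hi : 0 ≤ i ∧ i < n + 1
    · rw [Finset.sum_eq_single (⟨i.toNat, by omega⟩ : Fin (n + 1))]
      · have : ((i.toNat : ℕ) : ℤ) = i := by omega
        simp [this]
      · intro u _ hu
        rw [if_neg]
        rintro rfl
        exact hu (by ext; simp)
      · simp
    · rw [h2 i hi, Finset.sum_eq_zero]
      · rfl
      · intro u _
        rw [if_neg]
        rintro rfl
        exact hi ⟨by omega, by omega⟩
  rw [e (v - 1), e (v + 1), ← Finset.sum_add_distrib]
  refine Finset.sum_congr rfl fun u _ => ?_
  rw [SimpleGraph.pathGraph_adj]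
  have : ¬ ((u : ℤ) = v - 1 ∧ (u : ℤ) = v + 1) := by omega
  by_cases c1 : (u : ℤ) = v - 1
  · have c2 : ¬ (u : ℤ) = v + 1 := by omega
    rw [if_pos c1, if_neg c2, if_pos (by omega), add_zero]
  · by_cases c2 : (u : ℤ) = v + 1
    · rw [if_neg c1, if_pos c2, if_pos (by omega), zero_add]
    · rw [if_neg c1, if_neg c2, if_neg (by omega), add_zero]

/-- As long as no device has spent more than `b` units of energy, the dynamics on the line follows
the protocol on the path. -/
theorem line_run_eq {n b : ℕ} {m : M} {ω : P.Bits (Fin (n + 1))}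
    (hE : ∀ v, P.energy (SimpleGraph.pathGraph (n + 1)) 0 m ω v ≤ b) {t : ℕ} (ht : t ≤ P.time)
    (v : Fin (n + 1)) :
    ∃ f, P.line.run (P.pathConfig n b m ω) t v =
      some (P.run (SimpleGraph.pathGraph (n + 1)) 0 m ω t v, f) := by
  classical
  set G := SimpleGraph.pathGraph (n + 1)
  let active : ℕ → Fin (n + 1) → ℕ := fun t v =>
    ((Finset.range t).filter (fun r => P.act r (P.run G 0 m ω r v) ≠ .idle)).card
  -- The invariant `b ≤ f + active t v` guarantees fuel in every listening slot: that slot counts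
  -- towards the total energy, which is at most `b`, so fewer than `b` units have been spent before
  -- it.
  suffices H : ∀ t ≤ P.time, ∀ v : Fin (n + 1), ∃ f,
      P.line.run (P.pathConfig n b m ω) t v = some (P.run G 0 m ω t v, f) ∧
      b ≤ f + active t v by
    obtain ⟨f, hf, -⟩ := H t ht v
    exact ⟨f, hf⟩
  intro t
  induction t with
  | zero =>
    intro _ v
    refine ⟨b, ?_, Nat.le_add_right _ _⟩
    have hv : (0 : ℤ) ≤ v ∧ (v : ℤ) < n + 1 := by omega
    have e : ((v : ℤ) = 0) ↔ v = 0 := by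
      rw [Fin.ext_iff]; simp
    simp only [LineDyn.run, pathConfig, run, dif_pos hv]
    simp only [Fin.val_eq_zero_iff, Nat.cast_eq_zero, Int.toNat_natCast, Fin.eta]
    congr!
  | succ t ih =>
    intro ht v
    have ih' := ih (by omega)
    obtain ⟨f, hf, hb⟩ := ih' v
    have hin : P.incoming G t (P.run G 0 m ω t) v =
        P.lineSent t (P.line.run (P.pathConfig n b m ω) t (v - 1)) +
        P.lineSent t (P.line.run (P.pathConfig n b m ω) t (v + 1)) := by
      refine P.incoming_path n t _ _ (fun u => ?_) (fun i hi => ?_) v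
      · obtain ⟨g, hg, -⟩ := ih' u
        rw [hg]; rfl
      · refine P.line.run_dead _ _ ?_ _
        simp only [pathConfig, dif_neg hi]; rfl
    have hact : active (t + 1) v ≤ b := by
      refine le_trans (Finset.card_le_card ?_) (hE v)
      intro r hr
      simp only [Finset.mem_filter, Finset.mem_range] at hr ⊢
      exact ⟨by omega, hr.2⟩
    have hs : active (t + 1) v = active t v +
        if P.act t (P.run G 0 m ω t v) ≠ .idle then 1 else 0 := by
      simp only [active]
      rw [Finset.range_add_one, Finset.filter_insert]
      split_ifs
      · rw [Finset.card_insert_of_notMem (by simp)]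
      · rfl
    have hnx : P.line.run (P.pathConfig n b m ω) (t + 1) v = P.lineNxt t
        (P.line.run (P.pathConfig n b m ω) t (v - 1)) (some (P.run G 0 m ω t v, f))
        (P.line.run (P.pathConfig n b m ω) t (v + 1)) := by
      rw [← hf]; rfl
    rw [hnx]
    by_cases hl : P.act t (P.run G 0 m ω t v) = .listen
    · rw [if_pos (by rw [hl]; simp)] at hs
      have hf0 : 0 < f := by omega
      refine ⟨f - 1, ?_, by omega⟩
      simp only [lineNxt, hl, hf0, and_self, if_true, run, feedback]
      rw [← hin]; rfl
    · refine ⟨f, ?_, by omega⟩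
      simp only [lineNxt, hl, false_and, if_false, run, feedback]

theorem _root_.LineDyn.run_eq_of_fuel_eq_zero {Q : Type} (D : LineDyn Q) {σ σ' : ℤ → Q} {i : ℤ}
    (h : σ i = σ' i) (h0 : D.fuel (σ i) = 0) (t : ℕ) :
    D.run σ t i = D.run σ' t i ∧ D.fuel (D.run σ t i) = 0 := by
  induction t with
  | zero => exact ⟨h, h0⟩
  | succ t ih =>
    simp only [LineDyn.run]
    rw [← ih.1]
    have hn : ¬ D.lis t (D.run σ t i) := fun hl => by
      have := D.fuel_nxt_lt t (D.run σ t i) (D.run σ t i) (D.run σ t i) hl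
      omega
    refine ⟨D.nxt_eq_of_not_lis hn _ _ _ _, ?_⟩
    have := D.fuel_nxt_le t (D.run σ t (i - 1)) (D.run σ t i) (D.run σ t (i + 1))
    omega

/-- With probability at least one half, the final state of the last device of the path (with capped
listening) does not depend on the message of the source. -/
theorem avg_dependent_le (k : ℕ) {b : ℕ} (hb : 32 ^ b ≤ k + 1) :
    ∃ bad : P.Bits (Fin (k + 2)) → Prop, ∃ _ : DecidablePred bad,
      (avg fun ω => if bad ω then (1 : ℝ) else 0) ≤ 1 / 2 ∧
      ∀ ω, ¬ bad ω → ∀ m m',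
        P.line.run (P.pathConfig (k + 1) b m ω) P.time (k + 1 : ℕ) =
        P.line.run (P.pathConfig (k + 1) b m' ω) P.time (k + 1 : ℕ) := by
  classical
  have hpc : ∀ (ω : P.Bits (Fin (k + 2))) (m m' : M) (i : ℤ), 1 ≤ i →
      P.pathConfig (k + 1) b m ω i = P.pathConfig (k + 1) b m' ω i := by
    intro ω m m' i hi
    have : ¬ i = 0 := by omega
    simp only [pathConfig, this, if_false]
  -- For `b = 0` the last device can never listen, and no wall is needed.
  rcases Nat.eq_zero_or_pos b with rfl | hb0
  · refine ⟨fun _ => False, inferInstance, ?_, fun ω _ m m' => ?_⟩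
    · simp [avg]
    · refine (P.line.run_eq_of_fuel_eq_zero (hpc ω m m' _ (by push_cast; omega)) ?_ _).1
      simp only [pathConfig, line]
      split_ifs <;> rfl
  · let live : (Fin P.bits → Bool) → P.LineState := fun x => some (P.init none x, b)
    let good : List (Fin P.bits → Bool) → Prop := fun l =>
      ∃ l₁ l₂, l = l₁ ++ l₂ ∧ P.line.Wall P.time (l₁.map live)
    -- Only the `k` vertices strictly between the source and the last device can form the wall; the
    -- random bits of the two ends are averaged out.
    let word : P.Bits (Fin (k + 2)) → List (Fin P.bits → Bool) := fun ω =>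
      List.ofFn fun j : Fin k => ω j.castSucc.succ
    refine ⟨fun ω => ¬ good (word ω), inferInstance, ?_, fun ω hω m m' => ?_⟩
    · have h1 : (avg fun ω : P.Bits (Fin (k + 2)) => if ¬ good (word ω) then (1 : ℝ) else 0) =
          wordAvg (Fin P.bits → Bool) k (fun l => if good l then 0 else 1) := by
        rw [avg_cons]
        have : ∀ x, (avg fun ω : Fin (k + 1) → Fin P.bits → Bool =>
            if ¬ good (word (Fin.cons x ω)) then (1 : ℝ) else 0) =
            wordAvg (Fin P.bits → Bool) k (fun l => if good l then 0 else 1) := by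
          intro x
          rw [avg_snoc]
          have : ∀ y, (avg fun ω : Fin k → Fin P.bits → Bool =>
              if ¬ good (word (Fin.cons x (Fin.snoc ω y))) then (1 : ℝ) else 0) =
              wordAvg (Fin P.bits → Bool) k (fun l => if good l then 0 else 1) := by
            intro y
            rw [← avg_ofFn]
            congr 1
            funext ω
            have : word (Fin.cons x (Fin.snoc ω y)) = List.ofFn ω := by
              simp [word, Fin.cons_succ, Fin.snoc_castSucc]
            rw [this, ite_not]
          simp only [this, avg_const]
        simp only [this, avg_const]
      rw [h1]
      have h2 := LineDyn.wordAvg_no_wall_le (D := P.line) (live := live) hb0 (fun w => le_rfl) k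
        P.time
      -- The base 32 leaves some slack; it turns `log₂ / 5` into the logarithm to base 32.
      have h3 : (25 : ℝ) ^ b ≤ k + 1 := by
        calc (25 : ℝ) ^ b ≤ 32 ^ b := pow_le_pow_left₀ (by norm_num) (by norm_num) b
          _ ≤ k + 1 := by exact_mod_cast hb
      have h4 : wordAvg (Fin P.bits → Bool) k (fun l => if good l then 0 else 1) * (k + 1) ≤
          1 / 2 * (k + 1) := by
        refine le_trans ?_ (h2.trans ?_)
        · exact le_of_eq (by congr!)
        · linarith
      exact le_of_mul_le_mul_right h4 (by positivity)
    · rw [not_not] at hω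
      obtain ⟨l₁, l₂, hl, hw⟩ := hω
      have hlen : l₁.length ≤ k := by
        have := congrArg List.length hl
        simp [word] at this
        omega
      have hh : ∀ m, LineDyn.Holds (P.pathConfig (k + 1) b m ω) 1 (l₁.map live) := by
        intro m j q hj
        rw [List.getElem?_map] at hj
        have hjl : j < l₁.length := by
          by_contra hc
          rw [List.getElem?_eq_none (by omega)] at hj
          cases hj
        have h5 : l₁[j]? = (word ω)[j]? := by rw [hl, List.getElem?_append_left hjl]
        rw [h5] at hj
        have hjk : j < k := by omega
        simp only [word, List.getElem?_ofFn, hjk, dif_pos, Option.map_some, Option.some.injEq] at hj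
        rw [← hj]
        have h6 : (0 : ℤ) ≤ 1 + j ∧ (1 + j : ℤ) < (k + 1 : ℕ) + 1 := by push_cast; omega
        have h7 : ¬ (1 + (j : ℤ) = 0) := by omega
        simp only [pathConfig, dif_pos h6, h7, if_false, live]
        congr 4
        ext
        simp
        omega
      refine (hw 1 _ _ (hh m) (hh m')).1 (fun i hi => hpc ω m m' i (by omega)) _ le_rfl _ ?_
      rw [List.length_map]; push_cast; omega

/-- Broadcast on a path with little energy: over a uniformly random message from `k` messages, the
probability of success is at most `1/2 + 1/(2k)`. -/
theorem sum_prob_path_le (n : ℕ) (S : Finset M) :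
    ∑ m ∈ S, P.prob (fun ω =>
        P.Succeeds (SimpleGraph.pathGraph (n + 1)) 0 m ω ∧
        ∀ v, (P.energy (SimpleGraph.pathGraph (n + 1)) 0 m ω v : ℝ) <
          1 / 5 * Real.logb 2 ((n + 1 : ℕ) : ℝ)) ≤
      ((S.card : ℝ) + 1) / 2 := by
  classical
  have hlow : ∀ e : ℕ, (e : ℝ) < 1 / 5 * Real.logb 2 ((n + 1 : ℕ) : ℝ) → 32 ^ e ≤ n := by
    intro e he
    have h1 : ((5 * e : ℕ) : ℝ) < Real.logb 2 ((n + 1 : ℕ) : ℝ) := by push_cast at he ⊢; linarith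
    rw [Real.lt_logb_iff_rpow_lt (by norm_num) (by positivity), Real.rpow_natCast] at h1
    have h2 : 2 ^ (5 * e) < n + 1 := by exact_mod_cast h1
    rw [pow_mul] at h2
    norm_num at h2
    omega
  rcases S.eq_empty_or_nonempty with rfl | hS
  · simp
  -- On a single vertex the energy bound is `log 1 = 0`, so the event is empty.
  rcases n with _ | k
  · have h0 : ∀ m, P.prob (fun ω =>
        P.Succeeds (SimpleGraph.pathGraph (0 + 1)) 0 m ω ∧
        ∀ v, (P.energy (SimpleGraph.pathGraph (0 + 1)) 0 m ω v : ℝ) <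
          1 / 5 * Real.logb 2 ((0 + 1 : ℕ) : ℝ)) = 0 := by
      intro m
      rw [prob_eq_avg]
      simp [avg]
    simp only [h0, Finset.sum_const_zero]
    positivity
  · set b := Nat.log 32 (k + 1) with hbdef
    have hb : 32 ^ b ≤ k + 1 := Nat.pow_log_le_self 32 (by omega)
    obtain ⟨bad, _, hbad, hgood⟩ := P.avg_dependent_le k hb
    set E : M → P.Bits (Fin (k + 2)) → Prop := fun m ω =>
      P.Succeeds (SimpleGraph.pathGraph (k + 1 + 1)) 0 m ω ∧
        ∀ v, (P.energy (SimpleGraph.pathGraph (k + 1 + 1)) 0 m ω v : ℝ) <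
          1 / 5 * Real.logb 2 ((k + 1 + 1 : ℕ) : ℝ) with hE
    have hout : ∀ m ω, E m ω →
        (P.line.run (P.pathConfig (k + 1) b m ω) P.time (k + 1 : ℕ)).bind (fun x => P.out x.1) =
          some m := by
      rintro m ω ⟨h1, h2⟩
      have h3 : ∀ v, P.energy (SimpleGraph.pathGraph (k + 1 + 1)) 0 m ω v ≤ b := fun v =>
        Nat.le_log_of_pow_le (by norm_num) (hlow _ (h2 v))
      obtain ⟨f, hf⟩ := P.line_run_eq h3 le_rfl (Fin.last (k + 1))
      rw [Fin.val_last] at hf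
      rw [hf]
      exact h1 _
    -- Outside `bad` the last device holds the same output for all messages, so at most one of them
    -- is correct.
    have hcard : ∀ ω, (∑ m ∈ S, if E m ω then (1 : ℝ) else 0) ≤
        1 + ((S.card : ℝ) - 1) * if bad ω then 1 else 0 := by
      intro ω
      rw [Finset.sum_boole]
      split_ifs with hω
      · have : (S.filter fun m => E m ω).card ≤ S.card := Finset.card_filter_le _ _
        have : ((S.filter fun m => E m ω).card : ℝ) ≤ S.card := by exact_mod_cast this
        linarith
      · have : (S.filter fun m => E m ω).card ≤ 1 := by
          refine Finset.card_le_one.2 fun m hm m' hm' => ?_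
          have h1 := hout m ω (Finset.mem_filter.1 hm).2
          have h2 := hout m' ω (Finset.mem_filter.1 hm').2
          rw [hgood ω hω m m', h2] at h1
          exact (Option.some.inj h1).symm
        have : ((S.filter fun m => E m ω).card : ℝ) ≤ 1 := by exact_mod_cast this
        linarith
    have hsum : ∑ m ∈ S, P.prob (E m) = avg fun ω => ∑ m ∈ S, if E m ω then (1 : ℝ) else 0 := by
      simp only [prob_eq_avg]
      unfold avg
      rw [← Finset.sum_div, Finset.sum_comm]
    rw [hsum]
    have h1 := avg_mono hcard
    rw [avg_add, avg_const, avg_mul_left] at h1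
    have h2 : (1 : ℝ) ≤ S.card := by exact_mod_cast hS.card_pos
    have h3 : ((S.card : ℝ) - 1) * (avg fun ω => if bad ω then (1 : ℝ) else 0) ≤
        ((S.card : ℝ) - 1) * (1 / 2) := mul_le_mul_of_nonneg_left hbad (by linarith)
    linarith

end Protocol

end Radio

/-! ### Protocols that proceed in rounds of coloured slots -/

namespace Radio

/-- One round: every awake device broadcasts its state in the slot given by its colour and listens
in all other slots of the round, and then updates its state. -/
structure Round (S : Type) (K : ℕ) where
  awake : S → Prop
  col : S → Fin K
  upd : S → (Fin K → Option S) → S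

namespace Round

variable {S S' V : Type} {K : ℕ} [Fintype V]

open Classical in
/-- The messages sent by the neighbours of `v` in slot `k` of the round. -/
noncomputable def senders (I : Round S K) (G : SimpleGraph V) (σ : V → S) (v : V) (k : Fin K) :
    Multiset S :=
  (Finset.univ.filter (fun u => G.Adj v u)).val.filterMap fun u =>
    if I.awake (σ u) ∧ I.col (σ u) = k then some (σ u) else none

open Classical in
/-- What `v` hears in the slots of the round. -/
noncomputable def heard (I : Round S K) (G : SimpleGraph V) (σ : V → S) (v : V) (k : Fin K) :
    Option S :=
  if I.awake (σ v) ∧ I.col (σ v) ≠ k then receive (I.senders G σ v k) else none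

/-- The states after the round. -/
noncomputable def next (I : Round S K) (G : SimpleGraph V) (σ : V → S) (v : V) : S :=
  I.upd (σ v) (I.heard G σ v)

/-- The states after a sequence of rounds. -/
noncomputable def exec (G : SimpleGraph V) : List (Round S K) → (V → S) → V → S
  | [], σ => σ
  | I :: l, σ => exec G l (I.next G σ)

open Classical in
/-- The number of rounds in which `v` is awake. -/
noncomputable def awakeCount (G : SimpleGraph V) (v : V) : List (Round S K) → (V → S) → ℕ
  | [], _ => 0
  | I :: l, σ => (if I.awake (σ v) then 1 else 0) + awakeCount G v l (I.next G σ)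

theorem exec_append (G : SimpleGraph V) (l₁ l₂ : List (Round S K)) (σ : V → S) :
    exec G (l₁ ++ l₂) σ = exec G l₂ (exec G l₁ σ) := by
  induction l₁ generalizing σ with
  | nil => rfl
  | cons I l ih => exact ih _

theorem awakeCount_append (G : SimpleGraph V) (v : V) (l₁ l₂ : List (Round S K)) (σ : V → S) :
    awakeCount G v (l₁ ++ l₂) σ = awakeCount G v l₁ σ + awakeCount G v l₂ (exec G l₁ σ) := by
  induction l₁ generalizing σ with
  | nil => simp [awakeCount, exec]
  | cons I l ih => simp only [List.cons_append, awakeCount, exec, ih, add_assoc]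

open Classical in
/-- The action in slot `t` when the given rounds are run one after the other; the second component
of the state collects what has been heard in the current round. -/
noncomputable def slotAct (l : List (Round S K)) (t : ℕ) (s : S × (Fin K → Option S)) : Action S :=
  match l[t / K]? with
  | none => .idle
  | some I =>
    if I.awake s.1 then if (I.col s.1 : ℕ) = t % K then .send s.1 else .listen else .idle

/-- The state after slot `t`. -/
def slotStep (l : List (Round S K)) (t : ℕ) (s : S × (Fin K → Option S))
    (o : Option (Option S)) : S × (Fin K → Option S) :=
  match l[t / K]? with
  | none => s
  | some I =>
    if t % K + 1 = K then
      (I.upd s.1 (fun k => if (k : ℕ) = t % K then o.join else s.2 k), fun _ => none)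
    else (s.1, fun k => if (k : ℕ) = t % K then o.join else s.2 k)

open Classical in
/-- The feedback in slot `t`. -/
noncomputable def slotFeedback (l : List (Round S K)) (G : SimpleGraph V) (t : ℕ)
    (τ : V → S × (Fin K → Option S)) (v : V) : Option (Option S) :=
  match slotAct l t (τ v) with
  | .listen => some (receive ((Finset.univ.filter (fun u => G.Adj v u)).val.filterMap
      fun u => (slotAct l t (τ u)).sent))
  | _ => none

/-- The states of all devices after `t` slots. -/
noncomputable def trace (l : List (Round S K)) (G : SimpleGraph V) (σ : V → S) :
    ℕ → V → S × (Fin K → Option S)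
  | 0 => fun v => (σ v, fun _ => none)
  | t + 1 => fun v => slotStep l t (trace l G σ t v) (slotFeedback l G t (trace l G σ t) v)

/-! ### Rounds as blocks of slots. -/

section Compile

variable (l : List (Round S K))

open Classical in
theorem slotAct_eq {t : ℕ} {I : Round S K} (hI : l[t / K]? = some I)
    (s : S × (Fin K → Option S)) :
    slotAct l t s =
      if I.awake s.1 then if (I.col s.1 : ℕ) = t % K then .send s.1 else .listen else .idle := by
  simp only [slotAct, hI]

theorem join_slotFeedback (G : SimpleGraph V) {t : ℕ} {I : Round S K}
    (hI : l[t / K]? = some I) (σ : V → S) (τ : V → S × (Fin K → Option S))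
    (hτ : ∀ v, (τ v).1 = σ v) (v : V) (k : Fin K) (hk : (k : ℕ) = t % K) :
    (slotFeedback l G t τ v).join = I.heard G σ v k := by
  classical
  have hact : ∀ u, slotAct l t (τ u) =
      if I.awake (σ u) then if I.col (σ u) = k then .send (σ u) else .listen else .idle := by
    intro u
    rw [slotAct_eq l hI, hτ, ← hk]
    simp only [Fin.val_inj]
  have hin : ((Finset.univ.filter (fun u => G.Adj v u)).val.filterMap
      fun u => (slotAct l t (τ u)).sent) = I.senders G σ v k := by
    unfold senders
    congr 1
    funext u
    rw [hact]
    by_cases h1 : I.awake (σ u) <;> by_cases h2 : I.col (σ u) = k <;> simp [h1, h2, Action.sent]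
  unfold slotFeedback heard
  rw [hin, hact]
  by_cases h1 : I.awake (σ v)
  · by_cases h2 : I.col (σ v) = k <;> simp [h1, h2]
  · simp [h1]

/-- Within a round only the buffer changes, one entry per slot; the last slot completes it, applies
the update and empties it. -/
theorem trace_round (G : SimpleGraph V) (σ₀ : V → S) {j : ℕ} {I : Round S K} (hI : l[j]? = some I)
    (σ : V → S) (h : ∀ v, trace l G σ₀ (K * j) v = (σ v, fun _ => none)) :
    (∀ k < K, ∀ v, trace l G σ₀ (K * j + k) v =
      (σ v, fun i : Fin K => if (i : ℕ) < k then I.heard G σ v i else none)) ∧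
    (0 < K → ∀ v, trace l G σ₀ (K * (j + 1)) v = (I.next G σ v, fun _ => none)) := by
  classical
  have hdiv : ∀ k < K, (K * j + k) / K = j ∧ (K * j + k) % K = k := by
    intro k hk
    have hK : 0 < K := by omega
    rw [Nat.mul_add_div hK, Nat.div_eq_of_lt hk, Nat.mul_add_mod, Nat.mod_eq_of_lt hk]
    simp
  have hstep : ∀ k (_ : k < K),
      (∀ v, trace l G σ₀ (K * j + k) v =
        (σ v, fun i : Fin K => if (i : ℕ) < k then I.heard G σ v i else none)) →
      ∀ v, trace l G σ₀ (K * j + k + 1) v =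
        if k + 1 = K then (I.upd (σ v)
          (fun i : Fin K => if (i : ℕ) < k + 1 then I.heard G σ v i else none), fun _ => none)
        else (σ v, fun i : Fin K => if (i : ℕ) < k + 1 then I.heard G σ v i else none) := by
    intro k hk hτ v
    obtain ⟨hd, hm⟩ := hdiv k hk
    have hI' : l[(K * j + k) / K]? = some I := by rw [hd]; exact hI
    have hbuf : (fun i : Fin K => if (i : ℕ) = k then
        (slotFeedback l G (K * j + k) (trace l G σ₀ (K * j + k)) v).join
        else if (i : ℕ) < k then I.heard G σ v i else none) =
        fun i : Fin K => if (i : ℕ) < k + 1 then I.heard G σ v i else none := by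
      rw [join_slotFeedback l G hI' σ _ (fun v => by rw [hτ]) v ⟨k, hk⟩ hm.symm]
      funext i
      by_cases h1 : (i : ℕ) = k
      · have : i = ⟨k, hk⟩ := Fin.ext h1
        simp [this]
      · have h2 : (i : ℕ) < k ↔ (i : ℕ) < k + 1 := by omega
        simp only [h1, if_false, h2]
    rw [← hbuf]
    simp only [trace, slotStep, hI', hm]
    rw [hτ v]
  have hall : ∀ k < K, ∀ v, trace l G σ₀ (K * j + k) v =
      (σ v, fun i : Fin K => if (i : ℕ) < k then I.heard G σ v i else none) := by
    intro k
    induction k with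
    | zero => intro _ v; simpa using h v
    | succ k ih =>
      intro hk v
      rw [← add_assoc, hstep k (by omega) (ih (by omega)) v, if_neg (by omega)]
  refine ⟨hall, fun hK v => ?_⟩
  obtain ⟨k, rfl⟩ : ∃ k, K = k + 1 := ⟨K - 1, by omega⟩
  have e : (k + 1) * (j + 1) = (k + 1) * j + k + 1 := by ring
  rw [e, hstep k (by omega) (hall k (by omega)) v, if_pos rfl]
  unfold next
  congr 2
  funext i
  rw [if_pos i.isLt]

theorem trace_eq_exec (hK : 0 < K) (G : SimpleGraph V) (σ₀ : V → S) {j : ℕ} (hj : j ≤ l.length)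
    (v : V) : trace l G σ₀ (K * j) v = (exec G (l.take j) σ₀ v, fun _ => none) := by
  induction j generalizing v with
  | zero => simp [trace, exec]
  | succ j ih =>
    have hI : l[j]? = some l[j] := List.getElem?_eq_getElem (by omega)
    rw [(trace_round l G σ₀ hI _ (ih (by omega))).2 hK, List.take_add_one, exec_append, hI]
    rfl

theorem card_active_le (hK : 0 < K) (G : SimpleGraph V) (σ₀ : V → S) (v : V)
    [DecidablePred fun t => slotAct l t (trace l G σ₀ t v) ≠ .idle] :
    ((Finset.range (K * l.length)).filter
      (fun t => slotAct l t (trace l G σ₀ t v) ≠ .idle)).card ≤ K * awakeCount G v l σ₀ := by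
  classical
  have key : ∀ j ≤ l.length, ((Finset.range (K * j)).filter
      (fun t => slotAct l t (trace l G σ₀ t v) ≠ .idle)).card ≤
      K * awakeCount G v (l.take j) σ₀ := by
    intro j
    induction j with
    | zero => intro _; simp
    | succ j ih =>
      intro hj
      have hI : l[j]? = some l[j] := List.getElem?_eq_getElem (by omega)
      have hr := (trace_round l G σ₀ hI _ fun v => trace_eq_exec l hK G σ₀ (by omega) v).1
      set σ := exec G (l.take j) σ₀ with hσ
      rw [List.take_add_one, awakeCount_append, hI]
      simp only [Option.toList, awakeCount, ← hσ]
      have hsub : (Finset.range (K * (j + 1))).filter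
          (fun t => slotAct l t (trace l G σ₀ t v) ≠ .idle) ⊆
          (Finset.range (K * j)).filter (fun t => slotAct l t (trace l G σ₀ t v) ≠ .idle) ∪
          if l[j].awake (σ v) then (Finset.range K).image (fun k => K * j + k) else ∅ := by
        intro t ht
        rw [Finset.mem_filter, Finset.mem_range] at ht
        rw [Finset.mem_union, Finset.mem_filter, Finset.mem_range]
        by_cases htj : t < K * j
        · exact Or.inl ⟨htj, ht.2⟩
        · right
          obtain ⟨k, rfl⟩ : ∃ k, t = K * j + k := ⟨t - K * j, by omega⟩
          have hk : k < K := by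
            have := ht.1
            rw [mul_add, mul_one] at this
            omega
          have hd : l[(K * j + k) / K]? = some l[j] := by
            rw [Nat.mul_add_div hK, Nat.div_eq_of_lt hk]
            exact hI
          have hne := ht.2
          rw [hr k hk v, slotAct_eq l hd] at hne
          by_cases haw : l[j].awake (σ v)
          · rw [if_pos haw]
            exact Finset.mem_image.2 ⟨k, Finset.mem_range.2 hk, rfl⟩
          · simp [haw] at hne
      refine (Finset.card_le_card hsub).trans ((Finset.card_union_le _ _).trans ?_)
      rw [mul_add]
      refine Nat.add_le_add (ih (by omega)) ?_
      by_cases haw : l[j].awake (σ v)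
      · simp only [haw, if_true]
        refine Finset.card_image_le.trans ?_
        simp
      · simp [haw]
  have := key l.length le_rfl
  rw [List.take_length] at this
  refine le_trans (le_of_eq ?_) this
  congr!

/-- The protocol that runs the given rounds one after the other. -/
noncomputable def toProtocol {M : Type} (l : List (Round S K)) (bits : ℕ)
    (init : Option M → (Fin bits → Bool) → S) (out : S → Option M) : Protocol .noCD M where
  Msg := S
  State := S × (Fin K → Option S)
  bits := bits
  time := K * l.length
  init x b := (init x b, fun _ => none)
  act := slotAct l
  step := slotStep l
  out s := out s.1

variable {M : Type} (bits : ℕ) (init : Option M → (Fin bits → Bool) → S) (out : S → Option M)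

open Classical in
/-- The initial states. -/
noncomputable def initial (s : V) (m : M) (ω : V → Fin bits → Bool) (v : V) : S :=
  init (if v = s then some m else none) (ω v)

theorem run_toProtocol (G : SimpleGraph V) (s : V) (m : M) (ω : V → Fin bits → Bool) (t : ℕ) :
    (toProtocol l bits init out).run G s m ω t = trace l G (initial bits init s m ω) t := by
  induction t with
  | zero => rfl
  | succ t ih =>
    funext v
    simp only [Protocol.run, trace]
    rw [ih]
    have : (toProtocol l bits init out).feedback G t (trace l G (initial bits init s m ω) t) v =
        slotFeedback l G t (trace l G (initial bits init s m ω) t) v := by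
      have hact : (toProtocol l bits init out).act t (trace l G (initial bits init s m ω) t v) =
          slotAct l t (trace l G (initial bits init s m ω) t v) := rfl
      unfold Protocol.feedback slotFeedback
      rw [hact]
      cases slotAct l t (trace l G (initial bits init s m ω) t v) <;> rfl
    rw [this]
    rfl

theorem succeeds_toProtocol (hK : 0 < K) (G : SimpleGraph V) (s : V) (m : M)
    (ω : V → Fin bits → Bool) :
    (toProtocol l bits init out).Succeeds G s m ω ↔
      ∀ v, out (exec G l (initial bits init s m ω) v) = some m := by
  unfold Protocol.Succeeds
  rw [run_toProtocol]
  refine forall_congr' fun v => ?_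
  have := trace_eq_exec l hK G (initial bits init s m ω) le_rfl v
  rw [List.take_length] at this
  change out (trace l G (initial bits init s m ω) (K * l.length) v).1 = some m ↔ _
  rw [this]

theorem energy_toProtocol_le (hK : 0 < K) (G : SimpleGraph V) (s : V) (m : M)
    (ω : V → Fin bits → Bool) (v : V) :
    (toProtocol l bits init out).energy G s m ω v ≤
      K * awakeCount G v l (initial bits init s m ω) := by
  classical
  refine le_trans (le_of_eq ?_) (card_active_le l hK G (initial bits init s m ω) v)
  unfold Protocol.energy
  congr 1
  ext t
  rw [Finset.mem_filter, Finset.mem_filter, run_toProtocol]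
  rfl

end Compile

/-! ### Renaming states -/

/-- The rounds `I` and `I'` do the same up to the renaming `f` of states. -/
def Simulates (f : S → S') (I : Round S K) (I' : Round S' K) : Prop :=
  (∀ s, I'.awake (f s) ↔ I.awake s) ∧ (∀ s, I'.col (f s) = I.col s) ∧
    ∀ s r, I'.upd (f s) (fun k => (r k).map f) = f (I.upd s r)

theorem _root_.Radio.receive_map (f : S → S') (ms : Multiset S) :
    receive (ms.map f) = (receive ms).map f := by
  by_cases h : Multiset.card ms = 1
  · obtain ⟨a, rfl⟩ := Multiset.card_eq_one.1 h
    rw [Multiset.map_singleton, receive_singleton, receive_singleton]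
    rfl
  · rw [receive_of_card_ne_one _ h, receive_of_card_ne_one _ (by simpa using h)]
    rfl

/-- Reception depends only on how many neighbours send, so it commutes with any map of states,
injective or not. -/
theorem Simulates.heard {f : S → S'} {I : Round S K} {I' : Round S' K} (h : Simulates f I I')
    (G : SimpleGraph V) (σ : V → S) (v : V) (k : Fin K) :
    I'.heard G (fun v => f (σ v)) v k = (I.heard G σ v k).map f := by
  classical
  have hs : I'.senders G (fun v => f (σ v)) v k = (I.senders G σ v k).map f := by
    unfold senders
    rw [Multiset.map_filterMap]
    congr 1
    funext u
    rw [h.1, h.2.1]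
    split_ifs <;> rfl
  unfold Round.heard
  rw [h.1, h.2.1, hs, receive_map]
  split_ifs <;> rfl

theorem Simulates.next {f : S → S'} {I : Round S K} {I' : Round S' K} (h : Simulates f I I')
    (G : SimpleGraph V) (σ : V → S) :
    I'.next G (fun v => f (σ v)) = fun v => f (I.next G σ v) := by
  funext v
  unfold Round.next
  rw [← h.2.2]
  congr 1
  funext k
  exact h.heard G σ v k

theorem exec_simulates {f : S → S'} {l : List (Round S K)} {l' : List (Round S' K)}
    (h : List.Forall₂ (Simulates f) l l') (G : SimpleGraph V) (σ : V → S) :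
    exec G l' (fun v => f (σ v)) = fun v => f (exec G l σ v) := by
  induction h generalizing σ with
  | nil => rfl
  | cons h _ ih =>
    simp only [exec]
    rw [h.next]
    exact ih _

/-! ### Reception -/

theorem filterMap_ite_eq_map_filter {α β : Type*} (p : α → Prop) [DecidablePred p] (f : α → β)
    (t : Multiset α) :
    t.filterMap (fun u => if p u then some (f u) else none) = (t.filter p).map f := by
  induction t using Multiset.induction_on with
  | empty => rfl
  | cons a t ih =>
    by_cases ha : p a
    · rw [Multiset.filterMap_cons_some (fun u => if p u then some (f u) else none) _ _ (if_pos ha),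
        Multiset.filter_cons_of_pos _ ha, Multiset.map_cons, ih]
    · rw [Multiset.filterMap_cons_none (f := fun u => if p u then some (f u) else none) _ _
        (if_neg ha), Multiset.filter_cons_of_neg _ ha, ih]

theorem exists_of_heard {I : Round S K} {G : SimpleGraph V} {σ : V → S} {v : V} {k : Fin K} {x : S}
    (h : I.heard G σ v k = some x) :
    I.awake (σ v) ∧ I.col (σ v) ≠ k ∧ ∃ u, G.Adj v u ∧ I.awake (σ u) ∧ I.col (σ u) = k ∧
      x = σ u ∧ ∀ w, G.Adj v w → I.awake (σ w) → I.col (σ w) = k → w = u := by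
  classical
  unfold heard at h
  split_ifs at h with hv
  refine ⟨hv.1, hv.2, ?_⟩
  by_cases hc : Multiset.card (I.senders G σ v k) = 1
  · unfold senders at hc h
    set s := Finset.univ.filter (fun u => G.Adj v u) with hs
    have hf : s.val.filterMap (fun u =>
        if I.awake (σ u) ∧ I.col (σ u) = k then some (σ u) else none) =
        (s.filter (fun u => I.awake (σ u) ∧ I.col (σ u) = k)).val.map σ := by
      rw [Finset.filter_val]
      exact filterMap_ite_eq_map_filter _ _ _
    rw [hf] at hc h
    rw [Multiset.card_map, Finset.card_val] at hc
    obtain ⟨u, hu⟩ := Finset.card_eq_one.1 hc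
    rw [hu] at h
    simp only [Finset.singleton_val, Multiset.map_singleton, receive_singleton,
      Option.some.injEq] at h
    have hmem : ∀ w, w ∈ s.filter (fun u => I.awake (σ u) ∧ I.col (σ u) = k) ↔ w = u := by
      intro w; rw [hu, Finset.mem_singleton]
    simp only [hs, Finset.mem_filter, Finset.mem_univ, true_and] at hmem
    obtain ⟨h1, h2, h3⟩ := (hmem u).2 rfl
    exact ⟨u, h1, h2, h3, h.symm, fun w h4 h5 h6 => (hmem w).1 ⟨h4, h5, h6⟩⟩
  · rw [receive_of_card_ne_one _ hc] at h
    cases h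

theorem heard_eq_some {I : Round S K} {G : SimpleGraph V} {σ : V → S} {v u : V}
    (hv : I.awake (σ v)) (hu : I.awake (σ u)) (hadj : G.Adj v u) (hc : I.col (σ v) ≠ I.col (σ u))
    (huniq : ∀ w, G.Adj v w → I.awake (σ w) → I.col (σ w) = I.col (σ u) → w = u) :
    I.heard G σ v (I.col (σ u)) = some (σ u) := by
  classical
  unfold heard
  rw [if_pos ⟨hv, hc⟩]
  have : I.senders G σ v (I.col (σ u)) = {σ u} := by
    unfold senders
    rw [← Finset.insert_erase (Finset.mem_filter.2 ⟨Finset.mem_univ u, hadj⟩),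
      Finset.insert_val_of_notMem (Finset.notMem_erase _ _),
      Multiset.filterMap_cons_some (fun w =>
        if I.awake (σ w) ∧ I.col (σ w) = I.col (σ u) then some (σ w) else none) _ _
        (if_pos ⟨hu, rfl⟩)]
    have h0 : Multiset.filterMap (fun w =>
        if I.awake (σ w) ∧ I.col (σ w) = I.col (σ u) then some (σ w) else none)
        ((Finset.univ.filter (fun u => G.Adj v u)).erase u).val = 0 := by
      rw [Multiset.eq_zero_iff_forall_notMem]
      intro x hx
      obtain ⟨w, hw, hx⟩ := (Multiset.mem_filterMap _ _).1 hx
      have hw' : w ∈ (Finset.univ.filter (fun u => G.Adj v u)).erase u := hw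
      simp only [Finset.mem_erase, Finset.mem_filter, Finset.mem_univ, true_and] at hw'
      split_ifs at hx with hcol
      exact hw'.1 (huniq w hw'.2 hcol.1 hcol.2)
    rw [h0]
    rfl
  rw [this, receive_singleton]

end Round

end Radio

/-! ### The broadcast algorithm: devices and rounds -/

namespace Radio

/-- The memory of a device of the broadcast algorithm; `I` is the type of identifiers. -/
structure Device (I M : Type) (K : ℕ) where
  /-- the own identifier -/
  me : I
  /-- the identifiers of the neighbours that are known -/
  known : Set I
  /-- the identifiers heard in the current attempt at choosing a colour -/
  heard : Set I
  /-- the colour that has been chosen -/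
  fixed : Option (Fin K)
  /-- the distance to the root of the cluster, along the tree of the cluster -/
  lab : ℕ
  /-- the root of the cluster -/
  rt : I
  /-- the new label and root, if there are any -/
  new : Option (ℕ × I)
  /-- the broadcast message, if it is known -/
  msg : Option M

namespace Device

variable {I J M V : Type} {K : ℕ}

/-- Renaming identifiers. -/
def map (e : I → J) (s : Device I M K) : Device J M K where
  me := e s.me
  known := e '' s.known
  heard := e '' s.heard
  fixed := s.fixed
  lab := s.lab
  rt := e s.rt
  new := s.new.map (Prod.map id e)
  msg := s.msg

/-- The identifiers that have been received. -/
def ids (r : Fin K → Option (Device I M K)) : Set I := {y | ∃ k x, r k = some x ∧ x.me = y}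

theorem ids_map (e : I → J) (r : Fin K → Option (Device I M K)) :
    ids (fun k => (r k).map (map e)) = e '' ids r := by
  ext y
  constructor
  · rintro ⟨k, x, hx, rfl⟩
    obtain ⟨z, hz, rfl⟩ := Option.map_eq_some_iff.1 hx
    exact ⟨z.me, ⟨k, z, hz, rfl⟩, rfl⟩
  · rintro ⟨_, ⟨k, x, hx, rfl⟩, rfl⟩
    exact ⟨k, map e x, by simp [hx], rfl⟩

/-- All devices announce themselves, in slots given by `c`. -/
def announce (c : I → Fin K) : Round (Device I M K) K where
  awake _ := True
  col s := c s.me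
  upd s r := { s with known := s.known ∪ ids r }

/-- All devices announce themselves; those without a colour try the one given by `c`. -/
def tryColour (c : I → Fin K) : Round (Device I M K) K where
  awake _ := True
  col s := s.fixed.getD (c s.me)
  upd s r := { s with heard := ids r }

/-- All neighbours have confirmed that they have heard this device. -/
def Confirmed (s : Device I M K) (r : Fin K → Option (Device I M K)) : Prop :=
  ∀ y ∈ s.known, ∃ k x, r k = some x ∧ x.me = y ∧ s.me ∈ x.heard

open Classical in
/-- All devices report what they have heard, and a device that has been heard by all its neighbours
keeps the colour it has tried. -/
noncomputable def keepColour (c : I → Fin K) : Round (Device I M K) K where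
  awake _ := True
  col s := s.fixed.getD (c s.me)
  upd s r := if s.fixed = none ∧ Confirmed s r then { s with fixed := some (c s.me) } else s

/-- The clusters with a root that satisfies `coin` keep their labels. -/
def start (coin : I → Bool) (k₀ : Fin K) : Round (Device I M K) K where
  awake _ := False
  col _ := k₀
  upd s _ := { s with new := if coin s.rt then some (s.lab, s.rt) else none }

/-- The devices that know the message start a wave. -/
def startMsg (k₀ : Fin K) : Round (Device I M K) K where
  awake _ := False
  col _ := k₀
  upd s _ := { s with new := if s.msg.isSome then some (s.lab, s.rt) else none }

open Classical in
/-- An element that satisfies `p`, if there is one. -/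
noncomputable def pick (p : Fin K → Prop) : Option (Fin K) :=
  if h : ∃ k, p k then some h.choose else none

theorem pick_spec {p : Fin K → Prop} {k : Fin K} (h : pick p = some k) : p k := by
  unfold pick at h
  split_ifs at h with hp
  rw [← Option.some.inj h]
  exact hp.choose_spec

theorem exists_pick {p : Fin K → Prop} {k : Fin K} (h : p k) : ∃ j, pick p = some j := by
  unfold pick
  rw [dif_pos ⟨k, h⟩]
  exact ⟨_, rfl⟩

/-- Something useful is received in slot `k`: a device with a label in `A` has a new label. -/
def Offers (A : ℕ → Prop) (r : Fin K → Option (Device I M K)) (k : Fin K) : Prop :=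
  ∃ x, r k = some x ∧ A x.lab ∧ x.new.isSome

/-- The device takes over a new label and the message from the device `x`. -/
def takeFrom (s x : Device I M K) : Device I M K :=
  { s with new := x.new.map fun p => (p.1 + 1, p.2), msg := s.msg.or x.msg }

open Classical in
/-- The devices with a label in `A` pass on their new labels and the message to the devices with a
label in `B` that have no new label. -/
noncomputable def cast (A B : ℕ → Prop) (k₀ : Fin K) : Round (Device I M K) K where
  awake s := A s.lab ∨ B s.lab
  col s := s.fixed.getD k₀
  upd s r :=
    if B s.lab ∧ s.new = none then ((pick (Offers A r)).bind r).elim s (takeFrom s) else s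

/-- The new labels replace the old ones. -/
def finish (k₀ : Fin K) : Round (Device I M K) K where
  awake _ := False
  col _ := k₀
  upd s _ := { s with lab := (s.new.getD (s.lab, s.rt)).1, rt := (s.new.getD (s.lab, s.rt)).2 }

/-- Everybody casts to everybody, and then the new labels and the message move to the roots and
from the roots to all devices of a cluster. -/
noncomputable def spread (n : ℕ) (k₀ : Fin K) : List (Round (Device I M K) K) :=
  cast (fun _ => True) (fun _ => True) k₀ ::
    ((List.range n).reverse.map (fun j => cast (· = j + 1) (· = j) k₀) ++
      (List.range n).map fun j => cast (· = j) (· = j + 1) k₀)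

/-- One step of merging clusters. -/
noncomputable def merge (n : ℕ) (k₀ : Fin K) (coin : I → Bool) : List (Round (Device I M K) K) :=
  start coin k₀ :: (spread n k₀ ++ [finish k₀])

/-- The whole algorithm. -/
noncomputable def program (n : ℕ) (k₀ : Fin K) (x y : List (I → Fin K)) (z : List (I → Bool)) :
    List (Round (Device I M K) K) :=
  x.map announce ++ (y.flatMap (fun c => [tryColour c, keepColour c]) ++
    (z.flatMap (merge n k₀) ++ startMsg k₀ :: spread n k₀))

/-- The device at the beginning. -/
def initially (i : I) (msg : Option M) : Device I M K where
  me := i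
  known := ∅
  heard := ∅
  fixed := none
  lab := 0
  rt := i
  new := none
  msg := msg

/-! #### Identifiers may be renamed -/

section Rename

open Round

variable {e : I → J}

theorem map_initially (e : I → J) (i : I) (msg : Option M) :
    map e (initially i msg : Device I M K) = initially (e i) msg := by
  simp [map, initially]

theorem simulates_announce (c : J → Fin K) :
    Simulates (map e) (announce fun i => c (e i) : Round (Device I M K) K) (announce c) := by
  refine ⟨fun _ => Iff.rfl, fun _ => rfl, fun s r => ?_⟩
  simp [announce, ids_map, map, Set.image_union]

theorem simulates_tryColour (c : J → Fin K) :
    Simulates (map e) (tryColour fun i => c (e i) : Round (Device I M K) K) (tryColour c) := by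
  refine ⟨fun _ => Iff.rfl, fun _ => rfl, fun s r => ?_⟩
  simp [tryColour, ids_map, map]

/-- Here identifiers are tested for equality. This is the only point of the renaming at which
injectivity is needed. -/
theorem confirmed_map (he : Function.Injective e) (s : Device I M K)
    (r : Fin K → Option (Device I M K)) :
    Confirmed (map e s) (fun k => (r k).map (map e)) ↔ Confirmed s r := by
  constructor
  · intro h y hy
    obtain ⟨k, x, hx, hxy, hme⟩ := h (e y) ⟨y, hy, rfl⟩
    obtain ⟨z, hz, rfl⟩ := Option.map_eq_some_iff.1 hx
    obtain ⟨w, hw, hws⟩ := hme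
    exact ⟨k, z, hz, he hxy, he hws ▸ hw⟩
  · rintro h _ ⟨y, hy, rfl⟩
    obtain ⟨k, x, hx, rfl, hme⟩ := h y hy
    exact ⟨k, map e x, by simp [hx], rfl, _, hme, rfl⟩

theorem simulates_keepColour (he : Function.Injective e) (c : J → Fin K) :
    Simulates (map e) (keepColour fun i => c (e i) : Round (Device I M K) K) (keepColour c) := by
  refine ⟨fun _ => Iff.rfl, fun _ => rfl, fun s r => ?_⟩
  have h : ((map e s).fixed = none ∧ Confirmed (map e s) fun k => (r k).map (map e)) ↔
      (s.fixed = none ∧ Confirmed s r) := and_congr Iff.rfl (confirmed_map he s r)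
  by_cases hs : s.fixed = none ∧ Confirmed s r
  · simp only [keepColour]
    rw [if_pos (h.2 hs), if_pos hs]
    rfl
  · simp only [keepColour]
    rw [if_neg (mt h.1 hs), if_neg hs]

theorem simulates_start (coin : J → Bool) (k₀ : Fin K) :
    Simulates (map e) (start (fun i => coin (e i)) k₀ : Round (Device I M K) K)
      (start coin k₀) := by
  refine ⟨fun _ => Iff.rfl, fun _ => rfl, fun s r => ?_⟩
  simp only [start, map]
  split_ifs <;> rfl

theorem simulates_startMsg (k₀ : Fin K) :
    Simulates (map e) (startMsg k₀ : Round (Device I M K) K) (startMsg k₀) := by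
  refine ⟨fun _ => Iff.rfl, fun _ => rfl, fun s r => ?_⟩
  simp only [startMsg, map]
  split_ifs <;> rfl

theorem offers_map (A : ℕ → Prop) (r : Fin K → Option (Device I M K)) :
    Offers A (fun k => (r k).map (map e)) = Offers A r := by
  funext k
  refine propext ⟨?_, ?_⟩
  · rintro ⟨x, hx, hA, hn⟩
    obtain ⟨z, hz, rfl⟩ := Option.map_eq_some_iff.1 hx
    exact ⟨z, hz, hA, by simpa [map] using hn⟩
  · rintro ⟨x, hx, hA, hn⟩
    exact ⟨map e x, by simp [hx], hA, by simpa [map] using hn⟩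

theorem simulates_cast (A B : ℕ → Prop) (k₀ : Fin K) :
    Simulates (map e) (cast A B k₀ : Round (Device I M K) K) (cast A B k₀) := by
  refine ⟨fun _ => Iff.rfl, fun _ => rfl, fun s r => ?_⟩
  have h : (B (map e s).lab ∧ (map e s).new = none) ↔ (B s.lab ∧ s.new = none) := by
    simp [map]
  by_cases hs : B s.lab ∧ s.new = none
  · simp only [cast]
    rw [if_pos (h.2 hs), if_pos hs, offers_map]
    rcases pick (Offers A r) with _ | k
    · rfl
    · simp only [Option.bind_some]
      rcases r k with _ | x
      · rfl
      · simp only [Option.map_some, Option.elim, takeFrom, map, Option.map_map]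
        rfl
  · simp only [cast]
    rw [if_neg (mt h.1 hs), if_neg hs]

theorem simulates_finish (k₀ : Fin K) :
    Simulates (map e) (finish k₀ : Round (Device I M K) K) (finish k₀) := by
  refine ⟨fun _ => Iff.rfl, fun _ => rfl, fun s r => ?_⟩
  rcases s with ⟨_, _, _, _, _, _, _ | _, _⟩ <;> rfl

theorem simulates_spread (n : ℕ) (k₀ : Fin K) :
    List.Forall₂ (Simulates (map e)) (spread n k₀ : List (Round (Device I M K) K))
      (spread n k₀) := by
  refine .cons (simulates_cast _ _ _) (List.rel_append ?_ ?_)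
  · rw [List.forall₂_map_left_iff, List.forall₂_map_right_iff, List.forall₂_same]
    exact fun _ _ => simulates_cast _ _ _
  · rw [List.forall₂_map_left_iff, List.forall₂_map_right_iff, List.forall₂_same]
    exact fun _ _ => simulates_cast _ _ _

theorem forall₂_flatMap {α β γ : Type} {R : β → γ → Prop} (f : α → List β) (g : α → List γ)
    (l : List α) (h : ∀ a, List.Forall₂ R (f a) (g a)) :
    List.Forall₂ R (l.flatMap f) (l.flatMap g) := by
  induction l with
  | nil => exact .nil
  | cons a l ih => exact List.rel_append (h a) ih

/-- Colour choices and coins are functions of identifiers. Composed with `e : V → J` they become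
functions of vertices, so the algorithm can be analysed with independent choices at the vertices. -/
theorem simulates_program (he : Function.Injective e) (n : ℕ) (k₀ : Fin K)
    (x y : List (J → Fin K)) (z : List (J → Bool)) :
    List.Forall₂ (Simulates (map e))
      (program n k₀ (x.map fun c i => c (e i)) (y.map fun c i => c (e i))
        (z.map fun c i => c (e i)) : List (Round (Device I M K) K))
      (program n k₀ x y z) := by
  unfold program
  rw [List.flatMap_map, List.flatMap_map, List.map_map]
  refine List.rel_append ?_ (List.rel_append ?_ (List.rel_append ?_ ?_))
  · rw [List.forall₂_map_left_iff, List.forall₂_map_right_iff, List.forall₂_same]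
    exact fun _ _ => simulates_announce _
  · exact forall₂_flatMap _ _ _ fun c =>
      .cons (simulates_tryColour c) (.cons (simulates_keepColour he c) .nil)
  · exact forall₂_flatMap _ _ _ fun c => .cons (simulates_start c k₀)
      (List.rel_append (simulates_spread n k₀) (.cons (simulates_finish k₀) .nil))
  · exact .cons (simulates_startMsg k₀) (simulates_spread n k₀)

end Rename

end Device

end Radio

/-! ### The broadcast algorithm: length and energy -/

namespace Radio

namespace Device

open Round

variable {I M V : Type} {K : ℕ} [Fintype V]

theorem length_spread (n : ℕ) (k₀ : Fin K) :
    (spread n k₀ : List (Round (Device I M K) K)).length = 2 * n + 1 := by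
  simp only [spread, List.length_cons, List.length_append, List.length_map, List.length_reverse,
    List.length_range]
  ring

theorem length_program (n : ℕ) (k₀ : Fin K) (x y : List (I → Fin K)) (z : List (I → Bool)) :
    (program n k₀ x y z : List (Round (Device I M K) K)).length =
      x.length + y.length * 2 + z.length * (2 * n + 3) + (2 * n + 2) := by
  simp only [program, merge, List.length_append, List.length_map, List.length_flatMap,
    List.length_cons, List.length_nil, List.map_const', List.sum_replicate, length_spread,
    smul_eq_mul]
  ring

theorem awakeCount_le_length {S : Type} (G : SimpleGraph V) (v : V) (l : List (Round S K))
    (σ : V → S) : awakeCount G v l σ ≤ l.length := by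
  induction l generalizing σ with
  | nil => simp [awakeCount]
  | cons I l ih =>
    have := ih (I.next G σ)
    simp only [awakeCount, List.length_cons]
    split_ifs <;> omega

theorem awakeCount_flatMap_le {S α : Type} (G : SimpleGraph V) (v : V) (f : α → List (Round S K))
    (b : ℕ) (h : ∀ a σ, awakeCount G v (f a) σ ≤ b) (l : List α) (σ : V → S) :
    awakeCount G v (l.flatMap f) σ ≤ l.length * b := by
  induction l generalizing σ with
  | nil => simp [awakeCount]
  | cons a l ih =>
    rw [List.flatMap_cons, awakeCount_append, List.length_cons, add_mul, one_mul, add_comm]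
    exact Nat.add_le_add (ih _) (h _ _)

theorem lab_cast (A B : ℕ → Prop) (k₀ : Fin K) (s : Device I M K)
    (r : Fin K → Option (Device I M K)) : ((cast A B k₀).upd s r).lab = s.lab := by
  unfold cast
  dsimp only
  split_ifs
  · rcases (pick (Offers A r)).bind r with _ | x <;> rfl
  · rfl

/-- Casts do not change labels, so the rounds in which a device is awake are known from its label at
the start. -/
theorem awakeCount_cast_le (G : SimpleGraph V) (v : V) (A B : ℕ → ℕ → Prop) (k₀ : Fin K)
    [∀ a, DecidablePred fun j => A j a ∨ B j a] (l : List ℕ) (σ : V → Device I M K) :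
    awakeCount G v (l.map fun j => cast (A j) (B j) k₀) σ ≤
      l.countP fun j => A j (σ v).lab ∨ B j (σ v).lab := by
  induction l generalizing σ with
  | nil => simp [awakeCount]
  | cons j l ih =>
    have h := ih ((cast (A j) (B j) k₀).next G σ)
    rw [show ((cast (A j) (B j) k₀).next G σ v).lab = (σ v).lab from lab_cast _ _ _ _ _] at h
    rw [List.map_cons, awakeCount, List.countP_cons]
    have : (cast (A j) (B j) k₀).awake (σ v) ↔ A j (σ v).lab ∨ B j (σ v).lab := Iff.rfl
    by_cases hj : A j (σ v).lab ∨ B j (σ v).lab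
    · rw [if_pos (this.2 hj), if_pos (by simpa using hj)]
      omega
    · rw [if_neg (mt this.1 hj), if_neg (by simpa using hj)]
      omega

theorem countP_le_two {l : List ℕ} (hl : l.Nodup) (p : ℕ → Prop) [DecidablePred p] (a b : ℕ)
    (h : ∀ j, p j → j = a ∨ j = b) : l.countP (fun j => p j) ≤ 2 := by
  rw [List.countP_eq_length_filter, ← List.toFinset_card_of_nodup (hl.filter _)]
  refine (Finset.card_le_card (t := {a, b}) ?_).trans Finset.card_le_two
  intro j hj
  simp only [List.mem_toFinset, List.mem_filter, decide_eq_true_eq] at hj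
  simpa using h j hj.2

/-- One round for the initial cast, and in each sweep a device with label `l` is awake only in the
rounds with index `l` and `l - 1`. -/
theorem awakeCount_spread_le (G : SimpleGraph V) (v : V) (n : ℕ) (k₀ : Fin K)
    (σ : V → Device I M K) : awakeCount G v (spread n k₀) σ ≤ 5 := by
  classical
  unfold spread
  rw [awakeCount, awakeCount_append]
  have h1 : ∀ σ : V → Device I M K, awakeCount G v
      ((List.range n).reverse.map fun j => cast (· = j + 1) (· = j) k₀) σ ≤ 2 := fun σ =>
    (awakeCount_cast_le G v _ _ k₀ _ _).trans <|
      countP_le_two (List.nodup_reverse.2 List.nodup_range) _ (σ v).lab ((σ v).lab - 1)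
        (by intro j; omega)
  have h2 : ∀ σ : V → Device I M K, awakeCount G v
      ((List.range n).map fun j => cast (· = j) (· = j + 1) k₀) σ ≤ 2 := fun σ =>
    (awakeCount_cast_le G v _ _ k₀ _ _).trans <|
      countP_le_two List.nodup_range _ (σ v).lab ((σ v).lab - 1) (by intro j; omega)
  refine (Nat.add_le_add ?_ (Nat.add_le_add (h1 _) (h2 _))).trans (le_refl (1 + (2 + 2)))
  split_ifs <;> omega

theorem awakeCount_merge_le (G : SimpleGraph V) (v : V) (n : ℕ) (k₀ : Fin K) (coin : I → Bool)
    (σ : V → Device I M K) : awakeCount G v (merge n k₀ coin) σ ≤ 5 := by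
  unfold merge
  rw [awakeCount, awakeCount_append, awakeCount, awakeCount,
    if_neg (show ¬ (start coin k₀).awake _ from id),
    if_neg (show ¬ (finish k₀).awake _ from id)]
  have := awakeCount_spread_le G v n k₀ ((start coin k₀).next G σ)
  omega

theorem awakeCount_program_le (G : SimpleGraph V) (v : V) (n : ℕ) (k₀ : Fin K)
    (x y : List (I → Fin K)) (z : List (I → Bool)) (σ : V → Device I M K) :
    awakeCount G v (program n k₀ x y z) σ ≤ x.length + y.length * 2 + z.length * 5 + 5 := by
  unfold program
  rw [awakeCount_append, awakeCount_append, awakeCount_append, awakeCount,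
    if_neg (show ¬ (startMsg k₀).awake _ from id)]
  have h1 := awakeCount_le_length G v (x.map announce) σ
  rw [List.length_map] at h1
  have h2 := fun σ => awakeCount_flatMap_le G v
    (fun c : I → Fin K => [(tryColour c : Round (Device I M K) K), keepColour c]) 2
    (fun a σ => awakeCount_le_length G v _ σ) y σ
  have h3 := fun σ => awakeCount_flatMap_le G v
    (merge n k₀ : (I → Bool) → List (Round (Device I M K) K)) 5
    (fun a σ => awakeCount_merge_le G v n k₀ a σ) z σ
  have h4 := fun σ => awakeCount_spread_le (I := I) (M := M) G v n k₀ σ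
  refine (Nat.add_le_add h1 (Nat.add_le_add (h2 _) (Nat.add_le_add (h3 _)
    (Nat.add_le_add le_rfl (h4 _))))).trans ?_
  omega

end Device

end Radio

/-! ### The broadcast algorithm: neighbours and colours -/

namespace Explorer

/-! ### Averages over independent uniform choices. -/

variable {β X V : Type} [Fintype β]

theorem avg_sum {ι : Type} (s : Finset ι) (F : ι → β → ℝ) :
    (avg fun b => ∑ i ∈ s, F i b) = ∑ i ∈ s, avg (F i) := by
  simp only [avg]
  rw [Finset.sum_comm, Finset.sum_div]

/-- A function that shrinks on average by the factor `q` in every step. -/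
theorem wordAvg_foldl_le (step : X → β → X) (Inv : X → Prop) (Φ : X → ℝ) {q : ℝ} (hq : 0 ≤ q)
    (hInv : ∀ x c, Inv x → Inv (step x c))
    (h : ∀ x, Inv x → (avg fun c => Φ (step x c)) ≤ q * Φ x) (L : ℕ) (x : X) (hx : Inv x) :
    wordAvg β L (fun l => Φ (l.foldl step x)) ≤ q ^ L * Φ x := by
  induction L generalizing x with
  | zero => simp [wordAvg]
  | succ L ih =>
    simp only [wordAvg, List.foldl_cons]
    calc (avg fun b => wordAvg β L fun l => Φ (l.foldl step (step x b)))
        ≤ avg fun b => q ^ L * Φ (step x b) := avg_mono fun b => ih _ (hInv _ _ hx)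
      _ = q ^ L * avg fun b => Φ (step x b) := avg_mul_left _ _
      _ ≤ q ^ L * (q * Φ x) := mul_le_mul_of_nonneg_left (h x hx) (pow_nonneg hq L)
      _ = q ^ (L + 1) * Φ x := by ring

variable [Fintype V] [DecidableEq V] [DecidableEq β]

/-- Resampling coordinate `a` maps pairs of a letter and a point of the event injectively to all
functions: `g` survives the resampling and restores the old value at `a`. -/
theorem avg_eq_le (a : V) (g : (V → β) → β) (hg : ∀ c x, g (Function.update c a x) = g c) :
    (avg fun c : V → β => if c a = g c then (1 : ℝ) else 0) ≤ 1 / Fintype.card β := by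
  rcases isEmpty_or_nonempty β with hβ | hβ
  · have : IsEmpty (V → β) := ⟨fun c => hβ.elim (c a)⟩
    simp [avg]
  · unfold avg
    rw [Finset.sum_boole]
    have hcard : Fintype.card β * (Finset.univ.filter fun c : V → β => c a = g c).card ≤
        Fintype.card (V → β) := by
      rw [← Fintype.card_coe, ← Fintype.card_prod]
      refine Fintype.card_le_of_injective
        (fun p : β × {c // c ∈ Finset.univ.filter fun c : V → β => c a = g c} =>
          Function.update p.2.1 a p.1) ?_
      rintro ⟨x, c, hc⟩ ⟨y, d, hd⟩ h
      simp only [Finset.mem_filter, Finset.mem_univ, true_and] at hc hd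
      simp only at h
      have h1 : x = y := by simpa using congrFun h a
      have h2 : g c = g d := by rw [← hg c x, h, hg]
      have h3 : c = d := by
        funext v
        by_cases hv : v = a
        · rw [hv, hc, hd, h2]
        · simpa [hv] using congrFun h v
      subst h1 h3
      rfl
    have h1 : (0 : ℝ) < Fintype.card β := by exact_mod_cast Fintype.card_pos
    have h2 : (0 : ℝ) < Fintype.card (V → β) := by exact_mod_cast Fintype.card_pos
    rw [div_le_div_iff₀ h2 h1, one_mul, mul_comm]
    exact_mod_cast hcard

/-- Forcing the two coins while remembering their old values is injective. -/
theorem avg_coin_le {a b : V} (hab : a ≠ b) :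
    (1 : ℝ) / 4 ≤ avg fun c : V → Bool => if c a = false ∧ c b = true then (1 : ℝ) else 0 := by
  unfold avg
  rw [Finset.sum_boole]
  have hcard : Fintype.card (V → Bool) ≤
      4 * (Finset.univ.filter fun c : V → Bool => c a = false ∧ c b = true).card := by
    have h4 : 4 = Fintype.card (Bool × Bool) := rfl
    rw [h4, ← Fintype.card_coe, ← Fintype.card_prod]
    refine Fintype.card_le_of_injective
      (fun c => ((c a, c b), (⟨Function.update (Function.update c a false) b true, by
        simp [hab]⟩ :
        {c // c ∈ Finset.univ.filter fun c : V → Bool => c a = false ∧ c b = true}))) ?_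
    intro c d h
    simp only [Prod.mk.injEq, Subtype.mk.injEq] at h
    funext v
    by_cases hv : v = a
    · rw [hv, h.1.1]
    · by_cases hw : v = b
      · rw [hw, h.1.2]
      · simpa [hv, hw] using congrFun h.2 v
  have h2 : (0 : ℝ) < Fintype.card (V → Bool) := by exact_mod_cast Fintype.card_pos
  rw [div_le_div_iff₀ (by norm_num) h2, one_mul, mul_comm]
  exact_mod_cast hcard

end Explorer

namespace Radio

namespace Round

variable {S V α : Type} {K : ℕ} [Fintype V]

theorem exec_flatMap (G : SimpleGraph V) (f : α → List (Round S K)) (l : List α) (σ : V → S) :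
    exec G (l.flatMap f) σ = l.foldl (fun σ a => exec G (f a) σ) σ := by
  induction l generalizing σ with
  | nil => rfl
  | cons a l ih => rw [List.flatMap_cons, exec_append, ih, List.foldl_cons]

/-- The device `v` receives the state of `u` in the round `I`. -/
def Hears (I : Round S K) (G : SimpleGraph V) (σ : V → S) (v u : V) : Prop :=
  I.awake (σ v) ∧ I.awake (σ u) ∧ G.Adj v u ∧ I.col (σ v) ≠ I.col (σ u) ∧
    ∀ w, G.Adj v w → I.awake (σ w) → I.col (σ w) = I.col (σ u) → w = u

theorem heard_eq_some_iff {I : Round S K} {G : SimpleGraph V} {σ : V → S} {v : V} {k : Fin K}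
    {x : S} : I.heard G σ v k = some x ↔ ∃ u, I.Hears G σ v u ∧ I.col (σ u) = k ∧ σ u = x := by
  constructor
  · intro h
    obtain ⟨h1, h2, u, h3, h4, rfl, rfl, h5⟩ := exists_of_heard h
    exact ⟨u, ⟨h1, h4, h3, h2, h5⟩, rfl, rfl⟩
  · rintro ⟨u, ⟨h1, h2, h3, h4, h5⟩, rfl, rfl⟩
    exact heard_eq_some h1 h2 h3 h4 h5

end Round

namespace Device

open Round

variable {M V : Type} {K : ℕ} [Fintype V] {G : SimpleGraph V}

/-- The device `v` receives the message of `u` if all devices are awake and have the colours `κ`. -/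
def Receives (G : SimpleGraph V) (κ : V → Fin K) (v u : V) : Prop :=
  G.Adj v u ∧ κ v ≠ κ u ∧ ∀ w, G.Adj v w → κ w = κ u → w = u

omit [Fintype V] in
-- The case `w = v` is a listener that itself sends in the slot of `u`. The conclusion prepares a
-- union bound over the closed neighbourhood of `v`.
theorem exists_collision {κ : V → Fin K} {v u : V} (h : G.Adj v u) (hn : ¬ Receives G κ v u) :
    ∃ w, (w = v ∨ G.Adj v w) ∧ w ≠ u ∧ κ w = κ u := by
  unfold Receives at hn
  push Not at hn
  by_cases hc : κ v = κ u
  · exact ⟨v, Or.inl rfl, h.ne, hc⟩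
  · obtain ⟨w, h1, h2, h3⟩ := hn h hc
    exact ⟨w, Or.inr h1, h3, h2⟩

/-- All clusters are singletons, and the devices know the messages given by `f`. -/
def Fresh (f : V → Option M) (σ : V → Device V M K) : Prop :=
  ∀ v, (σ v).me = v ∧ (σ v).lab = 0 ∧ (σ v).rt = v ∧ (σ v).msg = f v

/-! #### Learning the neighbours -/

theorem ids_heard {I : Round (Device V M K) K} {σ : V → Device V M K} (hme : ∀ v, (σ v).me = v)
    (v : V) : ids (I.heard G σ v) = {u | I.Hears G σ v u} := by
  ext y
  constructor
  · rintro ⟨k, x, h, rfl⟩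
    obtain ⟨u, hu, -, rfl⟩ := heard_eq_some_iff.1 h
    rw [hme]
    exact hu
  · intro h
    exact ⟨_, _, heard_eq_some_iff.2 ⟨y, h, rfl, rfl⟩, hme y⟩

theorem known_announce {σ : V → Device V M K} (hme : ∀ v, (σ v).me = v) (c : V → Fin K) (v : V) :
    ((announce c).next G σ v).known = (σ v).known ∪ {u | Receives G c v u} := by
  change (σ v).known ∪ ids ((announce c).heard G σ v) = _
  rw [ids_heard hme]
  congr 1
  ext u
  simp only [Hears, Receives, announce, hme, true_and, forall_const, Set.mem_ofPred_eq]

/-- The state while the devices learn their neighbours. -/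
def Learning (G : SimpleGraph V) (f : V → Option M) (σ : V → Device V M K) : Prop :=
  Fresh f σ ∧ (∀ v, (σ v).known ⊆ {u | G.Adj v u}) ∧ ∀ v, (σ v).fixed = none

theorem Learning.announce {f : V → Option M} {σ : V → Device V M K} (h : Learning G f σ)
    (c : V → Fin K) : Learning G f ((announce c).next G σ) := by
  refine ⟨h.1, fun v => ?_, h.2.2⟩
  rw [known_announce fun v => (h.1 v).1]
  exact Set.union_subset (h.2.1 v) fun u hu => hu.1

open Classical in
/-- The pairs of neighbours of which the first does not know the second. -/
noncomputable def unknown (G : SimpleGraph V) (σ : V → Device V M K) : Finset (V × V) :=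
  Finset.univ.filter fun p => G.Adj p.1 p.2 ∧ p.2 ∉ (σ p.1).known

open Classical in
theorem card_nbrs_le {Δ : ℕ} (hΔ : ∀ v, (G.neighborSet v).ncard ≤ Δ) (v : V) :
    (Finset.univ.filter (G.Adj v)).card ≤ Δ := by
  refine le_trans (le_of_eq ?_) (hΔ v)
  rw [← Set.ncard_coe_finset]
  congr 1
  ext u
  simp

open Classical in
theorem card_ball_le {Δ : ℕ} (hΔ : ∀ v, (G.neighborSet v).ncard ≤ Δ) (v : V) :
    (Finset.univ.filter fun w => w = v ∨ G.Adj v w).card ≤ Δ + 1 := by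
  have : (Finset.univ.filter fun w => w = v ∨ G.Adj v w) =
      insert v (Finset.univ.filter (G.Adj v)) := by
    ext w
    simp
  rw [this]
  exact (Finset.card_insert_le _ _).trans (Nat.add_le_add_right (card_nbrs_le hΔ v) 1)

open Classical in
/-- The sum of the indicators of collisions around `v` and `u`. -/
theorem indicator_not_receives_le {κ : V → Fin K} {v u : V} (h : G.Adj v u) :
    (if ¬ Receives G κ v u then (1 : ℝ) else 0) ≤
      ∑ w ∈ (Finset.univ.filter fun w => w = v ∨ G.Adj v w).filter (· ≠ u),
        if κ w = κ u then (1 : ℝ) else 0 := by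
  by_cases hn : Receives G κ v u
  · rw [if_neg (not_not.2 hn)]
    exact Finset.sum_nonneg fun w _ => by positivity
  · rw [if_pos hn]
    obtain ⟨w, h1, h2, h3⟩ := exists_collision h hn
    refine le_trans (by rw [if_pos h3]) (Finset.single_le_sum
      (f := fun w => if κ w = κ u then (1 : ℝ) else 0) (fun w _ => by positivity)
      (Finset.mem_filter.2 ⟨Finset.mem_filter.2 ⟨Finset.mem_univ w, h1⟩, h2⟩))

open Classical in
-- If one of the two vertices has no fixed colour, its trial colour is uniform and independent of
-- the other; if both are fixed, they differ by hypothesis.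
theorem avg_collision_le (F : V → Option (Fin K)) {a b : V} (hab : a ≠ b)
    (hF : F a ≠ none → F a ≠ F b) :
    (Explorer.avg fun c : V → Fin K =>
      if (F a).getD (c a) = (F b).getD (c b) then (1 : ℝ) else 0) ≤ 1 / K := by
  have key : ∀ a b : V, a ≠ b → F a = none → (Explorer.avg fun c : V → Fin K =>
      if (F a).getD (c a) = (F b).getD (c b) then (1 : ℝ) else 0) ≤ 1 / K := by
    intro a b hab ha
    have := Explorer.avg_eq_le a (fun c : V → Fin K => (F b).getD (c b)) fun c x => by
      rw [Function.update_of_ne hab.symm]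
    rw [Fintype.card_fin] at this
    simpa only [ha, Option.getD_none] using this
  rcases ha : F a with _ | x
  · simpa only [ha] using key a b hab ha
  · rcases hb : F b with _ | y
    · have := key b a hab.symm hb
      simp only [ha, hb, Option.getD_none, Option.getD_some] at this ⊢
      simpa only [eq_comm] using this
    · have hxy : x ≠ y := by
        have := hF (by simp [ha])
        rw [ha, hb] at this
        simpa using this
      simp [hxy, Explorer.avg]

open Classical in
theorem avg_not_receives_le {Δ : ℕ} (hΔ : ∀ v, (G.neighborSet v).ncard ≤ Δ)
    (F : V → Option (Fin K)) {v u : V} (h : G.Adj v u)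
    (hF : ∀ w, (w = v ∨ G.Adj v w) → w ≠ u → F w ≠ none → F w ≠ F u) :
    (Explorer.avg fun c : V → Fin K =>
      if ¬ Receives G (fun v => (F v).getD (c v)) v u then (1 : ℝ) else 0) ≤ (Δ + 1) / K := by
  refine (Explorer.avg_mono fun c => indicator_not_receives_le h).trans ?_
  rw [Explorer.avg_sum]
  refine (Finset.sum_le_card_nsmul _ _ (1 / (K : ℝ)) fun w hw => ?_).trans ?_
  · simp only [Finset.mem_filter, Finset.mem_univ, true_and] at hw
    exact avg_collision_le F hw.2 (hF w hw.1 hw.2)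
  · rw [nsmul_eq_mul, mul_one_div]
    refine div_le_div_of_nonneg_right ?_ (Nat.cast_nonneg K)
    exact_mod_cast (Finset.card_filter_le _ _).trans (card_ball_le hΔ v)

open Classical in
-- Each missing pair stays missing with probability at most `(Δ + 1) / K ≤ 1/2`.
theorem avg_unknown_le {Δ : ℕ} (hΔ : ∀ v, (G.neighborSet v).ncard ≤ Δ)
    (hK : 2 * (Δ + 1) ≤ K) {f : V → Option M} {σ : V → Device V M K} (h : Learning G f σ) :
    (Explorer.avg fun c : V → Fin K => ((unknown G ((announce c).next G σ)).card : ℝ)) ≤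
      1 / 2 * (unknown G σ).card := by
  have h1 : ∀ c : V → Fin K, ((unknown G ((announce c).next G σ)).card : ℝ) ≤
      ∑ p ∈ unknown G σ, if ¬ Receives G c p.1 p.2 then (1 : ℝ) else 0 := by
    intro c
    rw [Finset.sum_boole]
    refine Nat.cast_le.2 (Finset.card_le_card fun p hp => ?_)
    simp only [unknown, Finset.mem_filter, Finset.mem_univ, true_and] at hp ⊢
    rw [known_announce fun v => (h.1 v).1] at hp
    exact ⟨⟨hp.1, fun hq => hp.2 (Or.inl hq)⟩, fun hq => hp.2 (Or.inr hq)⟩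
  refine (Explorer.avg_mono h1).trans ?_
  rw [Explorer.avg_sum]
  refine (Finset.sum_le_card_nsmul _ _ (1 / 2) fun p hp => ?_).trans ?_
  · simp only [unknown, Finset.mem_filter, Finset.mem_univ, true_and] at hp
    have := avg_not_receives_le (K := K) hΔ (fun _ => none) hp.1 fun w _ _ hw => (hw rfl).elim
    refine this.trans ?_
    have hK' : (2 * (Δ + 1) : ℝ) ≤ K := by exact_mod_cast hK
    rw [div_le_div_iff₀ (by linarith [(Nat.cast_nonneg Δ : (0 : ℝ) ≤ Δ)]) (by norm_num)]
    linarith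
  · rw [nsmul_eq_mul, mul_comm]

/-! #### Colouring -/

/-- The vertices `a` and `b` are distinct and at distance at most two. -/
def Near (G : SimpleGraph V) (a b : V) : Prop :=
  a ≠ b ∧ (G.Adj a b ∨ ∃ z, G.Adj a z ∧ G.Adj z b)

/-- The state while the devices choose colours. -/
def Colouring (G : SimpleGraph V) (f : V → Option M) (σ : V → Device V M K) : Prop :=
  Fresh f σ ∧ (∀ v, (σ v).known = {u | G.Adj v u}) ∧
    ∀ a b, Near G a b → (σ a).fixed ≠ none → (σ a).fixed ≠ (σ b).fixed

/-- One attempt at choosing colours. -/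
noncomputable def attempt (c : V → Fin K) : List (Round (Device V M K) K) :=
  [tryColour c, keepColour c]

/-- The colours used in the attempt. -/
def trial (σ : V → Device V M K) (c : V → Fin K) (v : V) : Fin K := (σ v).fixed.getD (c v)

open Classical in
theorem exec_attempt {σ : V → Device V M K} (hme : ∀ v, (σ v).me = v)
    (hkn : ∀ v, (σ v).known = {u | G.Adj v u}) (c : V → Fin K) (v : V) :
    exec G (attempt c) σ v = { σ v with
      heard := {u | Receives G (trial σ c) v u}
      fixed := if (σ v).fixed = none ∧ ∀ u, G.Adj v u →
          Receives G (trial σ c) v u ∧ Receives G (trial σ c) u v then some (c v)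
        else (σ v).fixed } := by
  have hτ : ∀ v, (tryColour c).next G σ v =
      { σ v with heard := {u | Receives G (trial σ c) v u} } := by
    intro v
    unfold next
    simp only [tryColour]
    congr 1
    have := ids_heard (G := G) (I := tryColour c) hme v
    simp only [tryColour] at this
    rw [this]
    ext u
    simp only [Hears, Receives, trial, hme, true_and, forall_const, Set.mem_ofPred_eq]
  change (keepColour c).next G ((tryColour c).next G σ) v = _
  set τ := (tryColour c).next G σ with hτdef
  have hconf : Confirmed (τ v) ((keepColour c).heard G τ v) ↔ ∀ u, G.Adj v u →
      Receives G (trial σ c) v u ∧ Receives G (trial σ c) u v := by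
    have hH : ∀ u, (keepColour c).Hears G τ v u ↔ Receives G (trial σ c) v u := by
      intro u
      simp only [Hears, Receives, trial, keepColour, hτ, hme, true_and, forall_const]
    unfold Confirmed
    have h1 : (τ v).known = {u | G.Adj v u} := by rw [hτ]; exact hkn v
    have h2 : (τ v).me = v := by rw [hτ]; exact hme v
    rw [h1, h2]
    refine forall₂_congr fun u hu => ⟨?_, ?_⟩
    · rintro ⟨k, x, hx, hxu, hvx⟩
      obtain ⟨w, hw, -, rfl⟩ := heard_eq_some_iff.1 hx
      rw [hτ] at hxu hvx
      obtain rfl : w = u := (hme w).symm.trans hxu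
      exact ⟨(hH w).1 hw, hvx⟩
    · rintro ⟨h3, h4⟩
      refine ⟨_, _, heard_eq_some_iff.2 ⟨u, (hH u).2 h3, rfl, rfl⟩, ?_, ?_⟩
      · rw [hτ]; exact hme u
      · rw [hτ]; exact h4
  have hfx : (τ v).fixed = (σ v).fixed := by rw [hτ]
  change (if (τ v).fixed = none ∧ Confirmed (τ v) ((keepColour c).heard G τ v) then
    { τ v with fixed := some (c (τ v).me) } else τ v) = _
  simp only [hconf, hfx]
  split_ifs with hif
  · rw [hτ, hme]
  · rw [hτ]

/-- Mutual reception certifies a colour up to distance two: hearing a neighbour rules out its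
colour, and being heard by a neighbour `z` rules out the colours of all other neighbours of `z`.
Fixed colours take part in every trial, so they are respected as well. -/
theorem Colouring.attempt {f : V → Option M} {σ : V → Device V M K} (h : Colouring G f σ)
    (c : V → Fin K) : Colouring G f (exec G (attempt c) σ) := by
  classical
  have hex := exec_attempt (fun v => (h.1 v).1) h.2.1 c
  set τ := exec G (Device.attempt c) σ with hτ
  refine ⟨fun v => by rw [hex]; exact h.1 v, fun v => by rw [hex]; exact h.2.1 v, ?_⟩
  have hkeep : ∀ v x, (σ v).fixed = some x → (τ v).fixed = some x := by
    intro v x hx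
    rw [hex]
    simp [hx]
  have htrial : ∀ v, (τ v).fixed ≠ none → (τ v).fixed = some (trial σ c v) := by
    intro v hv
    rcases hx : (σ v).fixed with _ | x
    · rw [hex] at hv ⊢
      simp only [hx, true_and] at hv ⊢
      split_ifs at hv ⊢ with hif
      · simp [trial, hx]
      · exact (hv rfl).elim
    · rw [hkeep v x hx, trial, hx]
      rfl
  have hnew : ∀ a b, Near G a b → (σ a).fixed = none → (τ a).fixed ≠ none →
      trial σ c a ≠ trial σ c b := by
    intro a b hab ha hτa
    rw [hex] at hτa
    simp only [ha, true_and] at hτa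
    split_ifs at hτa with hif
    · rcases hab.2 with h1 | ⟨z, h1, h2⟩
      · exact (hif b h1).1.2.1
      · intro heq
        exact hab.1 ((hif z h1).2.2.2 b h2 heq.symm).symm
    · exact (hτa rfl).elim
  intro a b hab hτa heq
  have hba : Near G b a := ⟨hab.1.symm,
    hab.2.imp SimpleGraph.Adj.symm fun ⟨z, h1, h2⟩ => ⟨z, h2.symm, h1.symm⟩⟩
  have hτb : (τ b).fixed ≠ none := heq ▸ hτa
  rcases ha : (σ a).fixed with _ | x
  · refine hnew a b hab ha hτa ?_
    rw [htrial a hτa, htrial b hτb] at heq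
    exact Option.some.inj heq
  · rcases hb : (σ b).fixed with _ | y
    · refine hnew b a hba hb hτb ?_
      rw [htrial a hτa, htrial b hτb] at heq
      exact (Option.some.inj heq).symm
    · refine h.2.2 a b hab (by simp [ha]) ?_
      rw [hkeep a x ha, hkeep b y hb] at heq
      rw [ha, hb, heq]

open Classical in
/-- The devices without a colour. -/
noncomputable def uncoloured (σ : V → Device V M K) : Finset V :=
  Finset.univ.filter fun v => (σ v).fixed = none

open Classical in
-- A device fails only if one of at most `2Δ` receptions fails, each with probability at most `(Δ +
-- 1) / K`; the bound `4 (Δ + 1)² ≤ K` makes the total at most 1/2.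
theorem avg_uncoloured_le {Δ : ℕ} (hΔ : ∀ v, (G.neighborSet v).ncard ≤ Δ)
    (hK : 4 * (Δ + 1) ^ 2 ≤ K) {f : V → Option M} {σ : V → Device V M K} (h : Colouring G f σ) :
    (Explorer.avg fun c : V → Fin K => ((uncoloured (exec G (attempt c) σ)).card : ℝ)) ≤
      1 / 2 * (uncoloured σ).card := by
  have hex := exec_attempt (fun v => (h.1 v).1) h.2.1
  have hcard : ∀ c : V → Fin K, ((uncoloured (exec G (attempt c) σ)).card : ℝ) ≤
      ∑ v ∈ uncoloured σ, ∑ u ∈ Finset.univ.filter (G.Adj v),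
        ((if ¬ Receives G (trial σ c) v u then (1 : ℝ) else 0) +
          if ¬ Receives G (trial σ c) u v then (1 : ℝ) else 0) := by
    intro c
    have h0 : ∀ v u, (0 : ℝ) ≤ (if ¬ Receives G (trial σ c) v u then (1 : ℝ) else 0) +
          if ¬ Receives G (trial σ c) u v then (1 : ℝ) else 0 := by
      intro v u; positivity
    calc ((uncoloured (exec G (attempt c) σ)).card : ℝ)
        = ∑ v ∈ uncoloured (exec G (attempt c) σ), (1 : ℝ) := by simp
      _ ≤ ∑ v ∈ uncoloured (exec G (attempt c) σ), ∑ u ∈ Finset.univ.filter (G.Adj v),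
          ((if ¬ Receives G (trial σ c) v u then (1 : ℝ) else 0) +
            if ¬ Receives G (trial σ c) u v then (1 : ℝ) else 0) := by
          refine Finset.sum_le_sum fun v hv => ?_
          simp only [uncoloured, Finset.mem_filter, Finset.mem_univ, true_and] at hv
          rw [hex] at hv
          simp only at hv
          split_ifs at hv with hif
          have hn : ∃ u, G.Adj v u ∧
              ¬ (Receives G (trial σ c) v u ∧ Receives G (trial σ c) u v) := by
            by_contra hcon
            push Not at hcon
            exact hif ⟨hv, hcon⟩
          obtain ⟨u, hu, hn⟩ := hn
          refine le_trans ?_ (Finset.single_le_sum (fun u _ => h0 v u)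
            (Finset.mem_filter.2 ⟨Finset.mem_univ u, hu⟩))
          by_cases h1 : Receives G (trial σ c) v u
          · rw [if_pos (fun h2 => hn ⟨h1, h2⟩ : ¬ Receives G (trial σ c) u v)]
            simp [h1]
          · rw [if_pos h1]
            have : (0 : ℝ) ≤ if ¬ Receives G (trial σ c) u v then (1 : ℝ) else 0 := by positivity
            linarith
      _ ≤ _ := by
          refine Finset.sum_le_sum_of_subset_of_nonneg (fun v hv => ?_)
            fun v _ _ => Finset.sum_nonneg fun u _ => h0 v u
          simp only [uncoloured, Finset.mem_filter, Finset.mem_univ, true_and] at hv ⊢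
          rw [hex] at hv
          simp only at hv
          split_ifs at hv
          exact hv
  refine (Explorer.avg_mono hcard).trans ?_
  rw [Explorer.avg_sum]
  refine (Finset.sum_le_card_nsmul _ _ (1 / 2) fun v hv => ?_).trans ?_
  · simp only [uncoloured, Finset.mem_filter, Finset.mem_univ, true_and] at hv
    rw [Explorer.avg_sum]
    have hK' : (4 * (Δ + 1) ^ 2 : ℝ) ≤ K := by exact_mod_cast hK
    have hΔ0 : (0 : ℝ) ≤ Δ := Nat.cast_nonneg Δ
    have hK0 : (0 : ℝ) < K := by nlinarith
    refine (Finset.sum_le_card_nsmul _ _ ((Δ + 1) / K + (Δ + 1) / K : ℝ) fun u hu => ?_).trans ?_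
    · simp only [Finset.mem_filter, Finset.mem_univ, true_and] at hu
      rw [Explorer.avg_add]
      refine add_le_add ?_ ?_
      -- Competitors of `u` at `v` are `v` itself, which has no colour yet, and other neighbours of
      -- `v`, which are at distance at most two from `u`.
      · refine avg_not_receives_le hΔ (fun v => (σ v).fixed) hu fun w hw hne hw' => ?_
        rcases hw with rfl | hw
        · exact (hw' hv).elim
        · exact h.2.2 w u ⟨hne, Or.inr ⟨v, hw.symm, hu⟩⟩ hw'
      · refine avg_not_receives_le hΔ (fun v => (σ v).fixed) hu.symm fun w hw hne hw' => ?_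
        rw [hv]
        exact hw'
    · rw [nsmul_eq_mul]
      have h1 : ((Finset.univ.filter (G.Adj v)).card : ℝ) ≤ Δ := by
        exact_mod_cast card_nbrs_le hΔ v
      have h2 : (0 : ℝ) ≤ (Δ + 1) / K + (Δ + 1) / K := by positivity
      refine (mul_le_mul_of_nonneg_right h1 h2).trans ?_
      rw [← add_div, ← mul_div_assoc, div_le_div_iff₀ hK0 (by norm_num)]
      nlinarith
  · rw [nsmul_eq_mul, mul_comm]

end Device

end Radio

/-! ### The broadcast algorithm: merging clusters -/

namespace Radio

namespace Device

open Round

variable {M V : Type} {K : ℕ} [Fintype V] {G : SimpleGraph V} {k₀ : Fin K}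

/-- All devices have colours, and these differ at distance at most two. -/
def Coloured (G : SimpleGraph V) (σ : V → Device V M K) : Prop :=
  (∀ v, (σ v).fixed ≠ none) ∧ ∀ a b, Near G a b → (σ a).fixed ≠ (σ b).fixed

/-- Some devices without a new label take over the new label of a neighbour. -/
def Takes (G : SimpleGraph V) (σ τ : V → Device V M K) : Prop :=
  ∀ v, τ v = σ v ∨ (σ v).new = none ∧
    ∃ u, G.Adj v u ∧ (σ u).new ≠ none ∧ τ v = takeFrom (σ v) (σ u)

omit [Fintype V] in
theorem Takes.same {σ τ : V → Device V M K} (h : Takes G σ τ) (v : V) :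
    (τ v).fixed = (σ v).fixed ∧ (τ v).lab = (σ v).lab ∧ (τ v).rt = (σ v).rt := by
  rcases h v with h | ⟨-, u, -, -, h⟩ <;> rw [h] <;> exact ⟨rfl, rfl, rfl⟩

omit [Fintype V] in
theorem Takes.eq_of_new {σ τ : V → Device V M K} (h : Takes G σ τ) {v : V}
    (hv : (σ v).new ≠ none) : τ v = σ v := by
  rcases h v with h | ⟨hn, -⟩
  · exact h
  · exact (hv hn).elim

omit [Fintype V] in
theorem Coloured.congr {σ τ : V → Device V M K} (h : Coloured G σ)
    (hf : ∀ v, (τ v).fixed = (σ v).fixed) : Coloured G τ := by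
  refine ⟨fun v => ?_, fun a b hab => ?_⟩
  · rw [hf]; exact h.1 v
  · rw [hf, hf]; exact h.2 a b hab

/-- Repeated taking. -/
abbrev TakesStar (G : SimpleGraph V) : (V → Device V M K) → (V → Device V M K) → Prop :=
  Relation.ReflTransGen (Takes G)

omit [Fintype V] in
theorem TakesStar.same {σ τ : V → Device V M K} (h : TakesStar G σ τ) (v : V) :
    (τ v).fixed = (σ v).fixed ∧ (τ v).lab = (σ v).lab ∧ (τ v).rt = (σ v).rt := by
  induction h with
  | refl => exact ⟨rfl, rfl, rfl⟩
  | tail _ h ih =>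
    obtain ⟨h1, h2, h3⟩ := h.same v
    exact ⟨h1.trans ih.1, h2.trans ih.2.1, h3.trans ih.2.2⟩

omit [Fintype V] in
theorem TakesStar.eq_of_new {σ τ : V → Device V M K} (h : TakesStar G σ τ) {v : V}
    (hv : (σ v).new ≠ none) : τ v = σ v := by
  induction h with
  | refl => rfl
  | tail _ h ih => rw [h.eq_of_new (by rwa [ih]), ih]

omit [Fintype V] in
theorem TakesStar.new_ne {σ τ : V → Device V M K} (h : TakesStar G σ τ) {v : V}
    (hv : (σ v).new ≠ none) : (τ v).new ≠ none := by
  rwa [h.eq_of_new hv]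

omit [Fintype V] in
/-- A new label that has been taken comes from a neighbour. -/
theorem TakesStar.origin {σ τ : V → Device V M K} (h : TakesStar G σ τ) {v : V} {p : ℕ × V}
    (hv : (τ v).new = some p) : (σ v).new = some p ∨
      ∃ u l, G.Adj v u ∧ p.1 = l + 1 ∧ (τ u).new = some (l, p.2) := by
  induction h with
  | refl => exact Or.inl hv
  | @tail τ τ' _ h ih =>
    have hkeep : ∀ u q, (τ u).new = some q → (τ' u).new = some q := by
      intro u q hq
      rw [h.eq_of_new (by simp [hq]), hq]
    rcases h v with h' | ⟨-, u, hu, hn, h'⟩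
    · rw [h'] at hv
      refine (ih hv).imp_right ?_
      rintro ⟨u, l, h1, h2, h3⟩
      exact ⟨u, l, h1, h2, hkeep _ _ h3⟩
    · right
      obtain ⟨q, hq⟩ := Option.ne_none_iff_exists'.1 hn
      rw [h'] at hv
      simp only [takeFrom, hq, Option.map_some, Option.some.injEq] at hv
      subst hv
      exact ⟨u, q.1, hu, rfl, hkeep _ _ hq⟩

/-- Colours differ on every closed neighbourhood, so an awake device hears all its awake neighbours.
It stays unchanged for lack of an offer only if there is none. -/
theorem next_cast {σ : V → Device V M K} (hσ : Coloured G σ) (A B : ℕ → Prop) (v : V) :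
    ((cast A B k₀).next G σ v = σ v ∧ (B (σ v).lab → (σ v).new = none →
      ∀ u, G.Adj v u → A (σ u).lab → (σ u).new = none)) ∨
    (B (σ v).lab ∧ (σ v).new = none ∧ ∃ u, G.Adj v u ∧ A (σ u).lab ∧ (σ u).new ≠ none ∧
      (cast A B k₀).next G σ v = takeFrom (σ v) (σ u)) := by
  have hne : ∀ a b, Near G a b → (σ a).fixed.getD k₀ ≠ (σ b).fixed.getD k₀ := by
    intro a b hab
    obtain ⟨x, hx⟩ := Option.ne_none_iff_exists'.1 (hσ.1 a)
    obtain ⟨y, hy⟩ := Option.ne_none_iff_exists'.1 (hσ.1 b)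
    have := hσ.2 a b hab
    rw [hx, hy] at this ⊢
    exact fun h => this (congrArg some h)
  have hhears : ∀ u, G.Adj v u → B (σ v).lab → A (σ u).lab → (cast A B k₀).Hears G σ v u := by
    intro u hu hB hA
    refine ⟨Or.inr hB, Or.inl hA, hu, hne v u ⟨hu.ne, Or.inl hu⟩, fun w hw _ hcol => ?_⟩
    by_contra hwu
    exact hne w u ⟨hwu, Or.inr ⟨v, hw.symm, hu⟩⟩ hcol
  by_cases hB : B (σ v).lab ∧ (σ v).new = none
  · have hup : (cast A B k₀).next G σ v =
        ((pick (Offers A ((cast A B k₀).heard G σ v))).bind ((cast A B k₀).heard G σ v)).elim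
          (σ v) (takeFrom (σ v)) := if_pos hB
    by_cases hu : ∃ u, G.Adj v u ∧ A (σ u).lab ∧ (σ u).new ≠ none
    · right
      obtain ⟨u, h1, h2, h3⟩ := hu
      refine ⟨hB.1, hB.2, ?_⟩
      obtain ⟨k, hk⟩ := exists_pick (p := Offers A ((cast A B k₀).heard G σ v))
        ⟨σ u, heard_eq_some_iff.2 ⟨u, hhears u h1 hB.1 h2, rfl, rfl⟩, h2,
          Option.isSome_iff_ne_none.2 h3⟩
      obtain ⟨x, hx, hA, hn⟩ := pick_spec hk
      obtain ⟨w, hw, -, rfl⟩ := heard_eq_some_iff.1 hx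
      refine ⟨w, hw.2.2.1, hA, Option.isSome_iff_ne_none.1 hn, ?_⟩
      rw [hup, hk, Option.bind_some, hx]
      rfl
    · left
      push Not at hu
      refine ⟨?_, fun _ _ => hu⟩
      have hp : pick (Offers A ((cast A B k₀).heard G σ v)) = none := by
        rcases hk : pick (Offers A ((cast A B k₀).heard G σ v)) with _ | k
        · rfl
        · obtain ⟨x, hx, hA, hn⟩ := pick_spec hk
          obtain ⟨w, hw, -, rfl⟩ := heard_eq_some_iff.1 hx
          rw [hu w hw.2.2.1 hA] at hn
          cases hn
      rw [hup, hp]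
      rfl
  · left
    exact ⟨if_neg hB, fun h1 h2 => (hB ⟨h1, h2⟩).elim⟩

theorem takes_cast {σ : V → Device V M K} (hσ : Coloured G σ) (A B : ℕ → Prop) :
    Takes G σ ((cast A B k₀).next G σ) := by
  intro v
  rcases next_cast (k₀ := k₀) hσ A B v with ⟨h, -⟩ | ⟨-, h1, u, h2, -, h3, h4⟩
  · exact Or.inl h
  · exact Or.inr ⟨h1, u, h2, h3, h4⟩

/-- A cast reaches all devices it is meant for. -/
theorem new_cast {σ : V → Device V M K} (hσ : Coloured G σ) {A B : ℕ → Prop} {v u : V}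
    (h : G.Adj v u) (hB : B (σ v).lab) (hA : A (σ u).lab) (hu : (σ u).new ≠ none) :
    ((cast A B k₀).next G σ v).new ≠ none := by
  rcases next_cast (k₀ := k₀) hσ A B v with ⟨h1, h2⟩ | ⟨-, -, w, -, -, h3, h4⟩
  · rw [h1]
    exact fun hn => hu (h2 hB hn u h hA)
  · rw [h4]
    simpa [takeFrom] using h3

theorem next_cast_of_not {σ : V → Device V M K} (hσ : Coloured G σ) {A B : ℕ → Prop} {v : V}
    (hB : ¬ B (σ v).lab) : (cast A B k₀).next G σ v = σ v := by
  rcases next_cast (k₀ := k₀) hσ A B v with ⟨h, -⟩ | ⟨h, -⟩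
  · exact h
  · exact (hB h).elim

/-- The sweep towards the roots. -/
noncomputable def upSweep (n : ℕ) (k₀ : Fin K) : List (Round (Device V M K) K) :=
  (List.range n).reverse.map fun j => cast (· = j + 1) (· = j) k₀

/-- The sweep away from the roots. -/
noncomputable def downSweep (n : ℕ) (k₀ : Fin K) : List (Round (Device V M K) K) :=
  (List.range n).map fun j => cast (· = j) (· = j + 1) k₀

/-- The second clause carries the induction: later rounds do not touch the higher labels, so a child
that ends with a new label already had it when its parent listened. -/
theorem takesStar_upSweep (n : ℕ) {σ : V → Device V M K} (hσ : Coloured G σ) :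
    TakesStar G σ (exec G (upSweep n k₀) σ) ∧
    (∀ v, n ≤ (σ v).lab → exec G (upSweep n k₀) σ v = σ v) ∧
    ∀ v u, G.Adj v u → (σ v).lab = (σ u).lab + 1 → (σ u).lab < n →
      (exec G (upSweep n k₀) σ v).new ≠ none → (exec G (upSweep n k₀) σ u).new ≠ none := by
  induction n generalizing σ with
  | zero => exact ⟨.refl, fun _ _ => rfl, fun _ _ _ _ h => absurd h (Nat.not_lt_zero _)⟩
  | succ n ih =>
    have e : upSweep (n + 1) k₀ = (cast (· = n + 1) (· = n) k₀ : Round (Device V M K) K) ::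
        upSweep n k₀ := by
      simp [upSweep, List.range_succ]
    rw [e, exec]
    have ht := takes_cast (k₀ := k₀) hσ (· = n + 1) (· = n)
    have hn : ∀ v, (σ v).lab ≠ n → (cast (· = n + 1) (· = n) k₀).next G σ v = σ v :=
      fun v hv => next_cast_of_not hσ hv
    have hnew : ∀ v u, G.Adj v u → (σ v).lab = n → (σ u).lab = n + 1 → (σ u).new ≠ none →
        ((cast (· = n + 1) (· = n) k₀).next G σ v).new ≠ none :=
      fun v u h h1 h2 h3 => new_cast hσ h h1 h2 h3
    set τ := (cast (· = n + 1) (· = n) k₀).next G σ with hτ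
    obtain ⟨h1, h2, h3⟩ := ih (hσ.congr fun v => (ht.same v).1)
    have hlab : ∀ v, (τ v).lab = (σ v).lab := fun v => (ht.same v).2.1
    refine ⟨h1.head ht, fun v hv => ?_, fun v u hvu hl hu hv => ?_⟩
    · rw [h2 v (by rw [hlab]; omega), hn v (by omega)]
    · by_cases hun : (σ u).lab = n
      · rw [h2 v (by rw [hlab]; omega), hn v (by omega)] at hv
        exact h1.new_ne (hnew u v hvu.symm hun (by omega) hv)
      · exact h3 v u hvu (by rw [hlab, hlab, hl]) (by rw [hlab]; omega) hv

theorem takesStar_downSweep (n : ℕ) {σ : V → Device V M K} (hσ : Coloured G σ) :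
    TakesStar G σ (exec G (downSweep n k₀) σ) ∧
    ∀ v u, G.Adj v u → (σ v).lab = (σ u).lab + 1 → (σ u).lab < n →
      (exec G (downSweep n k₀) σ u).new ≠ none → (exec G (downSweep n k₀) σ v).new ≠ none := by
  induction n with
  | zero => exact ⟨.refl, fun _ _ _ _ h => absurd h (Nat.not_lt_zero _)⟩
  | succ n ih =>
    obtain ⟨h1, h2⟩ := ih
    have e : downSweep (n + 1) k₀ = downSweep n k₀ ++
        [(cast (· = n) (· = n + 1) k₀ : Round (Device V M K) K)] := by
      simp [downSweep, List.range_succ]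
    rw [e, exec_append, exec, exec]
    set τ := exec G (downSweep n k₀) σ with hτ
    have hlab : ∀ v, (τ v).lab = (σ v).lab := fun v => (h1.same v).2.1
    have hτc : Coloured G τ := hσ.congr fun v => (h1.same v).1
    have ht := takes_cast (k₀ := k₀) hτc (· = n) (· = n + 1)
    refine ⟨h1.tail ht, fun v u hvu hl hu hv => ?_⟩
    rw [next_cast_of_not hτc (by rw [hlab]; omega)] at hv
    by_cases hun : (σ u).lab = n
    · exact new_cast hτc hvu (by rw [hlab]; omega) (by rw [hlab]; omega) hv
    · have := h2 v u hvu hl (by omega) hv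
      rwa [ht.eq_of_new this]

/-- Every device is the root of its cluster or has a neighbour in its cluster that is closer to the
root. -/
def Clustered (G : SimpleGraph V) (σ : V → Device V M K) : Prop :=
  ∀ v, ((σ v).lab = 0 ∧ (σ v).rt = v) ∨
    ∃ u, G.Adj v u ∧ (σ v).lab = (σ u).lab + 1 ∧ (σ v).rt = (σ u).rt

/-- On the way to the root every smaller label occurs, and different labels need different vertices.
Hence sweeps of `Fintype.card V` rounds cover all labels. -/
theorem Clustered.lab_lt {σ : V → Device V M K} (h : Clustered G σ) (v : V) :
    (σ v).lab < Fintype.card V := by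
  have key : ∀ l v, (σ v).lab = l → ∀ i ≤ l, ∃ u, (σ u).lab = i := by
    intro l
    induction l with
    | zero => intro v hv i hi; exact ⟨v, by omega⟩
    | succ l ih =>
      intro v hv i hi
      rcases Nat.lt_or_ge l i with hil | hil
      · exact ⟨v, by omega⟩
      · rcases h v with h | ⟨u, -, h1, -⟩
        · omega
        · exact ih u (by omega) i hil
  have hsub : Finset.range ((σ v).lab + 1) ⊆ Finset.univ.image fun u => (σ u).lab := by
    intro i hi
    obtain ⟨u, hu⟩ := key _ v rfl i (by rw [Finset.mem_range] at hi; omega)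
    exact Finset.mem_image.2 ⟨u, Finset.mem_univ u, hu⟩
  have := (Finset.card_le_card hsub).trans Finset.card_image_le
  rw [Finset.card_range, Finset.card_univ] at this
  omega

omit [Fintype V] in
/-- Properties that pass to parents pass to the root. -/
theorem Clustered.root {σ : V → Device V M K} (h : Clustered G σ) {N : V → Prop}
    (hN : ∀ v u, G.Adj v u → (σ v).lab = (σ u).lab + 1 → N v → N u) {v : V} (hv : N v) :
    N (σ v).rt := by
  induction hl : (σ v).lab generalizing v with
  | zero =>
    rcases h v with ⟨-, h⟩ | ⟨u, -, h1, -⟩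
    · rwa [h]
    · omega
  | succ l ih =>
    rcases h v with h | ⟨u, h1, h2, h3⟩
    · omega
    · rw [h3]
      exact ih (hN v u h1 h2 hv) (by omega)

omit [Fintype V] in
/-- Properties that pass to children pass from the root to its cluster. -/
theorem Clustered.of_root {σ : V → Device V M K} (h : Clustered G σ) {N : V → Prop}
    (hN : ∀ v u, G.Adj v u → (σ v).lab = (σ u).lab + 1 → N u → N v) {v : V} (hv : N (σ v).rt) :
    N v := by
  induction hl : (σ v).lab generalizing v with
  | zero =>
    rcases h v with ⟨-, h⟩ | ⟨u, -, h1, -⟩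
    · rwa [h] at hv
    · omega
  | succ l ih =>
    rcases h v with h | ⟨u, h1, h2, h3⟩
    · omega
    · exact hN v u h1 h2 (ih (by rwa [← h3]) (by omega))

omit [Fintype V] in
theorem Clustered.rt_eq {σ : V → Device V M K} (h : Clustered G σ) {v : V}
    (hv : (σ v).lab = 0) : (σ v).rt = v := by
  rcases h v with ⟨-, h⟩ | ⟨u, -, h1, -⟩
  · exact h
  · omega

omit [Fintype V] in
theorem Clustered.lab_rt {σ : V → Device V M K} (h : Clustered G σ) (v : V) :
    (σ (σ v).rt).lab = 0 := by
  induction hl : (σ v).lab generalizing v with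
  | zero => rw [h.rt_eq hl, hl]
  | succ l ih =>
    rcases h v with h | ⟨u, -, h2, h3⟩
    · omega
    · rw [h3]
      exact ih u (by omega)

/-- The effect of a spread: new labels reach all neighbours, and from there the roots and then all
devices of a cluster. -/
theorem exec_spread {σ : V → Device V M K} (hσ : Coloured G σ) (hcl : Clustered G σ) :
    TakesStar G σ (exec G (spread (Fintype.card V) k₀) σ) ∧
    (∀ v u, (v = u ∨ G.Adj v u) → (σ u).new ≠ none →
      (exec G (spread (Fintype.card V) k₀) σ (σ v).rt).new ≠ none) ∧
    ∀ v u, G.Adj v u → (σ v).lab = (σ u).lab + 1 →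
      (exec G (spread (Fintype.card V) k₀) σ u).new ≠ none →
      (exec G (spread (Fintype.card V) k₀) σ v).new ≠ none := by
  change TakesStar G σ (exec G (cast (fun _ => True) (fun _ => True) k₀ ::
    (upSweep _ k₀ ++ downSweep _ k₀)) σ) ∧ (∀ v u, (v = u ∨ G.Adj v u) → (σ u).new ≠ none →
      (exec G (cast (fun _ => True) (fun _ => True) k₀ ::
    (upSweep _ k₀ ++ downSweep _ k₀)) σ (σ v).rt).new ≠ none) ∧
    ∀ v u, G.Adj v u → (σ v).lab = (σ u).lab + 1 →
      (exec G (cast (fun _ => True) (fun _ => True) k₀ ::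
    (upSweep _ k₀ ++ downSweep _ k₀)) σ u).new ≠ none →
      (exec G (cast (fun _ => True) (fun _ => True) k₀ ::
    (upSweep _ k₀ ++ downSweep _ k₀)) σ v).new ≠ none
  rw [exec, exec_append]
  have ht := takes_cast (k₀ := k₀) hσ (fun _ => True) (fun _ => True)
  have hnew : ∀ v u, (v = u ∨ G.Adj v u) → (σ u).new ≠ none →
      ((cast (fun _ => True) (fun _ => True) k₀).next G σ v).new ≠ none := by
    rintro v u (rfl | h) hu
    · rwa [ht.eq_of_new hu]
    · exact new_cast hσ h trivial trivial hu
  set τ := (cast (fun _ => True) (fun _ => True) k₀).next G σ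
  have hτ : Coloured G τ := hσ.congr fun v => (ht.same v).1
  have hτl : ∀ v, (τ v).lab = (σ v).lab := fun v => (ht.same v).2.1
  have hτr : ∀ v, (τ v).rt = (σ v).rt := fun v => (ht.same v).2.2
  obtain ⟨h1, -, h2⟩ := takesStar_upSweep (k₀ := k₀) (Fintype.card V) hτ
  set τ' := exec G (upSweep (Fintype.card V) k₀) τ
  have hτ' : Coloured G τ' := hτ.congr fun v => (h1.same v).1
  have hτl' : ∀ v, (τ' v).lab = (σ v).lab := fun v => (h1.same v).2.1.trans (hτl v)
  obtain ⟨h3, h4⟩ := takesStar_downSweep (k₀ := k₀) (Fintype.card V) hτ'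
  simp only [hτl] at h2
  simp only [hτl'] at h4
  refine ⟨(h1.head ht).trans h3, fun v u hvu hu => h3.new_ne ?_,
    fun v u hvu hl hu => h4 v u hvu hl (hcl.lab_lt u) hu⟩
  exact hcl.root (N := fun v => (τ' v).new ≠ none)
    (fun v u hvu hl hv => h2 v u hvu hl (hcl.lab_lt u) hv) (h1.new_ne (hnew v u hvu hu))

end Device

end Radio

/-! ### The broadcast algorithm: probability of success -/

namespace Explorer

variable {β : Type} [Fintype β]

theorem wordAvg_add (N : ℕ) (F G : List β → ℝ) :
    wordAvg β N (fun l => F l + G l) = wordAvg β N F + wordAvg β N G := by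
  induction N generalizing F G with
  | zero => rfl
  | succ N ih => simp only [wordAvg, ih, avg_add]

end Explorer

namespace Radio

namespace Device

open Round Explorer

variable {M V : Type} {K : ℕ} [Fintype V] {G : SimpleGraph V} {k₀ : Fin K} {s : V} {m : M}

/-- The source holds the message, and nobody holds a wrong message. -/
def Holds (s : V) (m : M) (σ : V → Device V M K) : Prop :=
  (σ s).msg = some m ∧ ∀ v, (σ v).msg = none ∨ (σ v).msg = some m

omit [Fintype V] in
theorem TakesStar.holds {σ τ : V → Device V M K} (h : TakesStar G σ τ) (hσ : Holds s m σ) :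
    Holds s m τ := by
  induction h with
  | refl => exact hσ
  | @tail τ τ' _ h ih =>
    constructor
    · rcases h s with h | ⟨-, u, -, -, h⟩
      · rw [h, ih.1]
      · rw [h, takeFrom, ih.1]
        rfl
    · intro v
      rcases h v with h | ⟨-, u, -, -, h⟩
      · rw [h]
        exact ih.2 v
      · rw [h, takeFrom]
        rcases ih.2 v with h1 | h1 <;> rcases ih.2 u with h2 | h2 <;> simp [h1, h2]

omit [Fintype V] in
theorem TakesStar.msg_ne_none {σ τ : V → Device V M K} (h : TakesStar G σ τ)
    (hσ : ∀ v, (σ v).new ≠ none → (σ v).msg ≠ none) (v : V) (hv : (τ v).new ≠ none) :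
    (τ v).msg ≠ none := by
  induction h generalizing v with
  | refl => exact hσ v hv
  | @tail τ τ' _ h ih =>
    rcases h v with h | ⟨-, u, -, hn, h⟩
    · rw [h] at hv ⊢
      exact ih v hv
    · rw [h, takeFrom]
      have := ih u hn
      simp [this]

open Classical in
/-- The roots of the clusters. -/
noncomputable def roots (σ : V → Device V M K) : Finset V :=
  Finset.univ.filter fun v => (σ v).lab = 0

/-- The state while clusters are merged. -/
def Merging (G : SimpleGraph V) (s : V) (m : M) (σ : V → Device V M K) : Prop :=
  Coloured G σ ∧ Clustered G σ ∧ Holds s m σ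

/-- The cluster structure survives in three cases. A device without a new label has a parent without
one, by the downward sweep. A device with coin true has a parent in the same cluster, which keeps
its label too. A device that has taken a label has its supplier as parent. A root with coin false
next to a cluster with coin true receives a positive label and is no longer a root. -/
theorem exec_merge {σ : V → Device V M K} (h : Merging G s m σ) (coin : V → Bool) :
    Merging G s m (exec G (merge (Fintype.card V) k₀ coin) σ) ∧
    roots (exec G (merge (Fintype.card V) k₀ coin) σ) ⊆ roots σ ∧
    ∀ v u, G.Adj v u → coin (σ v).rt = false → coin (σ u).rt = true →
      (σ v).rt ∉ roots (exec G (merge (Fintype.card V) k₀ coin) σ) := by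
  obtain ⟨hcol, hcl, hm⟩ := h
  have hρ : ∀ v, (start coin k₀).next G σ v =
      { σ v with new := if coin (σ v).rt then some ((σ v).lab, (σ v).rt) else none } :=
    fun v => rfl
  rw [merge, exec, exec_append, exec, exec]
  set ρ := (start coin k₀).next G σ with hρdef
  have hρcl : Clustered G ρ := hcl
  have hρnew : ∀ v, (ρ v).new = if coin (σ v).rt then some ((σ v).lab, (σ v).rt) else none :=
    fun v => rfl
  have hρl : ∀ v, (ρ v).lab = (σ v).lab := fun v => rfl
  have hρr : ∀ v, (ρ v).rt = (σ v).rt := fun v => rfl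
  have hρm : Holds s m ρ := hm
  have hρc : Coloured G ρ := hcol
  obtain ⟨h1, h2, h3⟩ := exec_spread (k₀ := k₀) hρc hρcl
  clear_value ρ
  set σ₁ := exec G (spread (Fintype.card V) k₀) ρ with hσ₁
  have hl : ∀ v, (σ₁ v).lab = (σ v).lab := fun v => (h1.same v).2.1.trans (hρl v)
  have hr : ∀ v, (σ₁ v).rt = (σ v).rt := fun v => (h1.same v).2.2.trans (hρr v)
  have hτnone : ∀ v, (σ₁ v).new = none → ((finish k₀).next G σ₁ v).lab = (σ v).lab ∧
      ((finish k₀).next G σ₁ v).rt = (σ v).rt := by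
    intro v hv
    rw [← hl, ← hr]
    simp only [next, finish, hv, Option.getD_none, and_self]
  have hτsome : ∀ v p, (σ₁ v).new = some p → ((finish k₀).next G σ₁ v).lab = p.1 ∧
      ((finish k₀).next G σ₁ v).rt = p.2 := by
    intro v p hv
    simp only [next, finish, hv, Option.getD_some, and_self]
  have hτc : Coloured G ((finish k₀).next G σ₁) :=
    (hρc.congr fun v => (h1.same v).1 : Coloured G σ₁)
  have hτm : Holds s m ((finish k₀).next G σ₁) := h1.holds hρm
  set τ := (finish k₀).next G σ₁ with hτ
  clear_value τ
  have hseed : ∀ v p, (ρ v).new = some p → coin (σ v).rt = true ∧ p = ((σ v).lab, (σ v).rt) := by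
    intro v p hp
    rw [hρnew] at hp
    split_ifs at hp with hc
    exact ⟨hc, (Option.some.inj hp).symm⟩
  have hkeep : ∀ v, coin (σ v).rt = true → (σ₁ v).new = some ((σ v).lab, (σ v).rt) := by
    intro v hv
    have : (ρ v).new = some ((σ v).lab, (σ v).rt) := by rw [hρnew, if_pos hv]
    rw [h1.eq_of_new (by simp [this]), this]
  -- A label taken from a neighbour is a successor, so no roots arise and a surviving root has taken
  -- nothing.
  have hroot : ∀ v, (τ v).lab = 0 → (σ v).lab = 0 ∧ ((σ₁ v).new ≠ none → coin (σ v).rt = true) := by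
    intro v hv
    rcases hn : (σ₁ v).new with _ | p
    · rw [(hτnone v hn).1] at hv
      exact ⟨hv, fun h => (h rfl).elim⟩
    · rw [(hτsome v p hn).1] at hv
      rcases h1.origin hn with ho | ⟨u, l, -, hp, -⟩
      · obtain ⟨hc, rfl⟩ := hseed v p ho
        exact ⟨hv, fun _ => hc⟩
      · omega
  refine ⟨⟨hτc, ?_, hτm⟩, ?_, ?_⟩
  · intro v
    rcases hn : (σ₁ v).new with _ | p
    · obtain ⟨e1, e2⟩ := hτnone v hn
      rw [e1, e2]
      refine (hcl v).imp_right ?_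
      rintro ⟨u, hu, hvl, hvr⟩
      have hun : (σ₁ u).new = none := by
        by_contra hcon
        exact h3 v u hu (by rw [hρl, hρl, hvl]) hcon hn
      obtain ⟨e3, e4⟩ := hτnone u hun
      exact ⟨u, hu, by rw [hvl, e3], by rw [hvr, e4]⟩
    · obtain ⟨e1, e2⟩ := hτsome v p hn
      rw [e1, e2]
      rcases h1.origin hn with ho | ⟨u, l, hu, hp, hul⟩
      · obtain ⟨hc, rfl⟩ := hseed v p ho
        refine (hcl v).imp_right ?_
        rintro ⟨u, hu, hvl, hvr⟩
        obtain ⟨e3, e4⟩ := hτsome u _ (hkeep u (hvr ▸ hc))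
        exact ⟨u, hu, by rw [hvl, e3], by rw [hvr, e4]⟩
      · right
        obtain ⟨e3, e4⟩ := hτsome u _ hul
        exact ⟨u, hu, by rw [hp, e3], by rw [e4]⟩
  · intro v hv
    simp only [roots, Finset.mem_filter, Finset.mem_univ, true_and] at hv ⊢
    exact (hroot v hv).1
  · intro v u hvu hv hu hmem
    simp only [roots, Finset.mem_filter, Finset.mem_univ, true_and] at hmem
    have h4 := h2 v u (Or.inr hvu) (by rw [hρnew, if_pos hu]; simp)
    rw [hρr] at h4
    have h5 := (hroot _ hmem).2 h4
    rw [hcl.rt_eq (hcl.lab_rt v), hv] at h5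
    cases h5

/-- The number of clusters, if there are at least two. -/
noncomputable def excess (σ : V → Device V M K) : ℝ :=
  if 2 ≤ (roots σ).card then (roots σ).card else 0

theorem excess_nonneg (σ : V → Device V M K) : 0 ≤ excess σ := by
  unfold excess
  positivity

open Classical in
-- Fix for every root `r` an adjacent cluster with root `q r`. With probability at least 1/4 the
-- coins are false at `r` and true at `q r`, and then `r` disappears. A single cluster cannot
-- shrink, which is why `excess` vanishes there.
theorem avg_excess_le (hG : G.Connected) {σ : V → Device V M K} (h : Merging G s m σ) :
    (avg fun coin : V → Bool => excess (exec G (merge (Fintype.card V) k₀ coin) σ)) ≤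
      3 / 4 * excess σ := by
  have hsub := fun coin => (exec_merge (k₀ := k₀) h coin).2.1
  have hkill := fun coin => (exec_merge (k₀ := k₀) h coin).2.2
  obtain ⟨-, hcl, -⟩ := h
  by_cases h2 : 2 ≤ (roots σ).card
  · have hrt : ∀ r ∈ roots σ, (σ r).rt = r := by
      intro r hr
      simp only [roots, Finset.mem_filter, Finset.mem_univ, true_and] at hr
      exact hcl.rt_eq hr
    have hedge : ∀ r : V, ∃ q : V, r ∈ roots σ → q ≠ r ∧
        ∃ v u, G.Adj v u ∧ (σ v).rt = r ∧ (σ u).rt = q := by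
      intro r
      by_cases hr : r ∈ roots σ
      · obtain ⟨r', hr', hne⟩ := Finset.exists_mem_ne (show 1 < (roots σ).card by omega) r
        obtain ⟨p⟩ := hG.preconnected r r'
        -- A walk from `r` to another root has an edge that leaves the cluster of `r`.
        obtain ⟨d, -, hd1, hd2⟩ := p.exists_boundary_dart {v | (σ v).rt = r} (hrt r hr)
          (by rw [Set.mem_ofPred_eq, hrt r' hr']; exact hne)
        exact ⟨_, fun _ => ⟨hd2, d.fst, d.snd, d.adj, hd1, rfl⟩⟩
      · exact ⟨r, fun h => (hr h).elim⟩
    choose q hq using hedge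
    have hle : ∀ coin : V → Bool, excess (exec G (merge (Fintype.card V) k₀ coin) σ) ≤
        ∑ r ∈ roots σ, (1 + (-1) * if coin r = false ∧ coin (q r) = true then (1 : ℝ) else 0) := by
      intro coin
      have h1 : excess (exec G (merge (Fintype.card V) k₀ coin) σ) ≤
          (roots (exec G (merge (Fintype.card V) k₀ coin) σ)).card := by
        unfold excess
        split_ifs
        · exact le_rfl
        · exact Nat.cast_nonneg _
      refine h1.trans ?_
      have h3 : roots (exec G (merge (Fintype.card V) k₀ coin) σ) ⊆
          (roots σ).filter fun r => ¬ (coin r = false ∧ coin (q r) = true) := by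
        intro r hr
        refine Finset.mem_filter.2 ⟨hsub coin hr, fun hc => ?_⟩
        obtain ⟨-, v, u, hvu, hv, hu⟩ := hq r (hsub coin hr)
        refine hkill coin v u hvu (by rw [hv]; exact hc.1) (by rw [hu]; exact hc.2) ?_
        rw [hv]
        exact hr
      refine (Nat.cast_le.2 (Finset.card_le_card h3)).trans (le_of_eq ?_)
      rw [Finset.card_filter, Nat.cast_sum]
      refine Finset.sum_congr rfl fun r _ => ?_
      by_cases hc : coin r = false ∧ coin (q r) = true <;> simp [hc]
    refine (avg_mono hle).trans ?_
    rw [avg_sum]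
    refine (Finset.sum_le_card_nsmul _ _ (3 / 4) fun r hr => ?_).trans ?_
    · have := avg_coin_le (hq r hr).1.symm
      rw [avg_add, avg_const, avg_mul_left]
      linarith
    · rw [nsmul_eq_mul, mul_comm, excess, if_pos h2]
  · have hle : ∀ coin : V → Bool, excess (exec G (merge (Fintype.card V) k₀ coin) σ) ≤ 0 := by
      intro coin
      have := Finset.card_le_card (hsub coin)
      rw [excess, if_neg (by omega)]
    refine (avg_mono hle).trans ?_
    rw [avg_const, excess, if_neg h2, mul_zero]

/-- New labels serve as markers of the informed devices. The mark of the source reaches the common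
root and then everybody, and the message travels with the marks. -/
theorem exec_startMsg_spread {σ : V → Device V M K} (h : Merging G s m σ)
    (hr : (roots σ).card ≤ 1) (v : V) :
    (exec G (startMsg k₀ :: spread (Fintype.card V) k₀) σ v).msg = some m := by
  classical
  obtain ⟨hcol, hcl, hm⟩ := h
  rw [exec]
  have hρcl : Clustered G ((startMsg k₀).next G σ) := hcl
  have hρm : Holds s m ((startMsg k₀).next G σ) := hm
  have hρnew : ∀ v, ((startMsg k₀).next G σ v).new ≠ none ↔
      ((startMsg k₀).next G σ v).msg ≠ none := by
    intro v
    simp only [next, startMsg]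
    rcases (σ v).msg with _ | x <;> simp
  have hρr : ((roots ((startMsg k₀).next G σ)).card) ≤ 1 := hr
  have hρc : Coloured G ((startMsg k₀).next G σ) := hcol
  set ρ := (startMsg k₀).next G σ
  obtain ⟨h1, h2, h3⟩ := exec_spread (k₀ := k₀) hρc hρcl
  have h4 := h2 s s (Or.inl rfl) ((hρnew s).2 (by rw [hρm.1]; simp))
  have h5 : (ρ v).rt = (ρ s).rt := Finset.card_le_one.1 hρr _
    (by simp [roots, hρcl.lab_rt]) _ (by simp [roots, hρcl.lab_rt])
  have h6 : (exec G (spread (Fintype.card V) k₀) ρ v).new ≠ none :=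
    hρcl.of_root (N := fun v => (exec G (spread (Fintype.card V) k₀) ρ v).new ≠ none)
      (fun v u hvu hl hu => h3 v u hvu hl hu) (by rw [h5]; exact h4)
  have h7 := h1.msg_ne_none (fun v => (hρnew v).1) v h6
  exact ((h1.holds hρm).2 v).resolve_left h7

/-- The devices at the beginning, if every device uses its own name as its identifier. -/
noncomputable def begin (f : V → Option M) (v : V) : Device V M K := initially v (f v)

open Classical in
/-- The inputs. -/
noncomputable def input (s : V) (m : M) (v : V) : Option M := if v = s then some m else none

open Classical in
/-- The indicator of failure of the algorithm. -/
noncomputable def failure (G : SimpleGraph V) (k₀ : Fin K) (s : V) (m : M)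
    (x y : List (V → Fin K)) (z : List (V → Bool)) : ℝ :=
  if ∀ v, (exec G (program (Fintype.card V) k₀ x y z) (begin (input s m)) v).msg = some m then 0
  else 1

theorem failure_le_one (x y : List (V → Fin K)) (z : List (V → Bool)) :
    failure G k₀ s m x y z ≤ 1 := by
  unfold failure
  split_ifs <;> norm_num

theorem failure_eq_zero {x y : List (V → Fin K)} {z : List (V → Bool)}
    (h : Merging G s m (exec G (z.flatMap (merge (Fintype.card V) k₀))
      (exec G (y.flatMap attempt) (exec G (x.map announce) (begin (input s m))))))
    (hr : (roots (exec G (z.flatMap (merge (Fintype.card V) k₀))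
      (exec G (y.flatMap attempt) (exec G (x.map announce) (begin (input s m)))))).card ≤ 1) :
    failure G k₀ s m x y z = 0 := by
  refine if_pos fun v => ?_
  unfold program
  rw [exec_append, exec_append, exec_append]
  exact exec_startMsg_spread h hr v

theorem foldl_induction {α X : Type} {Inv : X → Prop} {step : X → α → X}
    (h : ∀ x a, Inv x → Inv (step x a)) (l : List α) {x : X} (hx : Inv x) :
    Inv (l.foldl step x) := by
  induction l generalizing x with
  | nil => exact hx
  | cons a l ih => exact ih (h _ _ hx)

theorem Colouring.merging {σ : V → Device V M K} (h : Colouring G (input s m) σ)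
    (h0 : uncoloured σ = ∅) : Merging G s m σ := by
  classical
  have hfx : ∀ v, (σ v).fixed ≠ none := by
    intro v hv
    have : v ∈ uncoloured σ := by simp [uncoloured, hv]
    rw [h0] at this
    simp at this
  refine ⟨⟨hfx, fun a b hab => h.2.2 a b hab (hfx a)⟩, fun v => Or.inl ⟨(h.1 v).2.1, (h.1 v).2.2.1⟩,
    ?_, fun v => ?_⟩
  · rw [(h.1 s).2.2.2, input, if_pos rfl]
  · rw [(h.1 v).2.2.2, input]
    split_ifs
    · exact Or.inr rfl
    · exact Or.inl rfl

theorem Learning.colouring {f : V → Option M} {σ : V → Device V M K} (h : Learning G f σ)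
    (h0 : unknown G σ = ∅) : Colouring G f σ := by
  classical
  refine ⟨h.1, fun v => (h.2.1 v).antisymm fun u hu => ?_, fun a b _ ha => (ha (h.2.2 a)).elim⟩
  by_contra hcon
  have : (v, u) ∈ unknown G σ := by
    simp only [unknown, Finset.mem_filter, Finset.mem_univ, true_and]
    exact ⟨hu, hcon⟩
  rw [h0] at this
  simp at this

open Classical in
-- A phase that does not finish leaves at least one unknown pair, one uncoloured device or a
-- positive excess. So its probability of failure is at most the expected remainder, which decays
-- geometrically from at most `n²`, `n` and `n`.
theorem wordAvg_failure_le {Δ : ℕ} (hG : G.Connected) (hΔ : ∀ v, (G.neighborSet v).ncard ≤ Δ)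
    (hK : 4 * (Δ + 1) ^ 2 ≤ K) (L : ℕ) :
    (wordAvg (V → Fin K) L fun x => wordAvg (V → Fin K) L fun y => wordAvg (V → Bool) L fun z =>
      failure G k₀ s m x y z) ≤
    (1 / 2) ^ L * (Fintype.card V) ^ 2 +
      ((1 / 2) ^ L * Fintype.card V + (3 / 4) ^ L * Fintype.card V) := by
  have : Nonempty (V → Fin K) := ⟨fun _ => k₀⟩
  set n := Fintype.card V with hn
  have hcard : ∀ t : Finset V, (t.card : ℝ) ≤ n := fun t => by
    rw [hn]
    exact_mod_cast Finset.card_le_univ t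
  have h34 : (0 : ℝ) ≤ (3 / 4) ^ L * n := by positivity
  have h12 : (0 : ℝ) ≤ (1 / 2) ^ L * n := by positivity
  have hz : ∀ x y, Colouring G (input s m)
      (exec G (y.flatMap attempt) (exec G (x.map announce) (begin (input s m)))) →
      (wordAvg (V → Bool) L fun z => failure G k₀ s m x y z) ≤
      ((uncoloured (exec G (y.flatMap attempt)
        (exec G (x.map announce) (begin (input s m))))).card : ℝ) + (3 / 4) ^ L * n := by
    intro x y hσ
    rcases Finset.eq_empty_or_nonempty (uncoloured (exec G (y.flatMap attempt)
        (exec G (x.map announce) (begin (input s m))))) with h0 | h0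
    · rw [h0, Finset.card_empty, Nat.cast_zero, zero_add]
      have hmer := hσ.merging h0
      set σ := exec G (y.flatMap attempt) (exec G (x.map announce) (begin (input s m))) with hσdef
      have hfold := wordAvg_foldl_le
        (fun σ coin => exec G (merge (Fintype.card V) k₀ coin) σ) (Merging G s m) excess
        (by norm_num : (0 : ℝ) ≤ 3 / 4) (fun σ c h => (exec_merge h c).1)
        (fun σ h => avg_excess_le hG h) L σ hmer
      refine le_trans (wordAvg_mono fun z _ => ?_) (hfold.trans ?_)
      · have hinv : Merging G s m
            (z.foldl (fun σ coin => exec G (merge (Fintype.card V) k₀ coin) σ) σ) :=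
          foldl_induction (Inv := Merging G s m) (fun σ c h => (exec_merge h c).1) z hmer
        by_cases hr : (roots
            (z.foldl (fun σ coin => exec G (merge (Fintype.card V) k₀ coin) σ) σ)).card ≤ 1
        · rw [failure_eq_zero (by rw [exec_flatMap]; exact hinv) (by rw [exec_flatMap]; exact hr)]
          exact excess_nonneg _
        · refine (failure_le_one _ _ _).trans ?_
          rw [excess, if_pos (by omega)]
          exact_mod_cast (by omega : 1 ≤ (roots
            (z.foldl (fun σ coin => exec G (merge (Fintype.card V) k₀ coin) σ) σ)).card)
      · refine mul_le_mul_of_nonneg_left ?_ (by positivity)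
        unfold excess
        split_ifs
        · exact hcard _
        · positivity
    · have h1 : (1 : ℝ) ≤ (uncoloured (exec G (y.flatMap attempt)
        (exec G (x.map announce) (begin (input s m))))).card := by
        exact_mod_cast h0.card_pos
      refine ((wordAvg_mono fun z _ => failure_le_one _ _ _).trans (wordAvg_const L 1).le).trans ?_
      linarith
  have hy : ∀ x, Learning G (input s m) (exec G (x.map announce) (begin (input s m))) →
      (wordAvg (V → Fin K) L fun y => wordAvg (V → Bool) L fun z => failure G k₀ s m x y z) ≤
      ((unknown G (exec G (x.map announce) (begin (input s m)))).card : ℝ) +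
        ((1 / 2) ^ L * n + (3 / 4) ^ L * n) := by
    intro x hσ
    rcases Finset.eq_empty_or_nonempty
        (unknown G (exec G (x.map announce) (begin (input s m)))) with h0 | h0
    · rw [h0, Finset.card_empty, Nat.cast_zero, zero_add]
      have hcol := hσ.colouring h0
      have hinv : ∀ y : List (V → Fin K), Colouring G (input s m)
          (exec G (y.flatMap attempt) (exec G (x.map announce) (begin (input s m)))) := by
        intro y
        rw [exec_flatMap]
        exact foldl_induction (fun σ c h => h.attempt c) y hcol
      refine (wordAvg_mono fun y _ => hz x y (hinv y)).trans ?_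
      rw [wordAvg_add, wordAvg_const]
      refine add_le_add ?_ le_rfl
      have hfold := wordAvg_foldl_le (fun σ c => exec G (attempt c) σ)
        (Colouring G (input s m)) (fun σ => ((uncoloured σ).card : ℝ))
        (by norm_num : (0 : ℝ) ≤ 1 / 2) (fun σ c h => h.attempt c)
        (fun σ h => avg_uncoloured_le hΔ hK h) L _ hcol
      simp only [exec_flatMap]
      exact hfold.trans (mul_le_mul_of_nonneg_left (hcard _) (by positivity))
    · have h1 : (1 : ℝ) ≤ (unknown G (exec G (x.map announce) (begin (input s m)))).card := by
        exact_mod_cast h0.card_pos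
      refine ((wordAvg_mono fun y _ => (wordAvg_mono fun z _ => failure_le_one _ _ _).trans
        (wordAvg_const L 1).le).trans (wordAvg_const L 1).le).trans ?_
      linarith
  have hbegin : Learning G (input s m) (begin (input s m) : V → Device V M K) :=
    ⟨fun v => ⟨rfl, rfl, rfl, rfl⟩, fun v => Set.empty_subset _, fun v => rfl⟩
  have hfl : ∀ (x : List (V → Fin K)), exec G (x.map announce) (begin (input s m)) =
      x.foldl (fun σ c => (announce c).next G σ) (begin (input s m)) := by
    intro x
    have : x.map announce = x.flatMap fun c => [(announce c : Round (Device V M K) K)] :=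
      List.map_eq_flatMap
    rw [this, exec_flatMap]
    rfl
  have hinv : ∀ x : List (V → Fin K),
      Learning G (input s m) (exec G (x.map announce) (begin (input s m))) := by
    intro x
    rw [hfl]
    exact foldl_induction (fun σ c h => h.announce c) x hbegin
  refine (wordAvg_mono fun x _ => hy x (hinv x)).trans ?_
  rw [wordAvg_add, wordAvg_const]
  refine add_le_add ?_ le_rfl
  have hfold := wordAvg_foldl_le (fun σ c => (announce c).next G σ)
    (Learning G (input s m)) (fun σ => ((unknown G σ).card : ℝ))
    (by norm_num : (0 : ℝ) ≤ 1 / 2) (fun σ c h => h.announce c)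
    (fun σ h => avg_unknown_le hΔ (by nlinarith) h) L _ hbegin
  simp only [hfl]
  refine hfold.trans (mul_le_mul_of_nonneg_left ?_ (by positivity))
  have := Finset.card_le_univ (unknown G (begin (input s m) : V → Device V M K))
  rw [Fintype.card_prod, ← hn, ← sq] at this
  exact_mod_cast this

end Device

end Radio

/-! ### The broadcast algorithm: the protocol -/

namespace Radio

namespace Device

open Round Explorer

variable {M V : Type} {K L : ℕ} [Fintype V] {G : SimpleGraph V}

/-- The random string of a device, which is also its identifier. -/
abbrev Rand (K L : ℕ) : Type := (Fin L → Fin K) × (Fin L → Fin K) × (Fin L → Bool)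

/-- The rounds of the algorithm when devices are identified by their random strings. -/
noncomputable def rounds (n L : ℕ) (k₀ : Fin K) : List (Round (Device (Rand K L) M K) K) :=
  program n k₀ (List.ofFn fun i ρ => ρ.1 i) (List.ofFn fun i ρ => ρ.2.1 i)
    (List.ofFn fun i ρ => ρ.2.2 i)

/-- The broadcast protocol; `E` reads off the random string from the random bits. -/
noncomputable def broadcast (M : Type) (n : ℕ) (k₀ : Fin K) {bits : ℕ}
    (E : (Fin bits → Bool) ≃ Rand K L) : Protocol .noCD M :=
  toProtocol (rounds n L k₀) bits (fun o b => initially (E b) o) msg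

theorem time_broadcast (n : ℕ) (k₀ : Fin K) {bits : ℕ} (E : (Fin bits → Bool) ≃ Rand K L) :
    (broadcast M n k₀ E).time = K * (L + L * 2 + L * (2 * n + 3) + (2 * n + 2)) := by
  change K * (rounds n L k₀).length = _
  rw [rounds, length_program, List.length_ofFn, List.length_ofFn, List.length_ofFn]

theorem energy_broadcast_le (n : ℕ) (k₀ : Fin K) {bits : ℕ} (E : (Fin bits → Bool) ≃ Rand K L)
    (s : V) (m : M) (ω : V → Fin bits → Bool) (v : V) :
    (broadcast M n k₀ E).energy G s m ω v ≤ K * (L + L * 2 + L * 5 + 5) := by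
  refine (energy_toProtocol_le _ _ _ _ (Fin.pos k₀) G s m ω v).trans
    (Nat.mul_le_mul_left K ((awakeCount_program_le G v n k₀ _ _ _ _).trans (le_of_eq ?_)))
  rw [List.length_ofFn, List.length_ofFn, List.length_ofFn]

/-- With distinct strings the real run is the renamed image of the run with vertex names, and
renaming leaves the stored message alone. -/
theorem succeeds_broadcast (k₀ : Fin K) {bits : ℕ} (E : (Fin bits → Bool) ≃ Rand K L)
    (s : V) (m : M) (ω : V → Fin bits → Bool) (hinj : Function.Injective fun v => E (ω v))
    (h : failure G k₀ s m (List.ofFn fun i v => (E (ω v)).1 i)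
      (List.ofFn fun i v => (E (ω v)).2.1 i) (List.ofFn fun i v => (E (ω v)).2.2 i) = 0) :
    (broadcast M (Fintype.card V) k₀ E).Succeeds G s m ω := by
  unfold broadcast
  rw [succeeds_toProtocol _ _ _ _ (Fin.pos k₀)]
  intro v
  have hinit : initial bits (fun o b => initially (E b) o) s m ω =
      fun v => map (fun v => E (ω v)) (begin (input s m) v : Device V M K) := by
    funext v
    rw [begin, map_initially]
    rfl
  have hsim := simulates_program (M := M) hinj (Fintype.card V) k₀
    (List.ofFn fun i ρ => ρ.1 i) (List.ofFn fun i ρ => ρ.2.1 i) (List.ofFn fun i ρ => ρ.2.2 i)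
  rw [hinit, rounds, exec_simulates hsim]
  simp only [List.map_ofFn]
  unfold failure at h
  split_ifs at h with hf
  · exact hf v
  · norm_num at h

/-- Two of finitely many independent random strings hardly ever agree. -/
theorem avg_not_injective_le {β : Type} [Fintype β] [DecidableEq V]
    [DecidablePred fun e : V → β => Function.Injective e] :
    (avg fun e : V → β => if Function.Injective e then (0 : ℝ) else 1) ≤
      (Fintype.card V) ^ 2 * (1 / Fintype.card β) := by
  classical
  have h1 : ∀ e : V → β, (if Function.Injective e then (0 : ℝ) else 1) ≤
      ∑ p ∈ Finset.univ.filter (fun p : V × V => p.1 ≠ p.2),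
        if e p.1 = e p.2 then (1 : ℝ) else 0 := by
    intro e
    split_ifs with he
    · exact Finset.sum_nonneg fun p _ => by positivity
    · unfold Function.Injective at he
      push Not at he
      obtain ⟨a, b, hab, hne⟩ := he
      refine le_trans (by rw [if_pos hab]) (Finset.single_le_sum
        (f := fun p : V × V => if e p.1 = e p.2 then (1 : ℝ) else 0) (fun p _ => by positivity)
        (Finset.mem_filter.2 ⟨Finset.mem_univ (a, b), hne⟩))
  refine (avg_mono h1).trans ?_
  rw [avg_sum]
  refine (Finset.sum_le_card_nsmul _ _ (1 / (Fintype.card β : ℝ)) fun p hp => ?_).trans ?_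
  · simp only [Finset.mem_filter, Finset.mem_univ, true_and] at hp
    exact avg_eq_le p.1 (fun e => e p.2) fun e x => Function.update_of_ne hp.symm _ _
  · rw [nsmul_eq_mul]
    refine mul_le_mul_of_nonneg_right ?_ (by positivity)
    have := Finset.card_le_univ (Finset.univ.filter fun p : V × V => p.1 ≠ p.2)
    rw [Fintype.card_prod, ← sq] at this
    exact_mod_cast this

/-- Random strings for all devices, one letter after the other. -/
def randEquiv (V : Type) (K L : ℕ) :
    (V → Rand K L) ≃ (Fin L → V → Fin K) × (Fin L → V → Fin K) × (Fin L → V → Bool) :=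
  (Equiv.arrowProdEquivProdArrow _ _ _).trans
    ((Equiv.piComm _).prodCongr ((Equiv.arrowProdEquivProdArrow _ _ _).trans
      ((Equiv.piComm _).prodCongr (Equiv.piComm _))))

theorem two_pow_le_card_rand (hK : 0 < K) : 2 ^ L ≤ Fintype.card (Rand K L) := by
  simp only [Rand, Fintype.card_prod, Fintype.card_fun, Fintype.card_fin, Fintype.card_bool]
  have : 0 < K ^ L := Nat.pow_pos hK
  rw [← mul_assoc]
  exact Nat.le_mul_of_pos_left _ (Nat.mul_pos this this)

/-- The factor 4 counts the sources of error: coinciding strings, unknown neighbours, missing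
colours and surplus clusters. Each is at most `n² (3/4)^L`. -/
theorem le_prob_broadcast {Δ : ℕ} (hG : G.Connected) (hΔ : ∀ v, (G.neighborSet v).ncard ≤ Δ)
    (k₀ : Fin K) (hK : 4 * (Δ + 1) ^ 2 ≤ K) {bits : ℕ} (E : (Fin bits → Bool) ≃ Rand K L)
    (s : V) (m : M) :
    1 - 4 * (Fintype.card V) ^ 2 * (3 / 4) ^ L ≤ (broadcast M (Fintype.card V) k₀ E).prob
      (fun ω => (broadcast M (Fintype.card V) k₀ E).Succeeds G s m ω) := by
  classical
  set n := Fintype.card V with hn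
  have hn1 : (1 : ℝ) ≤ n := by
    exact_mod_cast Fintype.card_pos_iff.2 ⟨s⟩
  have : Nonempty (V → Fin bits → Bool) := ⟨fun _ _ => false⟩
  have hK0 : 0 < K := Fin.pos k₀
  rw [Protocol.prob_eq_avg]
  change _ ≤ avg fun ω : V → Fin bits → Bool => _
  let bad : (V → Rand K L) → ℝ := fun e => (if Function.Injective e then (0 : ℝ) else 1) +
    failure G k₀ s m (List.ofFn fun i v => (e v).1 i) (List.ofFn fun i v => (e v).2.1 i)
      (List.ofFn fun i v => (e v).2.2 i)
  have hle : ∀ ω : V → Fin bits → Bool, (1 : ℝ) ≤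
      (if (broadcast M n k₀ E).Succeeds G s m ω then (1 : ℝ) else 0) + bad (fun v => E (ω v)) := by
    intro ω
    have hf0 : 0 ≤ failure G k₀ s m (List.ofFn fun i v => (E (ω v)).1 i)
        (List.ofFn fun i v => (E (ω v)).2.1 i) (List.ofFn fun i v => (E (ω v)).2.2 i) := by
      unfold failure
      positivity
    by_cases hs : (broadcast M n k₀ E).Succeeds G s m ω
    · rw [if_pos hs]
      simp only [bad]
      have : (0 : ℝ) ≤ if Function.Injective fun v => E (ω v) then (0 : ℝ) else 1 := by
        positivity
      linarith
    · rw [if_neg hs]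
      simp only [bad]
      by_cases hinj : Function.Injective fun v => E (ω v)
      · rw [if_pos hinj]
        have hne : failure G k₀ s m (List.ofFn fun i v => (E (ω v)).1 i)
            (List.ofFn fun i v => (E (ω v)).2.1 i) (List.ofFn fun i v => (E (ω v)).2.2 i) ≠ 0 :=
          fun h0 => hs (succeeds_broadcast k₀ E s m ω hinj h0)
        unfold failure at hne ⊢
        split_ifs at hne ⊢ with hf
        · exact (hne rfl).elim
        · norm_num
      · rw [if_neg hinj]
        linarith
  have h1 : (1 : ℝ) ≤ (avg fun ω : V → Fin bits → Bool =>
      if (broadcast M n k₀ E).Succeeds G s m ω then (1 : ℝ) else 0) +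
      avg fun ω : V → Fin bits → Bool => bad (fun v => E (ω v)) := by
    rw [← avg_add]
    exact (avg_const (β := V → Fin bits → Bool) 1).ge.trans (avg_mono hle)
  have h2 : (avg fun ω : V → Fin bits → Bool => bad (fun v => E (ω v))) = avg bad :=
    avg_equiv (Equiv.piCongrRight fun _ : V => E) bad
  have h3 : (avg fun e : V → Rand K L => failure G k₀ s m (List.ofFn fun i v => (e v).1 i)
      (List.ofFn fun i v => (e v).2.1 i) (List.ofFn fun i v => (e v).2.2 i)) =
      wordAvg (V → Fin K) L fun x => wordAvg (V → Fin K) L fun y => wordAvg (V → Bool) L fun z =>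
        failure G k₀ s m x y z := by
    have := avg_equiv (randEquiv V K L) fun p =>
      failure G k₀ s m (List.ofFn p.1) (List.ofFn p.2.1) (List.ofFn p.2.2)
    refine this.trans ?_
    rw [avg_prod]
    simp only [avg_prod]
    rw [← avg_ofFn]
    congr 1
    funext x
    rw [← avg_ofFn]
    congr 1
    funext y
    rw [← avg_ofFn]
  have h4 := wordAvg_failure_le (k₀ := k₀) (s := s) (m := m) hG hΔ hK L
  have h5 := avg_not_injective_le (V := V) (β := Rand K L)
  have h6 : avg bad ≤ n ^ 2 * (1 / Fintype.card (Rand K L)) +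
      ((1 / 2) ^ L * n ^ 2 + ((1 / 2) ^ L * n + (3 / 4) ^ L * n)) := by
    simp only [bad]
    rw [avg_add, h3]
    exact add_le_add h5 (h4.trans le_rfl)
  have h7 : (1 / (Fintype.card (Rand K L) : ℝ)) ≤ (1 / 2) ^ L := by
    rw [div_pow, one_pow]
    refine one_div_le_one_div_of_le (by positivity) ?_
    exact_mod_cast two_pow_le_card_rand hK0
  have h8 : ((1 : ℝ) / 2) ^ L ≤ (3 / 4) ^ L := pow_le_pow_left₀ (by norm_num) (by norm_num) L
  have h9 : (n : ℝ) ≤ n ^ 2 := by nlinarith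
  have h10 : (0 : ℝ) ≤ (3 / 4) ^ L := by positivity
  have h11 : (0 : ℝ) ≤ (1 / 2) ^ L := by positivity
  have e1 : (n : ℝ) ^ 2 * (1 / Fintype.card (Rand K L)) ≤ n ^ 2 * (3 / 4) ^ L :=
    mul_le_mul_of_nonneg_left (h7.trans h8) (by positivity)
  have e2 : ((1 : ℝ) / 2) ^ L * n ^ 2 ≤ (3 / 4) ^ L * n ^ 2 :=
    mul_le_mul_of_nonneg_right h8 (by positivity)
  have e3 : ((1 : ℝ) / 2) ^ L * n ≤ (3 / 4) ^ L * n ^ 2 :=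
    mul_le_mul h8 h9 (by positivity) h10
  have e4 : ((3 : ℝ) / 4) ^ L * n ≤ (3 / 4) ^ L * n ^ 2 := mul_le_mul_of_nonneg_left h9 h10
  rw [h2] at h1
  linarith

/-- The random strings can be read off from random bits. -/
theorem exists_rand_equiv (k L : ℕ) : ∃ bits : ℕ, Nonempty ((Fin bits → Bool) ≃ Rand (2 ^ k) L) := by
  refine ⟨k * L + (k * L + L), ⟨Fintype.equivOfCardEq ?_⟩⟩
  simp only [Rand, Fintype.card_prod, Fintype.card_fun, Fintype.card_fin, Fintype.card_bool]
  rw [← pow_mul, pow_add, pow_add]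

end Device

/-! ### Choice of the parameters. -/

theorem clog_le {n : ℕ} (hn : 2 ≤ n) : (Nat.clog 2 n : ℝ) ≤ 4 * Real.log n := by
  have h1 : 2 ^ (Nat.clog 2 n - 1) < n := Nat.pow_pred_clog_lt_self (by norm_num) (by omega)
  have h2 : 1 ≤ Nat.clog 2 n := Nat.clog_pos (by norm_num) hn
  have h3 : ((Nat.clog 2 n : ℝ) - 1) * Real.log 2 ≤ Real.log n := by
    have := Real.log_le_log (by positivity)
      (show ((2 : ℝ) ^ (Nat.clog 2 n - 1)) ≤ n by exact_mod_cast h1.le)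
    rw [Real.log_pow, Nat.cast_sub h2, Nat.cast_one] at this
    exact this
  have h4 : Real.log 2 ≤ Real.log n :=
    Real.log_le_log (by norm_num) (by exact_mod_cast hn)
  have h5 : (1 / 2 : ℝ) ≤ Real.log 2 := by
    have := Real.log_two_gt_d9
    linarith
  have h6 : (0 : ℝ) ≤ (Nat.clog 2 n : ℝ) - 1 := by
    have : (1 : ℝ) ≤ Nat.clog 2 n := by exact_mod_cast h2
    linarith
  nlinarith

/-- Since `(3/4)³ < 1/2`, the power is at most `n^-(c + 4)`, and `4 n² ≤ n⁴` absorbs the factor in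
front. -/
theorem failure_bound {n : ℕ} (hn : 2 ≤ n) (c : ℕ) :
    4 * (n : ℝ) ^ 2 * (3 / 4) ^ (3 * (c + 4) * Nat.clog 2 n) ≤ 1 / (n : ℝ) ^ c := by
  have hn' : (2 : ℝ) ≤ n := by exact_mod_cast hn
  have h1 : ((3 : ℝ) / 4) ^ (3 * (c + 4) * Nat.clog 2 n) ≤ (1 / (n : ℝ)) ^ (c + 4) := by
    have e : 3 * (c + 4) * Nat.clog 2 n = 3 * Nat.clog 2 n * (c + 4) := by ring
    rw [e, pow_mul, pow_mul]
    refine pow_le_pow_left₀ (by positivity) ?_ _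
    calc (((3 : ℝ) / 4) ^ 3) ^ Nat.clog 2 n ≤ (1 / 2) ^ Nat.clog 2 n :=
          pow_le_pow_left₀ (by norm_num) (by norm_num) _
      _ ≤ 1 / n := by
          rw [div_pow, one_pow]
          refine one_div_le_one_div_of_le (by linarith) ?_
          exact_mod_cast Nat.le_pow_clog (by norm_num) n
  refine (mul_le_mul_of_nonneg_left h1 (by positivity)).trans ?_
  have h2 : (0 : ℝ) < (n : ℝ) ^ c := by positivity
  rw [div_pow, one_pow, mul_one_div, div_le_div_iff₀ (by positivity) h2, one_mul, pow_add]
  have h3 : 4 * (n : ℝ) ^ 2 ≤ n ^ 4 := by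
    nlinarith [mul_nonneg (sq_nonneg (n : ℝ)) (by nlinarith : (0 : ℝ) ≤ n ^ 2 - 4)]
  calc 4 * (n : ℝ) ^ 2 * n ^ c ≤ n ^ 4 * n ^ c := mul_le_mul_of_nonneg_right h3 h2.le
    _ = n ^ c * n ^ 4 := mul_comm _ _

theorem exists_broadcast_protocol (Δ c : ℕ) : ∃ C : ℝ, 0 < C ∧
    ∀ (M : Type) (n : ℕ), ∃ P : Protocol .noCD M,
      (P.time : ℝ) ≤ C * (n * Real.log n) ∧
      ∀ (V : Type) [Fintype V] (G : SimpleGraph V) (s : V) (m : M),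
        Fintype.card V = n → G.Connected → (∀ v, (G.neighborSet v).ncard ≤ Δ) →
        (∀ ω v, (P.energy G s m ω v : ℝ) ≤ C * Real.log n) ∧
        1 - 1 / (n : ℝ) ^ c ≤ P.prob (fun ω => P.Succeeds G s m ω) := by
  -- The number of colours is a power of two, so that a uniform colour is exactly `k` fair bits.
  obtain ⟨k, hk⟩ : ∃ k, 4 * (Δ + 1) ^ 2 ≤ 2 ^ k := ⟨_, Nat.lt_two_pow_self.le⟩
  -- Here `156 = 13 * 12`: the energy is at most `2^k * 13 L` with `L ≤ 12 (c + 4) log n`. The time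
  -- needs only `8 * 12`.
  refine ⟨156 * 2 ^ k * (c + 4), by positivity, fun M n => ?_⟩
  rcases Nat.lt_or_ge n 2 with hn | hn
  -- For `n < 2` the bounds force zero slots and zero energy, while the required probability of
  -- success is `1 - 1 = 0`.
  · have hlog : Real.log (n : ℝ) = 0 := by interval_cases n <;> simp
    refine ⟨⟨Unit, Option M, 0, 0, fun o _ => o, fun _ _ => .idle, fun _ s _ => s, id⟩,
      by simp [hlog], fun V _ G s m hV hG hΔ => ⟨fun ω v => by simp [hlog, Protocol.energy], ?_⟩⟩
    obtain rfl : n = 1 := by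
      have : 0 < Fintype.card V := Fintype.card_pos_iff.2 ⟨s⟩
      omega
    simp only [Nat.cast_one, one_pow, div_one, sub_self]
    exact div_nonneg (Nat.cast_nonneg _) (Nat.cast_nonneg _)
  · set l := Nat.clog 2 n with hl
    obtain ⟨bits, ⟨E⟩⟩ := Device.exists_rand_equiv k (3 * (c + 4) * l)
    have hl1 : 1 ≤ l := Nat.clog_pos (by norm_num) hn
    have hlog := clog_le hn
    rw [← hl] at hlog
    have hL1 : 1 ≤ 3 * (c + 4) * l := Nat.mul_pos (by omega) hl1
    set L := 3 * (c + 4) * l with hL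
    have hLlog : (L : ℝ) ≤ 12 * (c + 4) * Real.log n := by
      rw [hL]
      push_cast
      have : (0 : ℝ) ≤ c := Nat.cast_nonneg c
      nlinarith
    refine ⟨Device.broadcast M n ⟨0, Nat.two_pow_pos k⟩ E, ?_, ?_⟩
    · rw [Device.time_broadcast]
      have h1 : L + L * 2 + L * (2 * n + 3) + (2 * n + 2) ≤ 8 * n * L := by nlinarith
      have h2 : ((2 ^ k * (L + L * 2 + L * (2 * n + 3) + (2 * n + 2)) : ℕ) : ℝ) ≤
          2 ^ k * (8 * n * L) := by exact_mod_cast Nat.mul_le_mul_left _ h1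
      refine h2.trans ?_
      have h3 : (8 * n * L : ℝ) ≤ 8 * n * (12 * (c + 4) * Real.log n) :=
        mul_le_mul_of_nonneg_left hLlog (by positivity)
      have h4 : (0 : ℝ) ≤ (c + 4) * n * Real.log n :=
        mul_nonneg (by positivity) (Real.log_natCast_nonneg n)
      calc (2 : ℝ) ^ k * (8 * n * L) ≤ 2 ^ k * (156 * ((c + 4) * n * Real.log n)) :=
            mul_le_mul_of_nonneg_left (by linarith) (by positivity)
        _ = 156 * 2 ^ k * (c + 4) * (n * Real.log n) := by ring
    · intro V _ G s m hV hG hΔ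
      subst hV
      refine ⟨fun ω v => ?_, ?_⟩
      · have h1 : (Device.broadcast M (Fintype.card V) ⟨0, Nat.two_pow_pos k⟩ E).energy G s m ω v ≤
            2 ^ k * (13 * L) :=
          (Device.energy_broadcast_le _ _ E s m ω v).trans (Nat.mul_le_mul_left _ (by omega))
        have h2 : ((Device.broadcast M (Fintype.card V) ⟨0, Nat.two_pow_pos k⟩ E).energy G s m ω v
            : ℝ) ≤ 2 ^ k * (13 * L) := by exact_mod_cast h1
        refine h2.trans ?_
        calc (2 : ℝ) ^ k * (13 * L) ≤ 2 ^ k * (13 * (12 * (c + 4) * Real.log (Fintype.card V))) := by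
              gcongr
          _ = 156 * 2 ^ k * (c + 4) * Real.log (Fintype.card V) := by ring
      · refine le_trans ?_ (Device.le_prob_broadcast hG hΔ _ hk E s m)
        have := failure_bound hn c
        linarith

end Radio

theorem mainTheorem8 :
    (∀ Δ c : ℕ, ∃ C : ℝ, 0 < C ∧
      ∀ (M : Type) (n : ℕ), ∃ P : Radio.Protocol .noCD M,
        (P.time : ℝ) ≤ C * (n * Real.log n) ∧
        ∀ (V : Type) [Fintype V] (G : SimpleGraph V) (s : V) (m : M),
          Fintype.card V = n → G.Connected → (∀ v, (G.neighborSet v).ncard ≤ Δ) →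
          (∀ ω v, (P.energy G s m ω v : ℝ) ≤ C * Real.log n) ∧
          1 - 1 / (n : ℝ) ^ c ≤ P.prob (fun ω => P.Succeeds G s m ω)) ∧
    (∀ (M : Type) (n : ℕ) (P : Radio.Protocol .LOCAL M) (S : Finset M),
      ∑ m ∈ S, P.prob (fun ω =>
          P.Succeeds (SimpleGraph.pathGraph (n + 1)) 0 m ω ∧
          ∀ v, (P.energy (SimpleGraph.pathGraph (n + 1)) 0 m ω v : ℝ) <
            1 / 5 * Real.logb 2 ((n + 1 : ℕ) : ℝ)) ≤
        ((S.card : ℝ) + 1) / 2) :=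
  ⟨Radio.exists_broadcast_protocol, fun _ n P S => P.sum_prob_path_le n S⟩
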